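/- **Setting.** Let $\hbar>0$, $\xi>0$, let $k\ge 1$ be an integer, $1/\eta=\hbar\xi$, $1/\eta'=\hbar(\xi+k)$, and $s_A(t)=\sinh\frac{\hbar At}{2}$. Let $a_j(t)$ ($j=0,1,2$, $t\in\mathbb R\setminus\{0\}$) be bosons with $[a_i(t),a_j(t')]=\delta_{ij}c_j(t)\delta(t+t')$, $$c_0=\frac{s_2s_ks_{\xi+k}}{\hbar^2t\,s_\xi},\qquad c_1=\frac{s_2s_{k+2}}{\hbar^2t},\qquad c_2=-\frac{s_2s_k}{\hbar^2t},$$ where $a_j(t)$ annihilates the vacuum for $t>0$ and creates for $t<0$, and let $a_0'(t)=\frac{s_\xi(t)}{s_{\xi+k}(t)}a_0(t)$. Put $$\phi_j(A;B,C|\alpha;D)=\hbar\int_{-\infty}^{\infty}\frac{s_A(t)}{s_B(t)s_C(t)}a_j(t)e^{i\alpha t+\frac{\hbar D}{2}|t|}dt,\qquad \phi_j^{(\pm)}(A;B|\alpha;D)=2\hbar\int_0^\infty\frac{s_A(t)}{s_B(t)}a_j(\pm t)e^{\pm i\alpha t+\frac{\hbar D}{2}t}dt,$$ let $\phi_0'$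 be $\phi_0$ with $a_0'$ in place of $a_0$, omit $D$ when $D=0$, and write $\phi_j(C|\alpha;D)$ when $A=B$. The currents are $E(\alpha)=\Psi^-(\alpha):e^{-\phi_0(k|\alpha)}:$ and $F(\alpha)=\Psi^+(\alpha):e^{\phi_0'(k|\alpha)}:$ (normal ordered throughout) with $$\Psi^{\pm}(\alpha)=\mp\tfrac1\hbar:e^{\pm\phi_2(k|\alpha;\pm\frac k2)}\Bigl(e^{-\phi_2^{(+)}(1;2|\alpha;\mp\frac{k+2}2)\pm\phi_1^{(+)}(1;2|\alpha;\mp\frac k2)}-e^{\phi_2^{(-)}(1;2|\alpha;\mp\frac{k+2}2)\mp\phi_1^{(-)}(1;2|\alpha;\mp\frac k2)}\Bigr):,$$ and $h^\pm(\alpha)=\frac{\sin\pi\eta\hbar}{\pi\eta\hbar}H^\pm(\alpha)$, where $H^\pm(\alpha)=\kappa:K\bigl(\alpha+\tfrac{i\hbar}2(\pm(\xi+\tfrac k2)+1)\bigr)K\bigl(\alpha+\tfrac{i\hbar}2(\pm(\xi+\tfrac k2)-1)\bigr):$, $K(\alpha)=:e^{-\phi_0(1;2,\xi+k|\alpha)}:$,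 and $\kappa\in\mathbb C$ is an arbitrary normalization constant. *Products.* Operators are given by their matrix elements between the exponential vectors $\langle \mathrm{vac}|e^{\sum_j\int_0^\infty g_j(t)a_j(t)dt}$ and $e^{\sum_j\int_0^\infty f_j(t)a_j(-t)dt}|\mathrm{vac}\rangle$ with $f_j,g_j\in C_c((0,\infty))$. A product of two normal ordered exponentials, with spectral parameters $\gamma$ (of a current) and $\zeta$, is the normal ordered exponential of the sum of the exponents times the exponential of the commutator of the annihilation part of the first exponent with the creation part of the second; this commutator is an integral over $(0,\infty)$, regularized at $t=0$ by its finite part (the $\log\varepsilon$ term is dropped), which converges when $\operatorname{Im}(\gamma-\zeta)$ is large (current on the left) or very negative (current on the right), and its exponential is continued meromorphically in $\gamma$ to $\mathbb C$. For a contour $C$ from $-\infty$ to $+\infty$ (a $C^1$ curve, horizontal near both ends) put $$e^\pm(\alpha)=\sin(\pi\eta\hbar)\int_C\frac{d\gamma}{2\pi i}\frac{E(\gamma)}{\operatorname{sh}\pi\eta(\alpha-\gamma\pm\frac{i\hbar k}4)},\qquad f^\pm(\alpha)=\sin(\pi\eta'\hbar)\int_C\frac{d\gamma}{2\pi i}\frac{F(\gamma)}{\operatorname{sh}\pi\eta'(\alpha-\gamma\mp\frac{i\hbar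 k}4)};$$ products of these with an operator at $\zeta$ are the integrals over the same $C$ of the continued products, for every $C$ that avoids the poles of both products (of current and operator, in either order) and of the kernel. *Vertex operators.* For $n\ge0$ let $\phi_{n,\pm n}(\zeta)=:\exp\{-\phi_2(\pm n;2,k|\zeta;\pm\frac k2)-\phi_1(n;2,k+2|\zeta;\pm\frac{k+2}2)\}:$, and for $0\le l\le k$ let (normal ordered) $$\Phi^{(l)}_l=\phi_{l,l}(\zeta):e^{-\phi_0'(l;2,k|\zeta)}:,\quad \Psi^{(l)*}_l=\phi_{l,-l}(\zeta):e^{\phi_0(l;2,k|\zeta)}:,\quad \tilde\Phi^{(l)}_l=\phi_{k-l,-(k-l)}(\zeta):e^{-\phi_0'(l;2,k|\zeta)}:,\quad \tilde\Psi^{(l)*}_l=\phi_{k-l,k-l}(\zeta):e^{\phi_0(l;2,k|\zeta)}:.$$ **Proposition 4.3.** Let $0\le l\le k$. All products below exist in the above sense, all integrals converge absolutely, and, with $\nu=1$ for $(\Phi,\Psi^*)=(\Phi^{(l)}_l(\zeta),\Psi^{(l)*}_l(\zeta))$ and with $\nu=-1$ for $(\Phi,\Psi^*)=(\tilde\Phi^{(l)}_l(\zeta),\tilde\Psi^{(l)*}_l(\zeta))$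 (twisted relations, for the involution $\iota$ that multiplies $e^\pm,f^\pm$ by $-1$ and fixes $h^\pm$), the following highest-component intertwining relations hold. Type I, away from poles: $$\Phi\,h^\pm(\alpha)=\frac{\operatorname{sh}\pi\eta'(\alpha-\zeta+\frac{i\hbar}2(l\mp\frac k2))}{\operatorname{sh}\pi\eta'(\alpha-\zeta-\frac{i\hbar}2(l\pm\frac k2))}\,h^\pm(\alpha)\,\Phi,\qquad e^\pm(\alpha)\,\Phi=\nu\,\Phi\,e^\pm(\alpha),$$ and for each contour $C$ there is an operator $\Phi_{l-1}(\zeta)$, the same for all $\alpha$ and for both signs, and zero if $l=0$, such that $$\operatorname{sh}(i\pi\eta'\hbar)\,\Phi_{l-1}(\zeta)=\operatorname{sh}\pi\eta'\bigl(\alpha-\zeta+\tfrac{i\hbar}2(l\mp\tfrac k2)\bigr)f^\pm(\alpha)\,\Phi-\nu\,\operatorname{sh}\pi\eta'\bigl(\alpha-\zeta-\tfrac{i\hbar}2(l\pm\tfrac k2)\bigr)\Phi\,f^\pm(\alpha).$$ Type II, away from poles: $$h^\pm(\alpha)\,\Psi^*=\frac{\operatorname{sh}\pi\eta(\alpha-\zeta+\frac{i\hbar}2(l\pm\frac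 k2))}{\operatorname{sh}\pi\eta(\alpha-\zeta-\frac{i\hbar}2(l\mp\frac k2))}\,\Psi^*\,h^\pm(\alpha),\qquad f^\pm(\alpha)\,\Psi^*=\nu\,\Psi^*f^\pm(\alpha),$$ and for each contour $C$ there is an operator $\Psi^*_{l-1}(\zeta)$, the same for all $\alpha$ and for both signs, and zero if $l=0$, such that $$\operatorname{sh}(i\pi\eta\hbar l)\,\Psi^*_{l-1}(\zeta)=\operatorname{sh}\pi\eta\bigl(\alpha-\zeta+\tfrac{i\hbar}2(l\pm\tfrac k2)\bigr)\Psi^*e^\pm(\alpha)-\nu\,\operatorname{sh}\pi\eta\bigl(\alpha-\zeta-\tfrac{i\hbar}2(l\mp\tfrac k2)\bigr)e^\pm(\alpha)\,\Psi^*.$$ -/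

import Mathlib

/-! # Free boson vertex operators for the algebra `A_{ħ,η}(sl₂^)` at level `k`

The bosons are `a_j(t)`, `j = 0, 1, 2`, `t ∈ ℝ ∖ {0}`, with
`[a_j(t), a_j(t')] = c_j(t) δ(t + t')` and `[a_i(t), a_j(t')] = 0` for `i ≠ j`; `a_j(t)` with `t > 0`
annihilates the vacuum and `a_j(t)` with `t < 0` creates.  A normal ordered exponential
`:exp(∑_j ∫ X_j(t) a_j(t) dt):` is recorded by its coefficient function `X`. -/

namespace AhEta

/-- The parameters: `ħ > 0`, `ξ > 0` and a positive integer level `k` (the value of `c`). -/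
structure Params where
  hbar : ℝ
  xi : ℝ
  level : ℕ
  hbar_pos : 0 < hbar
  xi_pos : 0 < xi
  level_pos : 0 < level

namespace Params

/-- The level as a real number. -/
def k (P : Params) : ℝ := (P.level : ℝ)

/-- `η`, with `1/η = ħ ξ`. -/
noncomputable def eta (P : Params) : ℝ := 1 / (P.hbar * P.xi)

/-- `η'`, with `1/η' = ħ (ξ + k)`, so that `1/η' - 1/η = ħ k`. -/
noncomputable def eta' (P : Params) : ℝ := 1 / (P.hbar * (P.xi + P.k))

/-- `sinh (ħ A t / 2)`. -/
noncomputable def s (P : Params) (A t : ℝ) : ℝ := Real.sinh (P.hbar * A * t / 2)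

/-- `sh (π η x)` -/
noncomputable def shEta (P : Params) (x : ℂ) : ℂ := Complex.sinh ((Real.pi * P.eta : ℝ) * x)

/-- `sh (π η' x)` -/
noncomputable def shEta' (P : Params) (x : ℂ) : ℂ := Complex.sinh ((Real.pi * P.eta' : ℝ) * x)

end Params

/-- The sign `±` as a complex number. -/
def sgn (σ : ℤˣ) : ℂ := ((σ : ℤ) : ℂ)

/-- The coefficient functions `c_j(t)` of the commutation relations
`[a_j(t), a_j(t')] = c_j(t) δ(t + t')`. -/
noncomputable def comm (P : Params) (j : Fin 3) (t : ℝ) : ℝ :=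
  ![P.s 2 t * P.s P.k t * P.s (P.xi + P.k) t / (P.hbar ^ 2 * t * P.s P.xi t),
    P.s 2 t * P.s (P.k + 2) t / (P.hbar ^ 2 * t),
    -(P.s 2 t * P.s P.k t / (P.hbar ^ 2 * t))] j

/-- `X : Exponent` stands for the linear combination `∑_j ∫ X_j(t) a_j(t) dt` of the bosons. -/
abbrev Exponent : Type := Fin 3 → ℝ → ℂ

/-! ### The boson fields -/

/-- The field `φ_j(A;B,C|α;D)
= ħ ∫ dt sinh(ħAt/2) / (sinh(ħBt/2) sinh(ħCt/2)) a_j(t) e^{iαt + ħD|t|/2}`. -/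
noncomputable def phi (P : Params) (j : Fin 3) (A B C : ℝ) (α : ℂ) (D : ℝ) : Exponent :=
  Pi.single j fun t =>
    ((P.hbar * (P.s A t / (P.s B t * P.s C t)) : ℝ) : ℂ) *
      Complex.exp (Complex.I * α * (t : ℂ) + ((P.hbar * D / 2 * |t| : ℝ) : ℂ))

/-- The field `φ'_0(A;B,C|α;D)`, where `a_0` is replaced with
`a'_0(t) = sinh(ħξt/2) / sinh(ħ(ξ+k)t/2) a_0(t)`. -/
noncomputable def phi' (P : Params) (A B C : ℝ) (α : ℂ) (D : ℝ) : Exponent := fun j t =>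
  ((P.s P.xi t / P.s (P.xi + P.k) t : ℝ) : ℂ) * phi P 0 A B C α D j t

/-- The coefficient common to `φ_j^{(+)}(A;B|α;D)` (on `t > 0`) and `φ_j^{(-)}(A;B|α;D)`
(on `t < 0`). -/
noncomputable def halfCoeff (P : Params) (A B : ℝ) (α : ℂ) (D : ℝ) (t : ℝ) : ℂ :=
  ((2 * P.hbar * (P.s A t / P.s B t) : ℝ) : ℂ) *
    Complex.exp (Complex.I * α * (t : ℂ) + ((P.hbar * D / 2 * |t| : ℝ) : ℂ))

/-- `φ_j^{(+)}(A;B|α;D) = 2ħ ∫_0^∞ dt sinh(ħAt/2) / sinh(ħBt/2) a_j(t) e^{iαt + ħDt/2}`. -/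
noncomputable def phiPlus (P : Params) (j : Fin 3) (A B : ℝ) (α : ℂ) (D : ℝ) : Exponent :=
  Pi.single j ((Set.Ioi (0 : ℝ)).indicator (halfCoeff P A B α D))

/-- `φ_j^{(-)}(A;B|α;D) = 2ħ ∫_0^∞ dt sinh(ħAt/2) / sinh(ħBt/2) a_j(-t) e^{-iαt + ħDt/2}`. -/
noncomputable def phiMinus (P : Params) (j : Fin 3) (A B : ℝ) (α : ℂ) (D : ℝ) : Exponent :=
  Pi.single j ((Set.Iio (0 : ℝ)).indicator (halfCoeff P A B α D))

/-! ### Currents and vertex operators -/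

/-- An operator valued function `α ↦ ∑_i b_i :exp X_i(α):`, given as the list of the `(b_i, X_i)`. -/
abbrev VertexField : Type := List (ℂ × (ℂ → Exponent))

/-- The exponents of the two terms of the parafermion current `Ψ^τ(α)`, `τ = ±1`:
`first = true` gives
`τ φ_2(k|α;τk/2) - φ_2^{(+)}(1;2|α;-τ(k+2)/2) + τ φ_1^{(+)}(1;2|α;-τk/2)` and `first = false` gives
`τ φ_2(k|α;τk/2) + φ_2^{(-)}(1;2|α;-τ(k+2)/2) - τ φ_1^{(-)}(1;2|α;-τk/2)`.
Here `φ_2(k|α;D) = φ_2(1;1,k|α;D)`. -/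
noncomputable def paraExp (P : Params) (τ : ℝ) (first : Bool) (α : ℂ) : Exponent :=
  (τ : ℂ) • phi P 2 1 1 P.k α (τ * P.k / 2) +
    bif first then
      -phiPlus P 2 1 2 α (-τ * (P.k + 2) / 2) + (τ : ℂ) • phiPlus P 1 1 2 α (-τ * P.k / 2)
    else
      phiMinus P 2 1 2 α (-τ * (P.k + 2) / 2) - (τ : ℂ) • phiMinus P 1 1 2 α (-τ * P.k / 2)

/-- The current `E(α) = Ψ^-(α) :exp(-φ_0(k|α)):`, where
`Ψ^-(α) = (1/ħ) (:exp(first exponent): - :exp(second exponent):)`. -/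
noncomputable def E (P : Params) : VertexField :=
  [((1 / P.hbar : ℝ), fun α => paraExp P (-1) true α - phi P 0 1 1 P.k α 0),
   ((-(1 / P.hbar) : ℝ), fun α => paraExp P (-1) false α - phi P 0 1 1 P.k α 0)]

/-- The current `F(α) = Ψ^+(α) :exp(φ'_0(k|α)):`, where
`Ψ^+(α) = -(1/ħ) (:exp(first exponent): - :exp(second exponent):)`. -/
noncomputable def F (P : Params) : VertexField :=
  [((-(1 / P.hbar) : ℝ), fun α => paraExp P 1 true α + phi' P 1 1 P.k α 0),
   ((1 / P.hbar : ℝ), fun α => paraExp P 1 false α + phi' P 1 1 P.k α 0)]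

/-- The exponent `-φ_0(1;2,ξ+k|α)` of the current `k(α)`. -/
noncomputable def kExp (P : Params) (α : ℂ) : Exponent := -phi P 0 1 2 (P.xi + P.k) α 0

/-- The Cartan currents `h^±(α) = sin(πηħ)/(πηħ) H^±(α)`, where `H^±(α)` is a constant `κ` times
the normal ordered product of `k(α + iħ(±(ξ+k/2)+1)/2)` and `k(α + iħ(±(ξ+k/2)-1)/2)`. -/
noncomputable def h (P : Params) (κ : ℂ) (σ : ℤˣ) : VertexField :=
  [(κ * ((Real.sin (Real.pi * P.eta * P.hbar) / (Real.pi * P.eta * P.hbar) : ℝ) : ℂ), fun α =>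
    kExp P (α + Complex.I * P.hbar / 2 * (sgn σ * (P.xi + P.k / 2 : ℝ) + 1)) +
    kExp P (α + Complex.I * P.hbar / 2 * (sgn σ * (P.xi + P.k / 2 : ℝ) - 1)))]

/-- The exponent of the parafermion primary field `φ_{n,τn}(ζ)`, `τ = ±1`:
`-φ_2(τn;2,k|ζ;τk/2) - φ_1(n;2,k+2|ζ;τ(k+2)/2)`. -/
noncomputable def primaryExp (P : Params) (n : ℕ) (τ : ℝ) (ζ : ℂ) : Exponent :=
  -phi P 2 (τ * n) 2 P.k ζ (τ * P.k / 2) - phi P 1 n 2 (P.k + 2) ζ (τ * (P.k + 2) / 2)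

/-- `Φ^{(l)}_l(ζ) = φ_{l,l}(ζ) :exp(-φ'_0(l;2,k|ζ)):` -/
noncomputable def PhiTop (P : Params) (l : ℕ) : VertexField :=
  [(1, fun ζ => primaryExp P l 1 ζ - phi' P l 2 P.k ζ 0)]

/-- `Ψ^{(l)*}_l(ζ) = φ_{l,-l}(ζ) :exp(φ_0(l;2,k|ζ)):` -/
noncomputable def PsiTop (P : Params) (l : ℕ) : VertexField :=
  [(1, fun ζ => primaryExp P l (-1) ζ + phi P 0 l 2 P.k ζ 0)]

/-- The twisted `Φ̃^{(l)}_l(ζ) = φ_{k-l,-(k-l)}(ζ) :exp(-φ'_0(l;2,k|ζ)):`, for `l ≤ k`. -/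
noncomputable def PhiTwisted (P : Params) (l : ℕ) : VertexField :=
  [(1, fun ζ => primaryExp P (P.level - l) (-1) ζ - phi' P l 2 P.k ζ 0)]

/-- The twisted `Ψ̃^{(l)*}_l(ζ) = φ_{k-l,k-l}(ζ) :exp(φ_0(l;2,k|ζ)):`, for `l ≤ k`. -/
noncomputable def PsiTwisted (P : Params) (l : ℕ) : VertexField :=
  [(1, fun ζ => primaryExp P (P.level - l) 1 ζ + phi P 0 l 2 P.k ζ 0)]

/-! ### Matrix elements -/

/-- A test state: three test functions in `C_c((0,∞))`.  It defines the exponential vector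
`|f⟩ = exp(∑_j ∫_0^∞ f_j(t) a_j(-t) dt) |vac⟩` and the dual exponential vector
`⟨g| = ⟨vac| exp(∑_j ∫_0^∞ g_j(t) a_j(t) dt)`.  An operator on the Fock space is given by its matrix
elements between these. -/
structure TestState where
  toFun : Fin 3 → ℝ → ℂ
  cont : ∀ j, Continuous (toFun j)
  compact : ∀ j, HasCompactSupport (toFun j)
  pos : ∀ j, tsupport (toFun j) ⊆ Set.Ioi 0

/-- Operators on the Fock space, through their matrix elements `(g, f) ↦ ⟨g| O |f⟩`. -/
abbrev Op : Type := TestState → TestState → ℂ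

/-- The matrix element `⟨g| :exp X: |f⟩`. -/
noncomputable def normalOrdered (P : Params) (X : Exponent) : Op := fun g f =>
  Complex.exp (∑ j : Fin 3, ∫ t in Set.Ioi (0 : ℝ),
    (X j t * f.toFun j t + g.toFun j t * X j (-t) + g.toFun j t * f.toFun j t) * (comm P j t : ℂ))

/-- The integrand of the contraction of `:exp X: :exp Y:`: the commutator of the annihilation part
of `X` with the creation part of `Y` is `∫_0^∞ contractionDensity P X Y t dt`. -/
noncomputable def contractionDensity (P : Params) (X Y : Exponent) (t : ℝ) : ℂ :=
  ∑ j : Fin 3, X j t * Y j (-t) * (comm P j t : ℂ)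

/-- `L` is the regularized value of `∫_0^∞ w(t) dt`, for `w` with at most a simple pole at `t = 0`:
the finite part, where the term proportional to `log ε` of `∫_ε^∞ w(t) dt` is dropped.  (It is the
value of `∫_C w(t) log(-t) dt/(2πi)` for a contour `C` coming from `+∞`, going round `0`, and going
back to `+∞`.) -/
def IsFinitePart (w : ℝ → ℂ) (L : ℂ) : Prop :=
  (∀ ε : ℝ, 0 < ε → MeasureTheory.IntegrableOn w (Set.Ioi ε)) ∧
    ∃ B : ℂ, Filter.Tendsto
      (fun ε : ℝ => (∫ t in Set.Ioi ε, w t) + B * ((Real.log ε : ℝ) : ℂ))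
      (nhdsWithin 0 (Set.Ioi 0)) (nhds L)

/-- `M` is the meromorphic continuation to `ℂ` of the function `γ ↦ exp(∫_0^∞ W γ t dt)`
(regularized integral), which has to converge for all `γ` in a set of the filter `𝓕` (here a half
plane `Im γ > R` or `Im γ < R`).  The normal form makes `M` unique: removable singularities are
removed. -/
def IsContinuation (W : ℂ → ℝ → ℂ) (𝓕 : Filter ℂ) (M : ℂ → ℂ) : Prop :=
  MeromorphicNFOn M Set.univ ∧ ∀ᶠ γ in 𝓕, ∃ L : ℂ, IsFinitePart (W γ) L ∧ M γ = Complex.exp L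

open Classical in
/-- The continuation of `IsContinuation`, where it exists. -/
noncomputable def continuation (W : ℂ → ℝ → ℂ) (𝓕 : Filter ℂ) : ℂ → ℂ :=
  if hM : ∃ M, IsContinuation W 𝓕 M then hM.choose else 0

/-- Half planes `Im γ > R`. -/
def upper : Filter ℂ := Filter.comap Complex.im Filter.atTop

/-- Half planes `Im γ < R`. -/
def lower : Filter ℂ := Filter.comap Complex.im Filter.atBot

/-- The density of the contraction of `:exp X(γ): :exp Y(ζ):`, with `ζ` fixed. -/
noncomputable def densityL (P : Params) (X Y : ℂ → Exponent) (ζ γ : ℂ) : ℝ → ℂ :=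
  contractionDensity P (X γ) (Y ζ)

/-- The density of the contraction of `:exp Y(ζ): :exp X(γ):`, with `ζ` fixed. -/
noncomputable def densityR (P : Params) (X Y : ℂ → Exponent) (ζ γ : ℂ) : ℝ → ℂ :=
  contractionDensity P (Y ζ) (X γ)

/-- The contraction of `:exp X(γ): :exp Y(ζ):`, continued in `γ` from `Im γ ≫ 0`. -/
noncomputable def contrL (P : Params) (X Y : ℂ → Exponent) (ζ : ℂ) : ℂ → ℂ :=
  continuation (densityL P X Y ζ) upper

/-- The contraction of `:exp Y(ζ): :exp X(γ):`, continued in `γ` from `Im γ ≪ 0`. -/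
noncomputable def contrR (P : Params) (X Y : ℂ → Exponent) (ζ : ℂ) : ℂ → ℂ :=
  continuation (densityR P X Y ζ) lower

/-- The products `A(γ)B(ζ)` and `B(ζ)A(γ)` exist: every contraction converges in a half plane and
has a meromorphic continuation in `γ` to the whole plane. -/
def HasProducts (P : Params) (A B : VertexField) : Prop :=
  ∀ ζ : ℂ, ∀ p ∈ A, ∀ q ∈ B,
    (∃ M, IsContinuation (densityL P p.2 q.2 ζ) upper M) ∧
    (∃ M, IsContinuation (densityR P p.2 q.2 ζ) lower M)

/-- The point `γ` is not a pole of `A(γ)B(ζ)` or of `B(ζ)A(γ)`. -/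
def IsRegular (P : Params) (A B : VertexField) (ζ γ : ℂ) : Prop :=
  ∀ p ∈ A, ∀ q ∈ B, AnalyticAt ℂ (contrL P p.2 q.2 ζ) γ ∧ AnalyticAt ℂ (contrR P p.2 q.2 ζ) γ

/-- The product `A(γ)B(ζ)`, continued in `γ` from `Im γ ≫ 0`: by Wick's theorem
`:exp X: :exp Y: = (contraction) :exp (X + Y):`. -/
noncomputable def mulL (P : Params) (A B : VertexField) (γ ζ : ℂ) : Op := fun g f =>
  (A.map fun p => (B.map fun q =>
    p.1 * q.1 * contrL P p.2 q.2 ζ γ * normalOrdered P (p.2 γ + q.2 ζ) g f).sum).sum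

/-- The product `B(ζ)A(γ)`, continued in `γ` from `Im γ ≪ 0`. -/
noncomputable def mulR (P : Params) (A B : VertexField) (γ ζ : ℂ) : Op := fun g f =>
  (A.map fun p => (B.map fun q =>
    p.1 * q.1 * contrR P p.2 q.2 ζ γ * normalOrdered P (p.2 γ + q.2 ζ) g f).sum).sum

/-! ### The half currents -/

/-- A contour from `-∞` to `+∞` in the complex plane: a `C¹` curve that is horizontal near both
ends. -/
structure Contour where
  path : ℝ → ℂ
  smooth : ContDiff ℝ 1 path
  left_end : ∃ R b : ℝ, ∀ x ≤ R, path x = (x : ℂ) + (b : ℂ) * Complex.I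
  right_end : ∃ R b : ℝ, ∀ x ≥ R, path x = (x : ℂ) + (b : ℂ) * Complex.I

/-- `∫_C G(γ) dγ/(2πi)` converges absolutely. -/
def Contour.Converges (C : Contour) (G : ℂ → ℂ) : Prop :=
  MeasureTheory.Integrable fun x : ℝ => G (C.path x) * deriv C.path x

/-- `∫_C G(γ) dγ/(2πi)` -/
noncomputable def Contour.integral (C : Contour) (G : ℂ → ℂ) : ℂ :=
  (2 * Real.pi * Complex.I)⁻¹ * ∫ x : ℝ, G (C.path x) * deriv C.path x

/-- The denominator `sh πη(α - γ ± iħk/4)` of the kernel of `e^±(α)`. -/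
noncomputable def eDen (P : Params) (σ : ℤˣ) (α γ : ℂ) : ℂ :=
  P.shEta (α - γ + sgn σ * (Complex.I * P.hbar * P.k / 4))

/-- The denominator `sh πη'(α - γ ∓ iħk/4)` of the kernel of `f^±(α)`. -/
noncomputable def fDen (P : Params) (σ : ℤˣ) (α γ : ℂ) : ℂ :=
  P.shEta' (α - γ - sgn σ * (Complex.I * P.hbar * P.k / 4))

/-- The kernel of `e^±(α) = sin(πηħ) ∫_C dγ/(2πi) E(γ) / sh πη(α - γ ± iħk/4)`. -/
noncomputable def eKer (P : Params) (σ : ℤˣ) (α γ : ℂ) : ℂ :=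
  ((Real.sin (Real.pi * P.eta * P.hbar) : ℝ) : ℂ) / eDen P σ α γ

/-- The kernel of `f^±(α) = sin(πη'ħ) ∫_C dγ/(2πi) F(γ) / sh πη'(α - γ ∓ iħk/4)`. -/
noncomputable def fKer (P : Params) (σ : ℤˣ) (α γ : ℂ) : ℂ :=
  ((Real.sin (Real.pi * P.eta' * P.hbar) : ℝ) : ℂ) / fDen P σ α γ

/-- `x(α) B(ζ)` for the half current `x(α) = ∫_C dγ/(2πi) K(γ) A(γ)`. -/
noncomputable def halfL (P : Params) (C : Contour) (K : ℂ → ℂ) (A B : VertexField) (ζ : ℂ) : Op :=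
  fun g f => C.integral fun γ => K γ * mulL P A B γ ζ g f

/-- `B(ζ) x(α)` for the half current `x(α) = ∫_C dγ/(2πi) K(γ) A(γ)`. -/
noncomputable def halfR (P : Params) (C : Contour) (K : ℂ → ℂ) (A B : VertexField) (ζ : ℂ) : Op :=
  fun g f => C.integral fun γ => K γ * mulR P A B γ ζ g f

/-- Both of the integrals `x(α) B(ζ)` and `B(ζ) x(α)` converge. -/
def HalfConverges (P : Params) (C : Contour) (K : ℂ → ℂ) (A B : VertexField) (ζ : ℂ) : Prop :=
  ∀ g f, C.Converges (fun γ => K γ * mulL P A B γ ζ g f) ∧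
    C.Converges (fun γ => K γ * mulR P A B γ ζ g f)

/-! ### The intertwining relations -/

/-- The components of the type I relations `Φ(ζ) ι(x) = Δ(x) Φ(ζ)` that involve only the
highest component `Φ = Φ^{(l)}_l` and the next one.  Here `ι` multiplies `e^±` and `f^±` by `ν` and fixes `h^±`:
`ν = 1` gives the untwisted relations and `ν = -1` the twisted ones. -/
structure TypeI (P : Params) (κ : ℂ) (l : ℕ) (ν : ℂ) (Φ : VertexField) : Prop where
  products : (∀ σ, HasProducts P (h P κ σ) Φ) ∧ HasProducts P (E P) Φ ∧ HasProducts P (F P) Φ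
  /-- `Φ h^±(α) = sh πη'(α-ζ+iħ(l∓k/2)/2) / sh πη'(α-ζ-iħ(l±k/2)/2) h^±(α) Φ` -/
  h_rel : ∀ (σ : ℤˣ) (α ζ : ℂ), IsRegular P (h P κ σ) Φ ζ α →
    P.shEta' (α - ζ - Complex.I * P.hbar / 2 * (l + sgn σ * (P.k / 2))) ≠ 0 →
    mulR P (h P κ σ) Φ α ζ =
      (P.shEta' (α - ζ + Complex.I * P.hbar / 2 * (l - sgn σ * (P.k / 2))) /
        P.shEta' (α - ζ - Complex.I * P.hbar / 2 * (l + sgn σ * (P.k / 2)))) •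
        mulL P (h P κ σ) Φ α ζ
  /-- `e^±(α) Φ = ν Φ e^±(α)` -/
  e_rel : ∀ (C : Contour) (ζ : ℂ), (∀ x, IsRegular P (E P) Φ ζ (C.path x)) →
    ∀ (σ : ℤˣ) (α : ℂ), (∀ x, eDen P σ α (C.path x) ≠ 0) →
      HalfConverges P C (eKer P σ α) (E P) Φ ζ ∧
      halfL P C (eKer P σ α) (E P) Φ ζ = ν • halfR P C (eKer P σ α) (E P) Φ ζ
  /-- There is an operator `Φ_{l-1}(ζ)`, the same for all `α` and both signs, with
  `sh(iπη'ħ) Φ_{l-1} = sh πη'(α-ζ+iħ(l∓k/2)/2) f^±(α) Φ - ν sh πη'(α-ζ-iħ(l±k/2)/2) Φ f^±(α)`;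
  it is zero for `l = 0`. -/
  f_rel : ∀ C : Contour, ∃ Φlow : ℂ → Op, (l = 0 → Φlow = 0) ∧
    ∀ ζ : ℂ, (∀ x, IsRegular P (F P) Φ ζ (C.path x)) →
    ∀ (σ : ℤˣ) (α : ℂ), (∀ x, fDen P σ α (C.path x) ≠ 0) →
      HalfConverges P C (fKer P σ α) (F P) Φ ζ ∧
      P.shEta' (Complex.I * P.hbar) • Φlow ζ =
        P.shEta' (α - ζ + Complex.I * P.hbar / 2 * (l - sgn σ * (P.k / 2))) •
            halfL P C (fKer P σ α) (F P) Φ ζ -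
          (ν * P.shEta' (α - ζ - Complex.I * P.hbar / 2 * (l + sgn σ * (P.k / 2)))) •
            halfR P C (fKer P σ α) (F P) Φ ζ

/-- The components of the type II relations `Ψ*(ζ) Δ(x) = ι(x) Ψ*(ζ)` that involve only
the highest component `Ψ = Ψ^{(l)*}_l` and the next one; `ν` is as in `TypeI`. -/
structure TypeII (P : Params) (κ : ℂ) (l : ℕ) (ν : ℂ) (Ψ : VertexField) : Prop where
  products : (∀ σ, HasProducts P (h P κ σ) Ψ) ∧ HasProducts P (E P) Ψ ∧ HasProducts P (F P) Ψ
  /-- `h^±(α) Ψ = sh πη(α-ζ+iħ(l±k/2)/2) / sh πη(α-ζ-iħ(l∓k/2)/2) Ψ h^±(α)` -/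
  h_rel : ∀ (σ : ℤˣ) (α ζ : ℂ), IsRegular P (h P κ σ) Ψ ζ α →
    P.shEta (α - ζ - Complex.I * P.hbar / 2 * (l - sgn σ * (P.k / 2))) ≠ 0 →
    mulL P (h P κ σ) Ψ α ζ =
      (P.shEta (α - ζ + Complex.I * P.hbar / 2 * (l + sgn σ * (P.k / 2))) /
        P.shEta (α - ζ - Complex.I * P.hbar / 2 * (l - sgn σ * (P.k / 2)))) •
        mulR P (h P κ σ) Ψ α ζ
  /-- `f^±(α) Ψ = ν Ψ f^±(α)` -/
  f_rel : ∀ (C : Contour) (ζ : ℂ), (∀ x, IsRegular P (F P) Ψ ζ (C.path x)) →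
    ∀ (σ : ℤˣ) (α : ℂ), (∀ x, fDen P σ α (C.path x) ≠ 0) →
      HalfConverges P C (fKer P σ α) (F P) Ψ ζ ∧
      halfL P C (fKer P σ α) (F P) Ψ ζ = ν • halfR P C (fKer P σ α) (F P) Ψ ζ
  /-- There is an operator `Ψ_{l-1}(ζ)`, the same for all `α` and both signs, with
  `sh(iπηħl) Ψ_{l-1} = sh πη(α-ζ+iħ(l±k/2)/2) Ψ e^±(α) - ν sh πη(α-ζ-iħ(l∓k/2)/2) e^±(α) Ψ`;
  it is zero for `l = 0`. -/
  e_rel : ∀ C : Contour, ∃ Ψlow : ℂ → Op, (l = 0 → Ψlow = 0) ∧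
    ∀ ζ : ℂ, (∀ x, IsRegular P (E P) Ψ ζ (C.path x)) →
    ∀ (σ : ℤˣ) (α : ℂ), (∀ x, eDen P σ α (C.path x) ≠ 0) →
      HalfConverges P C (eKer P σ α) (E P) Ψ ζ ∧
      P.shEta (Complex.I * P.hbar * l) • Ψlow ζ =
        P.shEta (α - ζ + Complex.I * P.hbar / 2 * (l + sgn σ * (P.k / 2))) •
            halfR P C (eKer P σ α) (E P) Ψ ζ -
          (ν * P.shEta (α - ζ - Complex.I * P.hbar / 2 * (l - sgn σ * (P.k / 2)))) •
            halfL P C (eKer P σ α) (E P) Ψ ζ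

end AhEta

namespace AhEta

open MeasureTheory Set Filter Topology

/-! ### Finite parts of integrals over the half line -/

/-! By Wick's theorem a product of a current term and a vertex operator is a scalar contraction
times a normal ordered exponential that is the same for both orders. The exchange relations
therefore reduce to comparing two scalar functions of `γ`. The logarithm of each is a regularized
integral of a plane wave `e^{±i(γ-ζ)t}` times a combination of hyperbolic functions, divided by `t`.

Only three kinds of density occur. If the density is zero, the operators commute. If it is a single
exponential `-e^{-at}/t`, the contraction is linear in `γ`, and the two orders differ by a sign.
Otherwise it is `(e^{-zbt} - e^{-wbt})/(1 - e^{-bt})/t`, and Malmsten's formula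
(`exists_hasFinitePart_gamma`) gives `Γ(z)/Γ(w)` up to a constant that depends on `w - z` only. The
opposite order then gives `Γ(1-w)/Γ(1-z)` with the same constant, so the reflection formula
(`Gamma_div_Gamma_mul_sin`) turns the ratio of the two orders into a ratio of sines. These are the
factors `sh πη` and `sh πη'`; see `Exchange.of_density_gamma`.

For `E` and `F` the parameter is decided by the ratio `s_{ξ+k}/s_ξ` in `c_0`, which each primed
field multiplies by its inverse. Without primes (`E`, type II) the denominator is `s_ξ`, hence `η`;
with two primes (`F`, type I) it is `s_{ξ+k}`, hence `η'`; with one prime the ratio disappears and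
the current commutes or anticommutes with the vertex operator. The two terms of a current have the
same ratio of orders, so the relation passes to the whole current. In the twisted case with Gamma
functions one of the two sines is shifted by a half period, which produces `ν = -1`.

For the half currents, let `A(γ)Φ sh ρ(γ-ζ+B) = ν ΦA(γ) sh ρ(γ-ζ-B)`. An addition formula
(`sinh_kernel_identity`) shows that `sh ρ(α-ζ+B) x(α)Φ - ν sh ρ(α-ζ-B) Φx(α)` does not depend on `α`
(`halfCommutator_eq`), and this operator gives the next component. The shifts `±iħk/4` in the
kernels only translate `α`, so both signs yield the same operator. If `sh 2ρB = 0`, the integrand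
itself vanishes (`halfCommutator_eq_zero`). This settles `l = 0`, and also the values of `ξ` for
which the coefficient `sh(iπηħl)` of type II is zero.

Absolute convergence holds because contractions grow at most linearly along horizontal lines, matrix
elements are bounded there, and the kernels decay exponentially. -/

/-- `L` is the finite part of `∫_0^∞ w`, with logarithmic coefficient `B`. -/
def HasFinitePart (w : ℝ → ℂ) (B L : ℂ) : Prop :=
  (∀ ε : ℝ, 0 < ε → IntegrableOn w (Ioi ε)) ∧
    Tendsto (fun ε : ℝ => (∫ t in Ioi ε, w t) + B * ((Real.log ε : ℝ) : ℂ)) (𝓝[>] 0) (𝓝 L)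

namespace HasFinitePart

variable {w w₁ w₂ : ℝ → ℂ} {B B₁ B₂ L L₁ L₂ : ℂ}

theorem isFinitePart (h : HasFinitePart w B L) : IsFinitePart w L := ⟨h.1, B, h.2⟩

theorem congr (h : HasFinitePart w₁ B L) (hw : ∀ t, 0 < t → w₂ t = w₁ t) :
    HasFinitePart w₂ B L := by
  refine ⟨fun ε hε => (h.1 ε hε).congr_fun (fun t ht => (hw t (hε.trans ht)).symm)
    measurableSet_Ioi, h.2.congr' ?_⟩
  filter_upwards [self_mem_nhdsWithin] with ε (hε : 0 < ε)
  rw [setIntegral_congr_fun measurableSet_Ioi fun t ht => (hw t (hε.trans ht)).symm]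

theorem add (h₁ : HasFinitePart w₁ B₁ L₁) (h₂ : HasFinitePart w₂ B₂ L₂) :
    HasFinitePart (fun t => w₁ t + w₂ t) (B₁ + B₂) (L₁ + L₂) := by
  refine ⟨fun ε hε => (h₁.1 ε hε).add (h₂.1 ε hε), (h₁.2.add h₂.2).congr' ?_⟩
  filter_upwards [self_mem_nhdsWithin] with ε (hε : 0 < ε)
  rw [integral_add (h₁.1 ε hε) (h₂.1 ε hε)]
  ring

theorem const_mul (h : HasFinitePart w B L) (c : ℂ) :
    HasFinitePart (fun t => c * w t) (c * B) (c * L) := by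
  refine ⟨fun ε hε => (h.1 ε hε).const_mul c, (h.2.const_mul c).congr fun ε => ?_⟩
  rw [integral_const_mul]
  ring

theorem of_integrableOn (h : IntegrableOn w (Ioi 0)) :
    HasFinitePart w 0 (∫ t in Ioi 0, w t) := by
  refine ⟨fun ε hε => h.mono_set (Ioi_subset_Ioi hε.le), ?_⟩
  have ha := (aecover_Ioi_of_Ioi (μ := volume) (l := 𝓝[>] (0 : ℝ)) (a := id) (A := 0)
    (tendsto_id.mono_left nhdsWithin_le_nhds)).integral_tendsto_of_countably_generated h
  refine ha.congr' ?_
  filter_upwards [self_mem_nhdsWithin] with ε (hε : 0 < ε)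
  simp only [id, zero_mul, add_zero]
  rw [Measure.restrict_restrict measurableSet_Ioi,
    inter_eq_left.2 (Ioi_subset_Ioi hε.le)]

end HasFinitePart

/-- Divided by `log ε`, the difference of the two limits tends to zero, which forces the logarithmic
coefficients to agree; then the limits agree as well. -/
theorem IsFinitePart.unique {w : ℝ → ℂ} {L₁ L₂ : ℂ} (h₁ : IsFinitePart w L₁)
    (h₂ : IsFinitePart w L₂) : L₁ = L₂ := by
  obtain ⟨-, B₁, h₁⟩ := h₁
  obtain ⟨-, B₂, h₂⟩ := h₂
  have hlog : Tendsto (fun ε : ℝ => ((Real.log ε : ℝ) : ℂ)⁻¹) (𝓝[>] 0) (𝓝 0) := by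
    have := (tendsto_inv_atBot_zero.comp Real.tendsto_log_nhdsGT_zero)
    simpa [Function.comp_def] using (Complex.continuous_ofReal.tendsto 0).comp this
  have hd : Tendsto (fun ε : ℝ => (B₁ - B₂) * ((Real.log ε : ℝ) : ℂ)) (𝓝[>] 0)
      (𝓝 (L₁ - L₂)) := (h₁.sub h₂).congr fun ε => by ring
  have hB : B₁ - B₂ = 0 := by
    have hm := hd.mul hlog
    rw [mul_zero] at hm
    refine tendsto_nhds_unique (tendsto_const_nhds.congr' ?_) hm
    have h1 : ∀ᶠ ε : ℝ in 𝓝[>] 0, ε < 1 := nhdsWithin_le_nhds (Iio_mem_nhds one_pos)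
    filter_upwards [self_mem_nhdsWithin, h1] with ε (h0 : 0 < ε) h1
    have : ((Real.log ε : ℝ) : ℂ) ≠ 0 := by exact_mod_cast (Real.log_neg h0 h1).ne
    field_simp
  rw [hB] at hd
  simp only [zero_mul] at hd
  exact (sub_eq_zero.1 (tendsto_nhds_unique tendsto_const_nhds hd).symm)

/-! ### Frullani integrals with complex exponents -/

theorem norm_exp_neg_mul_le {a : ℂ} {c t : ℝ} (ha : c ≤ a.re) (ht : 0 ≤ t) :
    ‖Complex.exp (-a * t)‖ ≤ Real.exp (-c * t) := by
  rw [Complex.norm_exp]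
  simp only [neg_mul, Complex.neg_re, Complex.mul_re, Complex.ofReal_re, Complex.ofReal_im,
    mul_zero, sub_zero]
  gcongr

/-- Mean value inequality in the exponent on a half plane. The factor `t` is what later absorbs the
`1/t` of the Frullani integrand. -/
theorem norm_exp_neg_mul_sub_le {a b : ℂ} {c t : ℝ} (ha : c ≤ a.re) (hb : c ≤ b.re)
    (ht : 0 ≤ t) :
    ‖Complex.exp (-a * t) - Complex.exp (-b * t)‖ ≤ ‖a - b‖ * t * Real.exp (-c * t) := by
  have hconv : Convex ℝ {z : ℂ | c ≤ z.re} := convex_halfSpace_re_ge c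
  have := hconv.norm_image_sub_le_of_norm_hasDerivWithin_le (f := fun z => Complex.exp (-z * t))
    (f' := fun z => Complex.exp (-z * t) * (-1 * t)) (C := t * Real.exp (-c * t))
    (fun x _ => (((hasDerivAt_id x).neg.mul_const (t : ℂ)).cexp).hasDerivWithinAt) (fun x hx => by
      rw [norm_mul]
      have h1 := norm_exp_neg_mul_le (a := x) hx ht
      have h2 : ‖(-1 * t : ℂ)‖ = t := by simp [abs_of_nonneg ht]
      rw [h2, mul_comm]
      gcongr) hb ha
  calc _ ≤ _ := this
    _ = _ := by ring

theorem integrableOn_exp_neg {c : ℝ} (hc : 0 < c) (s : ℝ) :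
    IntegrableOn (fun t : ℝ => Real.exp (-c * t)) (Ioi s) :=
  integrableOn_exp_mul_Ioi (by linarith) s

/-- The integrand of the Frullani integral. -/
noncomputable def frullani (a b : ℂ) (t : ℝ) : ℂ :=
  (Complex.exp (-a * t) - Complex.exp (-b * t)) / t

theorem frullani_aestronglyMeasurable (a b : ℂ) (μ : Measure ℝ) :
    AEStronglyMeasurable (frullani a b) μ := by
  unfold frullani
  exact (Measurable.div (by fun_prop) (by fun_prop)).aestronglyMeasurable

theorem norm_frullani_le {a b : ℂ} {c t : ℝ} (ha : c ≤ a.re) (hb : c ≤ b.re)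
    (ht : 0 < t) : ‖frullani a b t‖ ≤ ‖a - b‖ * Real.exp (-c * t) := by
  rw [frullani, norm_div, Complex.norm_real, Real.norm_of_nonneg ht.le, div_le_iff₀ ht]
  calc _ ≤ _ := norm_exp_neg_mul_sub_le ha hb ht.le
    _ = _ := by ring

theorem integrableOn_frullani {a b : ℂ} (ha : 0 < a.re) (hb : 0 < b.re) :
    IntegrableOn (frullani a b) (Ioi 0) := by
  have hc : 0 < min a.re b.re := lt_min ha hb
  refine ((integrableOn_exp_neg hc 0).const_mul ‖a - b‖).mono'
    (frullani_aestronglyMeasurable a b _) ?_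
  filter_upwards [ae_restrict_mem measurableSet_Ioi] with t ht
  exact norm_frullani_le (min_le_left _ _) (min_le_right _ _) ht

/-- Differentiation in `a` removes the denominator `t` and leaves an elementary exponential
integral. -/
theorem hasDerivAt_integral_frullani {a b : ℂ} (ha : 0 < a.re) (hb : 0 < b.re) :
    HasDerivAt (fun z => ∫ t in Ioi (0 : ℝ), frullani z b t) (-a⁻¹) a := by
  have hint : (∫ t in Ioi (0 : ℝ), -Complex.exp (-a * t)) = -a⁻¹ := by
    rw [integral_neg, integral_exp_mul_complex_Ioi (by simpa using ha)]
    simp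
  have hs : {z : ℂ | a.re / 2 < z.re} ∈ 𝓝 a :=
    (isOpen_lt continuous_const Complex.continuous_re).mem_nhds
      (show a.re / 2 < a.re by linarith)
  have key := hasDerivAt_integral_of_dominated_loc_of_deriv_le (μ := volume.restrict (Ioi 0))
    (F := fun z t => frullani z b t) (F' := fun z (t : ℝ) => -Complex.exp (-z * t)) (x₀ := a)
    (bound := fun t => Real.exp (-(a.re / 2) * t)) hs
    (Eventually.of_forall fun z => frullani_aestronglyMeasurable z b _)
    (integrableOn_frullani ha hb) (by fun_prop)
    (by
      filter_upwards [ae_restrict_mem measurableSet_Ioi] with t ht z hz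
      rw [norm_neg]
      exact norm_exp_neg_mul_le (le_of_lt hz) (le_of_lt ht))
    (integrableOn_exp_neg (by linarith) 0)
    (by
      filter_upwards [ae_restrict_mem measurableSet_Ioi] with t ht z _
      have ht' : (t : ℂ) ≠ 0 := by exact_mod_cast (ne_of_gt ht)
      have := ((((hasDerivAt_id z).neg.mul_const (t : ℂ)).cexp).sub_const
        (Complex.exp (-b * t))).div_const (t : ℂ)
      refine this.congr_deriv ?_
      simp only [id, Pi.neg_apply]
      field_simp)
  rw [hint] at key
  exact key.2

/-- Frullani's integral `∫_0^∞ (e^{-at} - e^{-bt}) dt/t = log b - log a`. -/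
theorem integral_frullani {a b : ℂ} (ha : 0 < a.re) (hb : 0 < b.re) :
    ∫ t in Ioi (0 : ℝ), frullani a b t = Complex.log b - Complex.log a := by
  -- The integral plus `log z` has zero derivative on the right half plane, hence is constant; its
  -- value is read off at `z = b`, where the integrand vanishes.
  have hd : ∀ z : ℂ, 0 < z.re → HasDerivAt
      (fun z => (∫ t in Ioi (0 : ℝ), frullani z b t) + Complex.log z) 0 z := fun z hz => by
    have := (hasDerivAt_integral_frullani hz hb).fun_add
      (Complex.hasDerivAt_log (Complex.mem_slitPlane_iff.2 (Or.inl hz)))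
    simpa using this
  have hopen : IsOpen {z : ℂ | 0 < z.re} := isOpen_lt continuous_const Complex.continuous_re
  have hpre : IsPreconnected {z : ℂ | 0 < z.re} := (convex_halfSpace_re_gt 0).isPreconnected
  have heq := hopen.is_const_of_deriv_eq_zero hpre
    (fun z hz => (hd z hz).differentiableAt.differentiableWithinAt)
    (fun z hz => (hd z hz).deriv) ha hb
  have h0 : ∫ t in Ioi (0 : ℝ), frullani b b t = 0 := by simp [frullani]
  simp only [h0, zero_add] at heq
  linear_combination heq

/-! ### The finite part of the exponential integral -/

/-- The pole is compared with `1/t` cut off at `t = 1`: since `∫_ε^1 dt/t = -log ε`, this `g` has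
finite part `0` with coefficient `1`, and the difference is integrable up to `0`. -/
theorem exists_hasFinitePart_exp_neg_div {b : ℝ} (hb : 0 < b) :
    ∃ L, HasFinitePart (fun t : ℝ => Complex.exp (-(b : ℂ) * t) / t) 1 L := by
  set g : ℝ → ℂ := (Iic (1 : ℝ)).indicator fun t => ((t⁻¹ : ℝ) : ℂ) with hg
  have hgL : HasFinitePart g 1 0 := by
    constructor
    · intro ε hε
      rw [hg, IntegrableOn, integrable_indicator_iff measurableSet_Iic, IntegrableOn,
        Measure.restrict_restrict measurableSet_Iic, inter_comm, Ioi_inter_Iic]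
      refine Integrable.ofReal ?_
      refine (ContinuousOn.integrableOn_Icc (a := ε) (b := 1) ?_).mono_set Ioc_subset_Icc_self
      exact continuousOn_id.inv₀ fun t ht => (hε.trans_le ht.1).ne'
    · refine tendsto_const_nhds.congr' ?_
      have h1 : ∀ᶠ ε : ℝ in 𝓝[>] 0, ε < 1 := nhdsWithin_le_nhds (Iio_mem_nhds one_pos)
      filter_upwards [self_mem_nhdsWithin, h1] with ε (h0 : 0 < ε) h1
      rw [hg, setIntegral_indicator measurableSet_Iic, Ioi_inter_Iic,
        ← intervalIntegral.integral_of_le h1.le, intervalIntegral.integral_ofReal,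
        integral_inv_of_pos h0 one_pos]
      simp [Real.log_inv]
  have hr : IntegrableOn (fun t : ℝ => Complex.exp (-(b : ℂ) * t) / t - g t) (Ioi 0) := by
    have hbd : IntegrableOn (fun t : ℝ => (Iic (1 : ℝ)).indicator (fun _ => b) t +
        Real.exp (-b * t)) (Ioi 0) := by
      refine IntegrableOn.add ?_ (integrableOn_exp_neg hb 0)
      rw [IntegrableOn, integrable_indicator_iff measurableSet_Iic, IntegrableOn,
        Measure.restrict_restrict measurableSet_Iic, inter_comm, Ioi_inter_Iic]
      exact integrableOn_const (by simp)
    refine hbd.mono' ?_ ?_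
    · refine (Measurable.sub (Measurable.div (by fun_prop) (by fun_prop))
        (Measurable.indicator (by fun_prop) measurableSet_Iic)).aestronglyMeasurable
    · filter_upwards [ae_restrict_mem measurableSet_Ioi] with t (ht : 0 < t)
      have ht' : (t : ℂ) ≠ 0 := by exact_mod_cast ht.ne'
      by_cases h1 : t ≤ 1
      · rw [hg, indicator_of_mem (by exact h1), indicator_of_mem (by exact h1)]
        have := norm_frullani_le (a := b) (b := 0) (c := 0) (t := t) (by simpa using hb.le)
          (by simp) ht
        simp only [frullani, neg_zero, zero_mul, Complex.exp_zero, sub_zero, Complex.norm_real,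
          Real.exp_zero, mul_one, Real.norm_of_nonneg hb.le] at this
        rw [Complex.ofReal_inv, inv_eq_one_div, ← sub_div]
        exact this.trans (le_add_of_nonneg_right (Real.exp_pos _).le)
      · rw [hg, indicator_of_notMem (by exact h1), indicator_of_notMem (by exact h1), sub_zero,
          zero_add, norm_div, Complex.norm_real, Real.norm_of_nonneg ht.le]
        refine (div_le_self (norm_nonneg _) (not_le.1 h1).le).trans ?_
        exact norm_exp_neg_mul_le (by simp) ht.le
  have := (HasFinitePart.of_integrableOn hr).add hgL
  rw [zero_add] at this
  exact ⟨_, this.congr fun t _ => by ring⟩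

/-- The finite part of the exponential integral `∫_0^∞ e^{-at} dt/t` is `const - log a`. -/
theorem exists_hasFinitePart_exp_div :
    ∃ c : ℂ, ∀ a : ℂ, 0 < a.re →
      HasFinitePart (fun t : ℝ => Complex.exp (-a * t) / t) 1 (c - Complex.log a) := by
  obtain ⟨L, hL⟩ := exists_hasFinitePart_exp_neg_div one_pos
  refine ⟨L, fun a ha => ?_⟩
  have := (HasFinitePart.of_integrableOn (integrableOn_frullani (a := a) (b := 1) ha
    (by simp))).add hL
  rw [integral_frullani ha (by simp), zero_add] at this
  simp only [Complex.log_one] at this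
  rw [show 0 - Complex.log a + L = L - Complex.log a by ring] at this
  refine this.congr fun t _ => ?_
  simp only [frullani, Complex.ofReal_one]
  ring

/-! ### Malmsten's formula for a quotient of Gamma functions -/

/-- The derivative `1 - e^{-x}` is bounded by `‖x‖ ≤ ‖u‖` on the convex set where `Re x ≥ 0` and
`‖x‖ ≤ ‖u‖`. -/
theorem norm_exp_neg_sub_one_add_le {u : ℂ} (hu : 0 ≤ u.re) :
    ‖Complex.exp (-u) - 1 + u‖ ≤ ‖u‖ ^ 2 := by
  have hconv : Convex ℝ ({z : ℂ | 0 ≤ z.re} ∩ Metric.closedBall 0 ‖u‖) :=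
    (convex_halfSpace_re_ge 0).inter (convex_closedBall _ _)
  have := hconv.norm_image_sub_le_of_norm_hasDerivWithin_le
    (f := fun z => Complex.exp (-z) - 1 + z) (f' := fun z => Complex.exp (-z) * (-1) + 1)
    (C := ‖u‖) (x := 0) (y := u)
    (fun x _ => (((hasDerivAt_id x).neg.cexp.sub_const 1).add (hasDerivAt_id x)).hasDerivWithinAt)
    (fun x hx => by
      have h1 := norm_exp_neg_mul_sub_le (a := 0) (b := x) (c := 0) (t := 1) (by simp) hx.1
        zero_le_one
      have h2 : ‖x‖ ≤ ‖u‖ := by simpa using hx.2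
      simp only [neg_zero, Complex.exp_zero, Complex.ofReal_one, mul_one, zero_sub,
        norm_neg, Real.exp_zero] at h1
      rw [show Complex.exp (-x) * (-1) + 1 = 1 - Complex.exp (-x) by ring]
      exact h1.trans h2) (by simp) (by simpa using hu)
  simpa [pow_two] using this

/-- Equivalent to `(1 - y) e^y ≤ 1`, that is, to `1 - y ≤ e^{-y}`. -/
theorem exp_sub_one_sub_le {y : ℝ} : Real.exp y - 1 - y ≤ y * (Real.exp y - 1) := by
  have h1 : 1 - y ≤ Real.exp (-y) := by linarith [Real.add_one_le_exp (-y)]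
  have h2 : (1 - y) * Real.exp y ≤ 1 := by
    calc _ ≤ Real.exp (-y) * Real.exp y := by gcongr
      _ = 1 := by rw [← Real.exp_add]; simp
  linarith

/-- The remainder of the truncated Malmsten integral is `∫_0^∞ e^{-nbt} q(t) dt`, for this `q`. -/
noncomputable def malmstenTail (b : ℝ) (z w : ℂ) (t : ℝ) : ℂ :=
  ((Complex.exp (-(z * b) * t) - Complex.exp (-(w * b) * t)) / (Complex.exp ((b : ℂ) * t) - 1) +
    (z - w)) / t

/-- The integrand of Malmsten's formula for `log Γ(z) - log Γ(w)`, at scale `b`. -/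
noncomputable def malmsten (b : ℝ) (z w : ℂ) (t : ℝ) : ℂ :=
  ((Complex.exp (-(z * b) * t) - Complex.exp (-(w * b) * t)) / (1 - Complex.exp (-(b : ℂ) * t)) +
    (z - w) * Complex.exp (-(b : ℂ) * t)) / t

section

variable {b : ℝ} {z w : ℂ}

/-- The first order terms at `t = 0` cancel, so the tail is bounded uniformly in `t`. Multiplied by
`e^{-nbt}` its integral is therefore `O(1/n)`. -/
theorem norm_malmstenTail_le (hb : 0 < b) (hz : 0 < z.re) (hw : 0 < w.re) {t : ℝ} (ht : 0 < t) :
    ‖malmstenTail b z w t‖ ≤ (‖z‖ ^ 2 + ‖w‖ ^ 2) * b + ‖z - w‖ * b := by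
  have hy : 0 < b * t := mul_pos hb ht
  have he : b * t ≤ Real.exp (b * t) - 1 := by linarith [Real.add_one_le_exp (b * t)]
  have he0 : 0 < Real.exp (b * t) - 1 := hy.trans_le he
  have hD : Complex.exp ((b : ℂ) * t) - 1 = ((Real.exp (b * t) - 1 : ℝ) : ℂ) := by push_cast; rfl
  have hD0 : Complex.exp ((b : ℂ) * t) - 1 ≠ 0 := by
    rw [hD]; exact_mod_cast he0.ne'
  have ht' : (t : ℂ) ≠ 0 := by exact_mod_cast ht.ne'
  have hsq : ∀ x : ℂ, 0 < x.re →
      ‖Complex.exp (-(x * b) * t) - 1 + x * b * t‖ ≤ ‖x‖ ^ 2 * (b * t) ^ 2 := fun x hx => by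
    have := norm_exp_neg_sub_one_add_le (u := x * b * t) (by
      simp only [Complex.mul_re, Complex.ofReal_re, Complex.ofReal_im, mul_zero, sub_zero]
      positivity)
    rw [norm_mul, norm_mul, Complex.norm_real, Complex.norm_real, Real.norm_of_nonneg hb.le,
      Real.norm_of_nonneg ht.le] at this
    rw [neg_mul]
    calc _ ≤ _ := this
      _ = _ := by ring
  have hsplit : malmstenTail b z w t =
      ((Complex.exp (-(z * b) * t) - 1 + z * b * t) -
        (Complex.exp (-(w * b) * t) - 1 + w * b * t)) / (Complex.exp ((b : ℂ) * t) - 1) / t +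
      (z - w) * ((Complex.exp ((b : ℂ) * t) - 1 - b * t) / (Complex.exp ((b : ℂ) * t) - 1) / t) := by
    rw [malmstenTail]
    field_simp
    ring
  rw [hsplit]
  refine (norm_add_le _ _).trans (add_le_add ?_ ?_)
  · rw [norm_div, norm_div, hD, Complex.norm_real, Complex.norm_real, Real.norm_of_nonneg he0.le,
      Real.norm_of_nonneg ht.le, div_div, div_le_iff₀ (by positivity)]
    calc _ ≤ _ := norm_sub_le _ _
      _ ≤ ‖z‖ ^ 2 * (b * t) ^ 2 + ‖w‖ ^ 2 * (b * t) ^ 2 := add_le_add (hsq z hz) (hsq w hw)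
      _ = (‖z‖ ^ 2 + ‖w‖ ^ 2) * b * ((b * t) * t) := by ring
      _ ≤ _ := by gcongr
  · rw [norm_mul]
    refine mul_le_mul_of_nonneg_left ?_ (norm_nonneg _)
    have hN : Complex.exp ((b : ℂ) * t) - 1 - b * t =
        ((Real.exp (b * t) - 1 - b * t : ℝ) : ℂ) := by push_cast; rfl
    rw [norm_div, norm_div, hN, hD, Complex.norm_real, Complex.norm_real, Complex.norm_real,
      Real.norm_of_nonneg he0.le, Real.norm_of_nonneg ht.le,
      Real.norm_of_nonneg (by linarith), div_div, div_le_iff₀ (by positivity)]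
    have := exp_sub_one_sub_le (y := b * t)
    linarith

/-- With `X = e^{-bt}`, expand `1/(1-X)` as `1 + ... + X^n + X^(n+1)/(1-X)` and `X` as `(X - X^n) +
X^n`. All but the remainder become Frullani integrands, with `n + 1` terms to match
`Complex.GammaSeq`. -/
theorem malmsten_eq (hb : 0 < b) (n : ℕ) {t : ℝ} (ht : 0 < t) :
    malmsten b z w t =
      ((∑ j ∈ Finset.range (n + 1), frullani (z * b + j * b) (w * b + j * b) t) +
        (z - w) * frullani b (n * b) t) +
      Complex.exp (-(n * b : ℂ) * t) * malmstenTail b z w t := by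
  set X := Complex.exp (-(b : ℂ) * t) with hX
  have hbt : 0 < b * t := mul_pos hb ht
  have hX1 : 1 - X ≠ 0 := by
    have : (1 : ℝ) - Real.exp (-b * t) ≠ 0 := by
      have : Real.exp (-b * t) < 1 := by rw [Real.exp_lt_one_iff]; linarith
      linarith
    rw [hX]
    exact_mod_cast this
  have ht' : (t : ℂ) ≠ 0 := by exact_mod_cast ht.ne'
  have hX0 : X ≠ 0 := Complex.exp_ne_zero _
  have hpow : ∀ j : ℕ, Complex.exp (-(j * b : ℂ) * t) = X ^ j := fun j => by
    rw [hX, ← Complex.exp_nat_mul]; congr 1; ring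
  have hsh : ∀ (x : ℂ) (j : ℕ), Complex.exp (-(x * b + j * b) * t) =
      Complex.exp (-(x * b) * t) * X ^ j := fun x j => by
    rw [← hpow, ← Complex.exp_add]; congr 1; ring
  have hinv : Complex.exp ((b : ℂ) * t) = X⁻¹ := by
    rw [hX, ← Complex.exp_neg]; congr 1; ring
  have hsum : (∑ j ∈ Finset.range (n + 1), frullani (z * b + j * b) (w * b + j * b) t) =
      (Complex.exp (-(z * b) * t) - Complex.exp (-(w * b) * t)) / t *
        ((1 - X ^ (n + 1)) / (1 - X)) := by
    have hg : (1 - X ^ (n + 1)) / (1 - X) = ∑ j ∈ Finset.range (n + 1), X ^ j := by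
      rw [div_eq_iff hX1, geom_sum_mul_neg]
    rw [hg, Finset.mul_sum]
    refine Finset.sum_congr rfl fun j _ => ?_
    rw [frullani, hsh, hsh]
    ring
  have hX2 : X⁻¹ - 1 ≠ 0 := by
    intro h
    apply hX1
    field_simp at h
    simpa using h
  rw [hsum, malmsten, malmstenTail, frullani, hpow, hinv, ← hX]
  have hX3 : X⁻¹ - 1 = (1 - X) / X := by field_simp
  rw [hX3]
  field_simp
  ring

theorem measurable_malmstenTail : Measurable (malmstenTail b z w) := by
  unfold malmstenTail
  exact Measurable.div (by fun_prop) (by fun_prop)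

theorem norm_remainder_le (hb : 0 < b) (hz : 0 < z.re) (hw : 0 < w.re) (n : ℕ) {t : ℝ}
    (ht : 0 < t) :
    ‖Complex.exp (-(n * b : ℂ) * t) * malmstenTail b z w t‖ ≤
      Real.exp (-(n * b) * t) * ((‖z‖ ^ 2 + ‖w‖ ^ 2) * b + ‖z - w‖ * b) := by
  rw [norm_mul]
  refine mul_le_mul (norm_exp_neg_mul_le (by simp) ht.le) (norm_malmstenTail_le hb hz hw ht)
    (norm_nonneg _) (Real.exp_pos _).le

theorem integrableOn_remainder (hb : 0 < b) (hz : 0 < z.re) (hw : 0 < w.re) {n : ℕ} (hn : 0 < n) :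
    IntegrableOn (fun t : ℝ => Complex.exp (-(n * b : ℂ) * t) * malmstenTail b z w t)
      (Ioi 0) := by
  have hn' : (0 : ℝ) < n := by exact_mod_cast hn
  refine ((integrableOn_exp_neg (mul_pos hn' hb) 0).mul_const
    ((‖z‖ ^ 2 + ‖w‖ ^ 2) * b + ‖z - w‖ * b)).mono'
      (((by fun_prop : Measurable fun t : ℝ => Complex.exp (-(n * b : ℂ) * t)).mul
      measurable_malmstenTail).aestronglyMeasurable) ?_
  filter_upwards [ae_restrict_mem measurableSet_Ioi] with t ht
  exact norm_remainder_le hb hz hw n ht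

theorem tendsto_integral_remainder (hb : 0 < b) (hz : 0 < z.re) (hw : 0 < w.re) :
    Tendsto (fun n : ℕ => ∫ t in Ioi (0 : ℝ),
      Complex.exp (-(n * b : ℂ) * t) * malmstenTail b z w t) atTop (𝓝 0) := by
  set K := (‖z‖ ^ 2 + ‖w‖ ^ 2) * b + ‖z - w‖ * b with hK
  have hlim : Tendsto (fun n : ℕ => K / (n * b)) atTop (𝓝 0) :=
    tendsto_const_nhds.div_atTop (tendsto_natCast_atTop_atTop.atTop_mul_const hb)
  refine squeeze_zero_norm' ?_ hlim
  filter_upwards [eventually_gt_atTop 0] with n hn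
  have hn' : (0 : ℝ) < n := by exact_mod_cast hn
  have hnb := mul_pos hn' hb
  calc _ ≤ ∫ t in Ioi (0 : ℝ), Real.exp (-(n * b) * t) * K := by
        refine norm_integral_le_of_norm_le ((integrableOn_exp_neg hnb 0).mul_const _) ?_
        filter_upwards [ae_restrict_mem measurableSet_Ioi] with t ht
        exact norm_remainder_le hb hz hw n ht
    _ = _ := by
        rw [integral_mul_const, integral_exp_mul_Ioi (by linarith)]
        simp
        ring

/-- The Frullani logarithms exponentiate to `n^{z-w} ∏ (w+j)/(z+j)`, the quotient of Euler's
approximations to the Gamma function. The scale `b` drops out. -/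
theorem exp_sum_log_eq (hb : 0 < b) (hz : 0 < z.re) (hw : 0 < w.re) {n : ℕ} (hn : 0 < n) :
    Complex.exp ((∑ j ∈ Finset.range (n + 1),
        (Complex.log (w * b + j * b) - Complex.log (z * b + j * b))) +
        (z - w) * (Complex.log (n * b) - Complex.log b)) =
      Complex.GammaSeq z n / Complex.GammaSeq w n := by
  have hb' : (b : ℂ) ≠ 0 := by exact_mod_cast hb.ne'
  have hn' : (n : ℂ) ≠ 0 := by exact_mod_cast hn.ne'
  have hlog : Complex.log (n * b) - Complex.log b = Complex.log n := by
    have h1 : (n : ℂ) * b = ((n * b : ℝ) : ℂ) := by push_cast; rfl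
    have h2 : (n : ℂ) = ((n : ℝ) : ℂ) := by push_cast; rfl
    rw [h1, h2, ← Complex.ofReal_log (by positivity), ← Complex.ofReal_log hb.le,
      ← Complex.ofReal_log (by positivity), Real.log_mul (by positivity) hb.ne']
    push_cast
    ring
  have hne : ∀ x : ℂ, 0 < x.re → ∀ j : ℕ, x + j ≠ 0 := fun x hx j h => by
    have := congrArg Complex.re h
    simp only [Complex.add_re, Complex.natCast_re, Complex.zero_re] at this
    linarith [Nat.cast_nonneg (α := ℝ) j]
  have hprod : ∀ x : ℂ, 0 < x.re → ∏ j ∈ Finset.range (n + 1), (x + (j : ℂ)) ≠ 0 := fun x hx =>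
    Finset.prod_ne_zero_iff.2 fun j _ => hne x hx j
  rw [Complex.exp_add, Complex.exp_sum, hlog]
  have hterm : ∀ j ∈ Finset.range (n + 1),
      Complex.exp (Complex.log (w * b + j * b) - Complex.log (z * b + j * b)) =
        (w + j) / (z + j) := fun j _ => by
    rw [← add_mul, ← add_mul, Complex.exp_sub, Complex.exp_log (mul_ne_zero (hne w hw j) hb'),
      Complex.exp_log (mul_ne_zero (hne z hz j) hb'), mul_div_mul_right _ _ hb']
  rw [Finset.prod_congr rfl hterm, Finset.prod_div_distrib, Complex.GammaSeq, Complex.GammaSeq,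
    mul_comm (z - w), ← Complex.cpow_def_of_ne_zero hn', Complex.cpow_sub _ _ hn']
  have h1 := hprod z hz
  have h2 := hprod w hw
  have h3 : ((n.factorial : ℕ) : ℂ) ≠ 0 := by exact_mod_cast n.factorial_ne_zero
  have h4 : (n : ℂ) ^ w ≠ 0 := by simp [Complex.cpow_eq_zero_iff, hn']
  field_simp

/-- The integral is independent of the truncation `n`. As `n → ∞` the remainder vanishes, and the
main part exponentiates to Euler's limit for `Γ(z)/Γ(w)`. -/
theorem integrableOn_malmsten_and_exp_integral (hb : 0 < b) (hz : 0 < z.re) (hw : 0 < w.re) :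
    IntegrableOn (malmsten b z w) (Ioi 0) ∧
      Complex.exp (∫ t in Ioi (0 : ℝ), malmsten b z w t) = Complex.Gamma z / Complex.Gamma w := by
  have hre : ∀ x : ℂ, 0 < x.re → ∀ j : ℕ, 0 < (x * b + j * b : ℂ).re := fun x hx j => by
    simp only [Complex.add_re, Complex.mul_re, Complex.ofReal_re, Complex.ofReal_im, mul_zero,
      sub_zero, Complex.natCast_re]
    positivity
  have hfr : ∀ j : ℕ, IntegrableOn (frullani (z * b + j * b) (w * b + j * b)) (Ioi 0) :=
    fun j => integrableOn_frullani (hre z hz j) (hre w hw j)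
  have hfr2 : ∀ n : ℕ, 0 < n → IntegrableOn (frullani (b : ℂ) (n * b)) (Ioi 0) := fun n hn =>
    integrableOn_frullani (by simpa using hb) (by
      simp only [Complex.mul_re, Complex.ofReal_re, Complex.ofReal_im, mul_zero,
        sub_zero, Complex.natCast_re]
      positivity)
  have hsum : ∀ n : ℕ, 0 < n → IntegrableOn (fun t : ℝ =>
      (∑ j ∈ Finset.range (n + 1), frullani (z * b + j * b) (w * b + j * b) t) +
        (z - w) * frullani b (n * b) t) (Ioi 0) := fun n hn =>
    (integrable_finsetSum _ fun j _ => hfr j).add ((hfr2 n hn).const_mul _)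
  have hint : ∀ n : ℕ, 0 < n → (∫ t in Ioi (0 : ℝ),
      ((∑ j ∈ Finset.range (n + 1), frullani (z * b + j * b) (w * b + j * b) t) +
        (z - w) * frullani b (n * b) t)) = (∑ j ∈ Finset.range (n + 1),
        (Complex.log (w * b + j * b) - Complex.log (z * b + j * b))) +
        (z - w) * (Complex.log (n * b) - Complex.log b) := fun n hn => by
    rw [integral_add (integrable_finsetSum _ fun j _ => hfr j) ((hfr2 n hn).const_mul _),
      integral_finsetSum _ fun j _ => hfr j, integral_const_mul,
      integral_frullani (by simpa using hb) (by
        simp only [Complex.mul_re, Complex.ofReal_re, Complex.ofReal_im, mul_zero,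
          sub_zero, Complex.natCast_re]
        positivity)]
    simp_rw [fun j : ℕ => integral_frullani (hre z hz j) (hre w hw j)]
  have hJ : IntegrableOn (malmsten b z w) (Ioi 0) :=
    ((hsum 1 one_pos).add (integrableOn_remainder hb hz hw one_pos)).congr_fun
      (fun t ht => (malmsten_eq hb 1 ht).symm) measurableSet_Ioi
  refine ⟨hJ, ?_⟩
  have hJn : ∀ n : ℕ, 0 < n → (∫ t in Ioi (0 : ℝ), malmsten b z w t) =
      ((∑ j ∈ Finset.range (n + 1),
        (Complex.log (w * b + j * b) - Complex.log (z * b + j * b))) +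
        (z - w) * (Complex.log (n * b) - Complex.log b)) +
      ∫ t in Ioi (0 : ℝ), Complex.exp (-(n * b : ℂ) * t) * malmstenTail b z w t := fun n hn => by
    rw [← hint n hn, ← integral_add (hsum n hn) (integrableOn_remainder hb hz hw hn)]
    exact setIntegral_congr_fun measurableSet_Ioi fun t ht => malmsten_eq hb n ht
  have h1 : Tendsto (fun n : ℕ => Complex.exp ((∫ t in Ioi (0 : ℝ), malmsten b z w t) -
      ∫ t in Ioi (0 : ℝ), Complex.exp (-(n * b : ℂ) * t) * malmstenTail b z w t)) atTop
      (𝓝 (Complex.exp ((∫ t in Ioi (0 : ℝ), malmsten b z w t) - 0))) :=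
    (Complex.continuous_exp.tendsto _).comp
      (tendsto_const_nhds.sub (tendsto_integral_remainder hb hz hw))
  have h2 : Tendsto (fun n : ℕ => Complex.GammaSeq z n / Complex.GammaSeq w n) atTop
      (𝓝 (Complex.Gamma z / Complex.Gamma w)) :=
    (Complex.GammaSeq_tendsto_Gamma z).div (Complex.GammaSeq_tendsto_Gamma w)
      (Complex.Gamma_ne_zero_of_re_pos hw)
  rw [sub_zero] at h1
  refine tendsto_nhds_unique (h1.congr' ?_) h2
  filter_upwards [eventually_gt_atTop 0] with n hn
  rw [← exp_sum_log_eq hb hz hw hn, hJn n hn]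
  congr 1
  ring

end

/-- The regularized integral `∫_0^∞ (e^{-zbt} - e^{-wbt}) / (1 - e^{-bt}) dt/t` exponentiates to
`Γ(z) / Γ(w)`, up to a factor that depends on `z - w` only. -/
theorem exists_hasFinitePart_gamma {b : ℝ} (hb : 0 < b) :
    ∃ c : ℂ, ∀ z w : ℂ, 0 < z.re → 0 < w.re → ∃ L,
      HasFinitePart (fun t : ℝ => (Complex.exp (-(z * b) * t) - Complex.exp (-(w * b) * t)) /
        (1 - Complex.exp (-(b : ℂ) * t)) / t) (w - z) L ∧
      Complex.exp L = Complex.exp ((w - z) * c) * (Complex.Gamma z / Complex.Gamma w) := by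
  obtain ⟨c, hc⟩ := exists_hasFinitePart_exp_neg_div hb
  refine ⟨c, fun z w hz hw => ?_⟩
  obtain ⟨hJ, hexp⟩ := integrableOn_malmsten_and_exp_integral hb hz hw
  -- This removes the compensating term `(z-w) e^{-bt}/t` of Malmsten's integrand, at the price of a
  -- finite part `(w-z)c` in which `c` depends on `b` alone.
  have h := (HasFinitePart.of_integrableOn hJ).add (hc.const_mul (w - z))
  rw [zero_add, mul_one] at h
  refine ⟨_, h.congr fun t _ => ?_, ?_⟩
  · rw [malmsten]; ring
  · rw [Complex.exp_add, hexp, mul_comm]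

/-! ### Meromorphic continuation -/

theorem exists_isOpen_subset_of_mem_upper {S : Set ℂ} (hS : S ∈ upper) :
    ∃ U : Set ℂ, IsOpen U ∧ U.Nonempty ∧ U ⊆ S := by
  obtain ⟨T, hT, hTS⟩ := mem_comap.1 hS
  obtain ⟨R, hR⟩ := mem_atTop_sets.1 hT
  refine ⟨{z | R < z.im}, isOpen_lt continuous_const Complex.continuous_im,
    ⟨⟨0, R + 1⟩, by simp⟩, fun z hz => hTS (hR _ (le_of_lt hz))⟩

theorem exists_isOpen_subset_of_mem_lower {S : Set ℂ} (hS : S ∈ lower) :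
    ∃ U : Set ℂ, IsOpen U ∧ U.Nonempty ∧ U ⊆ S := by
  obtain ⟨T, hT, hTS⟩ := mem_comap.1 hS
  obtain ⟨R, hR⟩ := mem_atBot_sets.1 hT
  refine ⟨{z | z.im < R}, isOpen_lt Complex.continuous_im continuous_const,
    ⟨⟨0, R - 1⟩, by simp⟩, fun z hz => hTS (hR _ (le_of_lt hz))⟩

/-- Two meromorphic functions on the plane that agree on a nonempty open set agree near every
point. -/
theorem eventuallyEq_of_eqOn_open {f g : ℂ → ℂ} (hf : MeromorphicOn f univ)
    (hg : MeromorphicOn g univ) {U : Set ℂ} (hU : IsOpen U) (hne : U.Nonempty)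
    (h : EqOn f g U) (z : ℂ) : f =ᶠ[𝓝[≠] z] g := by
  obtain ⟨x, hx⟩ := hne
  have hm : MeromorphicOn (f - g) univ := hf.sub hg
  -- Infinite order means vanishing near the point, and this property propagates over the connected
  -- plane.
  have htop : meromorphicOrderAt (f - g) x = ⊤ := by
    rw [meromorphicOrderAt_eq_top_iff]
    filter_upwards [nhdsWithin_le_nhds (hU.mem_nhds hx)] with y hy
    simp [h hy]
  have hz : meromorphicOrderAt (f - g) z = ⊤ := by
    by_contra hz
    exact hm.meromorphicOrderAt_ne_top_of_isPreconnected isPreconnected_univ (mem_univ z)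
      (mem_univ x) hz htop
  rw [meromorphicOrderAt_eq_top_iff] at hz
  filter_upwards [hz] with y hy
  exact sub_eq_zero.1 hy

/-- The function `M` is meromorphic and equals the exponential of the regularized integral of `W γ`
for all `γ` far out in the half planes of `𝓕`. -/
def Represents (W : ℂ → ℝ → ℂ) (𝓕 : Filter ℂ) (M : ℂ → ℂ) : Prop :=
  MeromorphicOn M univ ∧
    ∀ᶠ γ in 𝓕, AnalyticAt ℂ M γ ∧ ∃ L : ℂ, IsFinitePart (W γ) L ∧ M γ = Complex.exp L

/-- Passing to the normal form keeps the values at points of analyticity, hence the values far out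
in the half plane. -/
theorem Represents.exists_isContinuation {W : ℂ → ℝ → ℂ} {𝓕 : Filter ℂ} {M : ℂ → ℂ}
    (h : Represents W 𝓕 M) : ∃ M', IsContinuation W 𝓕 M' := by
  refine ⟨toMeromorphicNFOn M univ, meromorphicNFOn_toMeromorphicNFOn M univ, ?_⟩
  filter_upwards [h.2] with γ ⟨ha, L, hL, hM⟩
  refine ⟨L, hL, ?_⟩
  rw [toMeromorphicNFOn_eq_toMeromorphicNFAt h.1 (mem_univ γ),
    toMeromorphicNFAt_eq_self.2 ha.meromorphicNFAt, hM]

/-- The finite part is unique, so both functions agree on an open set. Elsewhere only punctured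
neighbourhoods can be compared, because `M` need not be in normal form at isolated points. -/
theorem Represents.continuation_eventuallyEq {W : ℂ → ℝ → ℂ} {𝓕 : Filter ℂ} {M : ℂ → ℂ}
    (h𝓕 : ∀ S ∈ 𝓕, ∃ U : Set ℂ, IsOpen U ∧ U.Nonempty ∧ U ⊆ S) (h : Represents W 𝓕 M) (z : ℂ) :
    continuation W 𝓕 =ᶠ[𝓝[≠] z] M := by
  have hex := h.exists_isContinuation
  have hc : IsContinuation W 𝓕 (continuation W 𝓕) := by
    rw [continuation, dif_pos hex]
    exact hex.choose_spec
  obtain ⟨U, hU, hne, hsub⟩ := h𝓕 _ (h.2.and hc.2)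
  refine eventuallyEq_of_eqOn_open hc.1.meromorphicOn h.1 hU hne (fun γ hγ => ?_) z
  obtain ⟨⟨-, L, hL, hM⟩, L', hL', hM'⟩ := hsub hγ
  rw [hM', hM, hL.unique hL']

theorem Represents.const_one {W : ℂ → ℝ → ℂ} {𝓕 : Filter ℂ}
    (hW : ∀ γ t, 0 < t → W γ t = 0) : Represents W 𝓕 fun _ => 1 := by
  refine ⟨fun z _ => MeromorphicAt.const 1 z, Eventually.of_forall fun γ =>
    ⟨analyticAt_const, 0, ?_, by simp⟩⟩
  have h := HasFinitePart.of_integrableOn (w := fun _ => 0) (by simp)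
  simp only [integral_zero] at h
  exact (h.congr fun t ht => hW γ t ht).isFinitePart

theorem eq_of_eventuallyEq_nhdsNE {f g : ℂ → ℂ} {z : ℂ} (hf : ContinuousAt f z)
    (hg : ContinuousAt g z) (h : f =ᶠ[𝓝[≠] z] g) : f z = g z :=
  tendsto_nhds_unique ((hf.mono_left nhdsWithin_le_nhds).congr' h)
    (hg.mono_left nhdsWithin_le_nhds)

theorem eventually_upper_mul_im {r : ℝ} (hr : 0 < r) (s : ℝ) :
    ∀ᶠ γ : ℂ in upper, s < r * γ.im := by
  have : Tendsto (fun x : ℝ => r * x) atTop atTop := tendsto_id.const_mul_atTop hr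
  exact (this.eventually_gt_atTop s).comap _

theorem eventually_lower_mul_im {r : ℝ} (hr : 0 < r) (s : ℝ) :
    ∀ᶠ γ : ℂ in lower, r * γ.im < s := by
  have : Tendsto (fun x : ℝ => r * x) atBot atBot := tendsto_id.const_mul_atBot hr
  exact (this.eventually_lt_atBot s).comap _

/-! ### Quotients of Gamma functions -/

theorem ne_neg_natCast_of_im_ne_zero {z : ℂ} (hz : z.im ≠ 0) (m : ℕ) : z ≠ -m := by
  rintro rfl
  simp at hz

theorem ne_neg_natCast_of_re_pos {z : ℂ} (hz : 0 < z.re) (m : ℕ) : z ≠ -m := by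
  rintro rfl
  simp only [Complex.neg_re, Complex.natCast_re] at hz
  linarith [Nat.cast_nonneg (α := ℝ) m]

/-- On a vertical line, `Γ(z) / Γ(z + d)` with `d > 0` is bounded away from the real axis. -/
theorem exists_norm_Gamma_div_le_of_pos {d : ℝ} (hd : 0 < d) (s : ℝ) :
    ∃ C, 0 ≤ C ∧ ∀ y : ℝ, 1 ≤ |y| →
      ‖Complex.Gamma (s + y * Complex.I) / Complex.Gamma (s + d + y * Complex.I)‖ ≤ C := by
  have hpos : ∀ s : ℝ, 0 < s → ∃ C, 0 ≤ C ∧ ∀ y : ℝ, 1 ≤ |y| →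
      ‖Complex.Gamma (s + y * Complex.I) / Complex.Gamma (s + d + y * Complex.I)‖ ≤ C := by
    intro s hs
    -- For `Re z > 0` the quotient is `B(z,d)/Γ(d)`, and the modulus of the beta integrand depends
    -- on `Re z` only, so this real integral bounds the numerator for all `y`.
    set B := ∫ x in (0 : ℝ)..1, x ^ (s - 1) * (1 - x) ^ (d - 1) with hB
    have hB0 : 0 ≤ B := by
      refine intervalIntegral.integral_nonneg zero_le_one fun x hx => ?_
      exact mul_nonneg (Real.rpow_nonneg hx.1 _) (Real.rpow_nonneg (by linarith [hx.2]) _)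
    have hGd : 0 < Real.Gamma d := Real.Gamma_pos_of_pos hd
    refine ⟨B / Real.Gamma d, by positivity, fun y _ => ?_⟩
    have hre : 0 < (s + y * Complex.I : ℂ).re := by simpa using hs
    have key := Complex.Gamma_mul_Gamma_eq_betaIntegral hre (t := d) (by simpa using hd)
    rw [show (s + y * Complex.I + d : ℂ) = s + d + y * Complex.I by ring] at key
    have hne : Complex.Gamma (s + d + y * Complex.I) ≠ 0 :=
      Complex.Gamma_ne_zero_of_re_pos (by simpa using add_pos hs hd)
    have hGd' : Complex.Gamma d ≠ 0 := by
      rw [Complex.Gamma_ofReal]; exact_mod_cast hGd.ne'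
    have hq : Complex.Gamma (s + y * Complex.I) / Complex.Gamma (s + d + y * Complex.I) =
        Complex.betaIntegral (s + y * Complex.I) d / Complex.Gamma d := by
      rw [div_eq_div_iff hne hGd', key, mul_comm]
    rw [hq, norm_div, Complex.Gamma_ofReal, Complex.norm_real, Real.norm_of_nonneg hGd.le]
    refine div_le_div_of_nonneg_right ?_ hGd.le
    rw [Complex.betaIntegral, hB]
    refine (intervalIntegral.norm_integral_le_integral_norm zero_le_one).trans (le_of_eq ?_)
    rw [intervalIntegral.integral_of_le zero_le_one, intervalIntegral.integral_of_le zero_le_one,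
      integral_Ioc_eq_integral_Ioo, integral_Ioc_eq_integral_Ioo]
    refine setIntegral_congr_fun measurableSet_Ioo fun x hx => ?_
    have h1 : 0 < 1 - x := by linarith [hx.2]
    have h2 : (1 - x : ℂ) = ((1 - x : ℝ) : ℂ) := by push_cast; rfl
    rw [norm_mul, h2, Complex.norm_cpow_eq_rpow_re_of_pos hx.1,
      Complex.norm_cpow_eq_rpow_re_of_pos h1]
    simp
  -- The recursion `Γ(z+1) = zΓ(z)` moves the line to the left in unit steps; each step costs a
  -- factor `‖(z+d)/z‖ ≤ 1 + d`, because `‖z‖ ≥ |y| ≥ 1`.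
  obtain ⟨N, hN⟩ := exists_nat_gt (-s)
  have hN' : 0 < s + N := by linarith
  clear hN
  induction N generalizing s with
  | zero => exact hpos s (by simpa using hN')
  | succ n ih =>
    obtain ⟨C, hC, h⟩ := ih (s + 1) (by push_cast at hN' ⊢; linarith)
    refine ⟨C * (1 + d), by positivity, fun y hy => ?_⟩
    have hy0 : y ≠ 0 := by rintro rfl; simp at hy; linarith
    set z : ℂ := s + y * Complex.I with hz
    have him : z.im = y := by simp [hz]
    have hz0 : z ≠ 0 := fun h0 => hy0 (by rw [← him, h0]; simp)
    have hzd0 : z + d ≠ 0 := fun h0 => hy0 (by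
      have := congrArg Complex.im h0
      simpa [him] using this)
    have hz1 : 1 ≤ ‖z‖ := by
      have := Complex.abs_im_le_norm z
      rw [him] at this
      exact hy.trans this
    have h1 := h y hy
    rw [show ((s + 1 : ℝ) : ℂ) + y * Complex.I = z + 1 by rw [hz]; push_cast; ring,
      show ((s + 1 : ℝ) : ℂ) + d + y * Complex.I = z + d + 1 by rw [hz]; push_cast; ring,
      Complex.Gamma_add_one _ hz0, Complex.Gamma_add_one _ hzd0] at h1
    rw [show (s + d + y * Complex.I : ℂ) = z + d by rw [hz]; ring]
    have h2 : Complex.Gamma z / Complex.Gamma (z + d) =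
        z * Complex.Gamma z / ((z + d) * Complex.Gamma (z + d)) * ((z + d) / z) := by
      field_simp
    rw [h2, norm_mul]
    refine mul_le_mul h1 ?_ (norm_nonneg _) hC
    rw [add_div, div_self hz0]
    refine (norm_add_le _ _).trans ?_
    rw [norm_one, norm_div, Complex.norm_real, Real.norm_of_nonneg hd.le]
    gcongr
    exact div_le_self hd.le hz1

/-- On a vertical line, `Γ(z) / Γ(z + d)` with `d > -1` grows at most linearly. -/
theorem exists_norm_Gamma_div_le {d : ℝ} (hd : -1 < d) (s : ℝ) :
    ∃ C, 0 ≤ C ∧ ∀ y : ℝ, 1 ≤ |y| →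
      ‖Complex.Gamma (s + y * Complex.I) / Complex.Gamma (s + d + y * Complex.I)‖ ≤ C * |y| := by
  -- The denominator is raised by one, which makes the shift positive; undoing this multiplies by `w
  -- = s + d + iy`, of linear size.
  obtain ⟨C, hC, h⟩ := exists_norm_Gamma_div_le_of_pos (d := d + 1) (by linarith) s
  refine ⟨C * (|s + d| + 1), by positivity, fun y hy => ?_⟩
  have hy0 : y ≠ 0 := by rintro rfl; simp at hy; linarith
  set w : ℂ := s + d + y * Complex.I with hw
  have him : w.im = y := by simp [hw]
  have hw0 : w ≠ 0 := fun h0 => hy0 (by rw [← him, h0]; simp)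
  have hwn : ‖w‖ ≤ (|s + d| + 1) * |y| := by
    have : ‖w‖ ≤ |s + d| + |y| := by
      rw [hw]
      refine (norm_add_le _ _).trans (add_le_add ?_ ?_)
      · rw [← Complex.ofReal_add, Complex.norm_real, Real.norm_eq_abs]
      · simp
    nlinarith [abs_nonneg (s + d)]
  have h1 := h y hy
  rw [show (s : ℂ) + ((d + 1 : ℝ) : ℂ) + y * Complex.I = w + 1 by rw [hw]; push_cast; ring,
    Complex.Gamma_add_one _ hw0] at h1
  have h2 : Complex.Gamma (s + y * Complex.I) / Complex.Gamma w =
      Complex.Gamma (s + y * Complex.I) / (w * Complex.Gamma w) * w := by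
    field_simp
  rw [h2, norm_mul]
  calc _ ≤ C * ((|s + d| + 1) * |y|) := mul_le_mul h1 hwn (norm_nonneg _) hC
    _ = _ := by ring

/-- Quotient of the reflection formula at `a` and at `b`. The hyperbolic exchange factors all
originate here. -/
theorem Gamma_div_Gamma_mul_sin {a b : ℂ} (ha : Complex.sin (Real.pi * a) ≠ 0)
    (hb : Complex.sin (Real.pi * b) ≠ 0) :
    Complex.Gamma a / Complex.Gamma b * Complex.sin (Real.pi * a) =
      Complex.Gamma (1 - b) / Complex.Gamma (1 - a) * Complex.sin (Real.pi * b) := by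
  have h1 := Complex.Gamma_mul_Gamma_one_sub a
  have h2 := Complex.Gamma_mul_Gamma_one_sub b
  have hpi : (Real.pi : ℂ) ≠ 0 := by exact_mod_cast Real.pi_ne_zero
  have n1 : Complex.Gamma a * Complex.Gamma (1 - a) ≠ 0 := by
    rw [h1]; exact div_ne_zero hpi ha
  have n2 : Complex.Gamma b * Complex.Gamma (1 - b) ≠ 0 := by
    rw [h2]; exact div_ne_zero hpi hb
  rw [eq_div_iff ha] at h1
  rw [eq_div_iff hb] at h2
  have := (mul_ne_zero_iff.1 n1).2
  have := (mul_ne_zero_iff.1 n2).1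
  rw [div_mul_eq_mul_div, div_mul_eq_mul_div, div_eq_div_iff ‹_› ‹_›]
  linear_combination h1 - h2

theorem eventually_sin_affine_ne_zero {c : ℂ} (hc : c ≠ 0) (d z : ℂ) :
    ∀ᶠ γ in 𝓝[≠] z, Complex.sin (Real.pi * (d + c * γ)) ≠ 0 := by
  have hpi : (Real.pi : ℂ) ≠ 0 := by exact_mod_cast Real.pi_ne_zero
  have han : AnalyticOnNhd ℂ (fun γ : ℂ => Complex.sin (Real.pi * (d + c * γ))) univ := by
    have hdiff : Differentiable ℂ (fun γ : ℂ => Complex.sin (Real.pi * (d + c * γ))) := by fun_prop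
    exact fun x _ => hdiff.analyticAt x
  by_contra hcon
  rw [not_eventually] at hcon
  have h0 := han.eqOn_zero_of_preconnected_of_frequently_eq_zero isPreconnected_univ (mem_univ z)
    (hcon.mono fun γ hγ => not_not.1 hγ)
  -- At this point the argument of the sine is `π/2`, so the function is not identically zero and
  -- its zeros are isolated.
  have := h0 (mem_univ ((1 / 2 - d) / c))
  simp only [Pi.zero_apply] at this
  rw [show (Real.pi : ℂ) * (d + c * ((1 / 2 - d) / c)) = Real.pi / 2 by field_simp; ring,
    Complex.sin_pi_div_two] at this
  exact one_ne_zero this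

/-! ### Exchange of a current and a vertex operator -/

/-- Along horizontal lines `M` is continuous far out, and grows at most linearly. -/
def LinearGrowth (M : ℂ → ℂ) : Prop :=
  ∀ b : ℝ, ∃ C R : ℝ, 0 ≤ C ∧ ∀ x : ℝ, R ≤ |x| →
    ContinuousAt M (x + b * Complex.I) ∧ ‖M (x + b * Complex.I)‖ ≤ C * |x|

/-- `M` grows at most linearly along horizontal lines, as long as it is continuous there. -/
def HasLinearBound (M : ℂ → ℂ) : Prop :=
  ∀ b : ℝ, ∃ C R : ℝ, 0 ≤ C ∧ ∀ x : ℝ, R ≤ |x| →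
    ContinuousAt M (x + b * Complex.I) → ‖M (x + b * Complex.I)‖ ≤ C * |x|

/-- Both orders of the product of `:exp X(γ):` and `:exp Y(ζ):` exist, their contractions are
related by `(contrL γ) s₁(γ) = ν (contrR γ) s₂(γ)`, and grow at most linearly along horizontal
lines. -/
structure Exchange (P : Params) (X Y : ℂ → Exponent) (ζ ν : ℂ) (s₁ s₂ : ℂ → ℂ) : Prop where
  existsL : ∃ M, IsContinuation (densityL P X Y ζ) upper M
  existsR : ∃ M, IsContinuation (densityR P X Y ζ) lower M
  rel : ∀ z, ∀ᶠ γ in 𝓝[≠] z, contrL P X Y ζ γ * s₁ γ = ν * (contrR P X Y ζ γ * s₂ γ)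
  growthL : HasLinearBound (contrL P X Y ζ)
  growthR : HasLinearBound (contrR P X Y ζ)

/-- Equality on punctured neighbourhoods passes to the centre only where `N` is continuous; this is
why `HasLinearBound` is conditional on continuity. -/
theorem LinearGrowth.hasLinearBound {M N : ℂ → ℂ} (h : LinearGrowth M)
    (hN : ∀ z, N =ᶠ[𝓝[≠] z] M) : HasLinearBound N := by
  intro b
  obtain ⟨C, R, hC, h⟩ := h b
  refine ⟨C, R, hC, fun x hx hc => ?_⟩
  rw [eq_of_eventuallyEq_nhdsNE hc (h x hx).1 (hN _)]
  exact (h x hx).2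

section

variable {P : Params} {X Y : ℂ → Exponent} {ζ ν : ℂ} {s₁ s₂ : ℂ → ℂ}

theorem Exchange.of_represents {ML MR : ℂ → ℂ} (hL : Represents (densityL P X Y ζ) upper ML)
    (hR : Represents (densityR P X Y ζ) lower MR)
    (hrel : ∀ z, ∀ᶠ γ in 𝓝[≠] z, ML γ * s₁ γ = ν * (MR γ * s₂ γ))
    (hgL : LinearGrowth ML) (hgR : LinearGrowth MR) : Exchange P X Y ζ ν s₁ s₂ := by
  have eL := hL.continuation_eventuallyEq fun S hS => exists_isOpen_subset_of_mem_upper hS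
  have eR := hR.continuation_eventuallyEq fun S hS => exists_isOpen_subset_of_mem_lower hS
  refine ⟨hL.exists_isContinuation, hR.exists_isContinuation, fun z => ?_,
    hgL.hasLinearBound eL, hgR.hasLinearBound eR⟩
  filter_upwards [eL z, eR z, hrel z] with γ h1 h2 h3
  rw [contrL, contrR, h1, h2, h3]

/-- Operators with vanishing contractions commute. -/
theorem Exchange.of_density_eq_zero (hL : ∀ γ t, 0 < t → densityL P X Y ζ γ t = 0)
    (hR : ∀ γ t, 0 < t → densityR P X Y ζ γ t = 0) :
    Exchange P X Y ζ 1 (fun _ => 1) (fun _ => 1) := by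
  have hg : LinearGrowth fun _ => 1 := fun b => ⟨1, 1, zero_le_one, fun x hx =>
    ⟨continuousAt_const, by simpa using hx⟩⟩
  exact .of_represents (.const_one hL) (.const_one hR) (fun z => Eventually.of_forall fun γ => by
    simp) hg hg

theorem linearGrowth_affine (c d e : ℂ) : LinearGrowth fun γ => c * (d * γ + e) := by
  intro b
  refine ⟨‖c‖ * (‖d‖ * (1 + |b|) + ‖e‖), 1, by positivity, fun x hx => ⟨by fun_prop, ?_⟩⟩
  have h1 : ‖(x + b * Complex.I : ℂ)‖ ≤ |x| + |b| := (norm_add_le _ _).trans (by simp)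
  have h2 : ‖d * (x + b * Complex.I) + e‖ ≤ ‖d‖ * (|x| + |b|) + ‖e‖ := by
    refine (norm_add_le _ _).trans ?_
    rw [norm_mul]
    gcongr
  rw [norm_mul, mul_assoc]
  refine mul_le_mul_of_nonneg_left (h2.trans ?_) (norm_nonneg _)
  have h3 : |b| ≤ |b| * |x| := le_mul_of_one_le_right (abs_nonneg _) hx
  have h4 : ‖e‖ ≤ ‖e‖ * |x| := le_mul_of_one_le_right (norm_nonneg _) hx
  nlinarith [norm_nonneg d]

/-- Operators whose contractions are linear in the spectral parameter anticommute. -/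
theorem Exchange.of_density_exp (s : ℝ)
    (hL : ∀ γ t, 0 < t → densityL P X Y ζ γ t =
      -(Complex.exp (-(-Complex.I * (γ - ζ) - s) * t) / t))
    (hR : ∀ γ t, 0 < t → densityR P X Y ζ γ t =
      -(Complex.exp (-(Complex.I * (γ - ζ) + s) * t) / t)) :
    Exchange P X Y ζ (-1) (fun _ => 1) (fun _ => 1) := by
  obtain ⟨c, hc⟩ := exists_hasFinitePart_exp_div
  have hneg : ∀ {a : ℂ}, 0 < a.re → Complex.exp (-1 * (c - Complex.log a)) = Complex.exp (-c) * a :=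
    fun {a} ha => by
      have ha0 : a ≠ 0 := by rintro rfl; simp at ha
      rw [show -1 * (c - Complex.log a) = -c + Complex.log a by ring, Complex.exp_add,
        Complex.exp_log ha0]
  -- The logarithm in the exponential integral becomes a linear factor. The two orders give `e^{-c}
  -- a` and `-e^{-c} a` with `a = -i(γ-ζ) - s`, whence the sign `-1`.
  refine .of_represents
    (ML := fun γ => Complex.exp (-c) * (-Complex.I * γ + (Complex.I * ζ - s)))
    (MR := fun γ => Complex.exp (-c) * (Complex.I * γ + (-Complex.I * ζ + s)))
    ⟨fun z _ => AnalyticAt.meromorphicAt (by fun_prop), ?_⟩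
    ⟨fun z _ => AnalyticAt.meromorphicAt (by fun_prop), ?_⟩
    (fun z => Eventually.of_forall fun γ => by ring)
    (linearGrowth_affine _ _ _) (linearGrowth_affine _ _ _)
  · filter_upwards [eventually_upper_mul_im one_pos (ζ.im + s)] with γ hγ
    have hre : 0 < (-Complex.I * (γ - ζ) - s).re := by
      simp only [Complex.sub_re, neg_mul, Complex.neg_re, Complex.mul_re, Complex.I_re,
        Complex.I_im, Complex.sub_im, Complex.ofReal_re]
      linarith
    refine ⟨by fun_prop, _, (((hc _ hre).const_mul (-1)).congr fun t ht => ?_).isFinitePart, ?_⟩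
    · rw [hL γ t ht]; ring
    · rw [hneg hre]; ring
  · filter_upwards [eventually_lower_mul_im one_pos (ζ.im + s)] with γ hγ
    have hre : 0 < (Complex.I * (γ - ζ) + s).re := by
      simp only [Complex.sub_re, Complex.add_re, Complex.mul_re, Complex.I_re,
        Complex.I_im, Complex.sub_im, Complex.ofReal_re]
      linarith
    refine ⟨by fun_prop, _, (((hc _ hre).const_mul (-1)).congr fun t ht => ?_).isFinitePart, ?_⟩
    · rw [hR γ t ht]; ring
    · rw [hneg hre]; ring

/-- Since `1/Γ` is entire, `Γ` is the inverse of an analytic function. -/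
theorem meromorphicOn_Gamma_div (C c a b : ℂ) : MeromorphicOn
    (fun γ => C * (Complex.Gamma (c * γ + a) / Complex.Gamma (c * γ + b))) univ := by
  have h : ∀ a z : ℂ, MeromorphicAt (fun γ => Complex.Gamma (c * γ + a)) z := fun a z => by
    have hinv : Differentiable ℂ fun γ => (Complex.Gamma (c * γ + a))⁻¹ :=
      Complex.differentiable_one_div_Gamma.comp (by fun_prop)
    have := (hinv.analyticAt z).meromorphicAt.inv
    exact this.congr (Eventually.of_forall fun s => by simp)
  exact fun z _ => (MeromorphicAt.const C z).mul ((h a z).div (h b z))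

theorem analyticAt_Gamma_div {C c a b z : ℂ} (hz : ∀ m : ℕ, c * z + a ≠ -m) : AnalyticAt ℂ
    (fun γ => C * (Complex.Gamma (c * γ + a) / Complex.Gamma (c * γ + b))) z := by
  have hinv : ∀ a : ℂ, Differentiable ℂ fun γ => (Complex.Gamma (c * γ + a))⁻¹ := fun a =>
    Complex.differentiable_one_div_Gamma.comp (by fun_prop)
  have h1 : AnalyticAt ℂ (fun γ => Complex.Gamma (c * γ + a)) z := by
    have := ((hinv a).analyticAt z).fun_inv (inv_ne_zero (Complex.Gamma_ne_zero hz))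
    simpa using this
  simp only [div_eq_mul_inv]
  exact analyticAt_const.mul (h1.mul ((hinv b).analyticAt z))

/-- The factor `iρ` turns horizontal lines into vertical ones, and the poles of `Γ` are real, so
continuity holds once the imaginary part of the argument is at least `1` in modulus. -/
theorem linearGrowth_Gamma_div (C : ℂ) {ρ : ℝ} (hρ : ρ ≠ 0) (a : ℂ) {d : ℝ} (hd : -1 < d) :
    LinearGrowth fun γ => C * (Complex.Gamma (Complex.I * ρ * γ + a) /
      Complex.Gamma (Complex.I * ρ * γ + (a + d))) := by
  intro b
  obtain ⟨K, hK, h⟩ := exists_norm_Gamma_div_le hd (a.re - ρ * b)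
  refine ⟨‖C‖ * (K * (|ρ| + |a.im|)), max 1 ((1 + |a.im|) / |ρ|), by positivity, fun x hx => ?_⟩
  have hx1 : 1 ≤ |x| := (le_max_left _ _).trans hx
  have hρ' : 0 < |ρ| := abs_pos.2 hρ
  have hx2 : 1 + |a.im| ≤ |ρ| * |x| := by
    have := (le_max_right 1 ((1 + |a.im|) / |ρ|)).trans hx
    rwa [div_le_iff₀' hρ'] at this
  set y := ρ * x + a.im with hy
  have hy1 : 1 ≤ |y| := by
    have : |ρ * x| - |a.im| ≤ |y| := by
      rw [hy]; have := abs_sub_abs_le_abs_sub (ρ * x) (-a.im); simpa using this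
    rw [abs_mul] at this
    linarith
  have hy2 : |y| ≤ (|ρ| + |a.im|) * |x| := by
    have : |y| ≤ |ρ * x| + |a.im| := abs_add_le _ _
    rw [abs_mul] at this
    nlinarith [abs_nonneg a.im]
  have e1 : Complex.I * ρ * (x + b * Complex.I) + a =
      ((a.re - ρ * b : ℝ) : ℂ) + y * Complex.I := by
    apply Complex.ext <;> simp [hy] <;> ring
  have e2 : Complex.I * ρ * (x + b * Complex.I) + (a + d) =
      ((a.re - ρ * b : ℝ) : ℂ) + d + y * Complex.I := by
    rw [← add_assoc, e1]; ring
  have hy0 : y ≠ 0 := by intro h0; rw [h0] at hy1; simp at hy1; linarith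
  refine ⟨(analyticAt_Gamma_div fun m => ?_).continuousAt, ?_⟩
  · rw [e1]
    exact ne_neg_natCast_of_im_ne_zero (by simpa using hy0) m
  · beta_reduce
    rw [e1, e2, norm_mul, mul_assoc]
    refine mul_le_mul_of_nonneg_left ((h y hy1).trans ?_) (norm_nonneg _)
    calc K * |y| ≤ K * ((|ρ| + |a.im|) * |x|) := mul_le_mul_of_nonneg_left hy2 hK
      _ = _ := by ring

/-- The exchange relation for contractions that are quotients of Gamma functions. -/
theorem Exchange.of_density_gamma {ρ : ℝ} (hρ : 0 < ρ) (z w : ℝ) (hzw : z - w < 1) (κ : ℂ)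
    (hL : ∀ γ t, 0 < t → densityL P X Y ζ γ t =
      (Complex.exp (-((z - Complex.I * ρ * (γ - ζ)) * (ρ⁻¹ : ℝ)) * t) -
        Complex.exp (-((w - Complex.I * ρ * (γ - ζ)) * (ρ⁻¹ : ℝ)) * t)) /
        (1 - Complex.exp (-((ρ⁻¹ : ℝ) : ℂ) * t)) / t)
    (hR : ∀ γ t, 0 < t → densityR P X Y ζ γ t =
      (Complex.exp (-((1 - w + Complex.I * ρ * (γ - ζ)) * (ρ⁻¹ : ℝ)) * t) -
        Complex.exp (-((1 - z + Complex.I * ρ * (γ - ζ)) * (ρ⁻¹ : ℝ)) * t)) /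
        (1 - Complex.exp (-((ρ⁻¹ : ℝ) : ℂ) * t)) / t)
    (h₁ : ∀ γ, s₁ γ = κ * Complex.sin (Real.pi * (z - Complex.I * ρ * (γ - ζ))))
    (h₂ : ∀ γ, ν * s₂ γ = κ * Complex.sin (Real.pi * (w - Complex.I * ρ * (γ - ζ)))) :
    Exchange P X Y ζ ν s₁ s₂ := by
  obtain ⟨c, hc⟩ := exists_hasFinitePart_gamma (inv_pos.2 hρ)
  -- The Gamma arguments of both orders have the same difference, so the same constant serves for
  -- both and cancels from the relation.
  set C := Complex.exp ((w - z) * c) with hC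
  have hc0 : -(Complex.I * ρ) ≠ 0 := by
    simpa using hρ.ne'
  refine .of_represents
    (ML := fun γ => C * (Complex.Gamma (Complex.I * ((-ρ : ℝ) : ℂ) * γ +
      (z + Complex.I * ρ * ζ)) / Complex.Gamma (Complex.I * ((-ρ : ℝ) : ℂ) * γ +
      ((z + Complex.I * ρ * ζ) + ((w - z : ℝ) : ℂ)))))
    (MR := fun γ => C * (Complex.Gamma (Complex.I * (ρ : ℂ) * γ +
      (1 - w - Complex.I * ρ * ζ)) / Complex.Gamma (Complex.I * (ρ : ℂ) * γ +
      ((1 - w - Complex.I * ρ * ζ) + ((w - z : ℝ) : ℂ)))))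
    ⟨meromorphicOn_Gamma_div _ _ _ _, ?_⟩ ⟨meromorphicOn_Gamma_div _ _ _ _, ?_⟩ (fun x => ?_)
    (linearGrowth_Gamma_div _ (neg_ne_zero.2 hρ.ne') _ (by linarith))
    (linearGrowth_Gamma_div _ hρ.ne' _ (by linarith))
  · filter_upwards [eventually_upper_mul_im hρ (ρ * ζ.im - z),
      eventually_upper_mul_im hρ (ρ * ζ.im - w)] with γ h1 h2
    have r1 : 0 < (z - Complex.I * ρ * (γ - ζ)).re := by simp; linarith
    have r2 : 0 < (w - Complex.I * ρ * (γ - ζ)).re := by simp; linarith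
    have e1 : Complex.I * ((-ρ : ℝ) : ℂ) * γ + (z + Complex.I * ρ * ζ) =
        z - Complex.I * ρ * (γ - ζ) := by push_cast; ring
    have e2 : Complex.I * ((-ρ : ℝ) : ℂ) * γ + ((z + Complex.I * ρ * ζ) + ((w - z : ℝ) : ℂ)) =
        w - Complex.I * ρ * (γ - ζ) := by push_cast; ring
    obtain ⟨L, hfp, hexp⟩ := hc _ _ r1 r2
    refine ⟨analyticAt_Gamma_div fun m => ?_, L, (hfp.congr fun t ht => hL γ t ht).isFinitePart, ?_⟩
    · rw [e1]; exact ne_neg_natCast_of_re_pos r1 m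
    · rw [e1, e2, hexp, hC]; congr 3; ring
  · filter_upwards [eventually_lower_mul_im hρ (ρ * ζ.im + 1 - w),
      eventually_lower_mul_im hρ (ρ * ζ.im + 1 - z)] with γ h1 h2
    have r1 : 0 < (1 - w + Complex.I * ρ * (γ - ζ)).re := by simp; linarith
    have r2 : 0 < (1 - z + Complex.I * ρ * (γ - ζ)).re := by simp; linarith
    have e1 : Complex.I * (ρ : ℂ) * γ + (1 - w - Complex.I * ρ * ζ) =
        1 - w + Complex.I * ρ * (γ - ζ) := by ring
    have e2 : Complex.I * (ρ : ℂ) * γ + ((1 - w - Complex.I * ρ * ζ) + ((w - z : ℝ) : ℂ)) =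
        1 - z + Complex.I * ρ * (γ - ζ) := by push_cast; ring
    obtain ⟨L, hfp, hexp⟩ := hc _ _ r1 r2
    refine ⟨analyticAt_Gamma_div fun m => ?_, L, (hfp.congr fun t ht => hR γ t ht).isFinitePart, ?_⟩
    · rw [e1]; exact ne_neg_natCast_of_re_pos r1 m
    · rw [e1, e2, hexp, hC]; congr 3; ring
  · filter_upwards [eventually_sin_affine_ne_zero hc0 (z + Complex.I * ρ * ζ) x,
      eventually_sin_affine_ne_zero hc0 (w + Complex.I * ρ * ζ) x] with γ n1 n2
    rw [show (z + Complex.I * ρ * ζ + -(Complex.I * ρ) * γ : ℂ) =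
      z - Complex.I * ρ * (γ - ζ) by ring] at n1
    rw [show (w + Complex.I * ρ * ζ + -(Complex.I * ρ) * γ : ℂ) =
      w - Complex.I * ρ * (γ - ζ) by ring] at n2
    -- Reflection with `a = z - iρ(γ-ζ)` and `b = w - iρ(γ-ζ)`; the opposite order has arguments `1
    -- - b` and `1 - a`.
    have key := Gamma_div_Gamma_mul_sin n1 n2
    rw [h₁, mul_left_comm ν, h₂,
      show Complex.I * ((-ρ : ℝ) : ℂ) * γ + (z + Complex.I * ρ * ζ) =
        z - Complex.I * ρ * (γ - ζ) by push_cast; ring,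
      show Complex.I * ((-ρ : ℝ) : ℂ) * γ + ((z + Complex.I * ρ * ζ) + ((w - z : ℝ) : ℂ)) =
        w - Complex.I * ρ * (γ - ζ) by push_cast; ring,
      show Complex.I * (ρ : ℂ) * γ + (1 - w - Complex.I * ρ * ζ) =
        1 - (w - Complex.I * ρ * (γ - ζ)) by ring,
      show Complex.I * (ρ : ℂ) * γ + ((1 - w - Complex.I * ρ * ζ) + ((w - z : ℝ) : ℂ)) =
        1 - (z - Complex.I * ρ * (γ - ζ)) by push_cast; ring]
    linear_combination C * κ * key

end

/-! ### Contractions of the boson fields -/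

namespace Params

variable (P : Params)

theorem s_neg_left (A t : ℝ) : P.s (-A) t = -P.s A t := by
  rw [s, s, ← Real.sinh_neg]; congr 1; ring

theorem s_neg_right (A t : ℝ) : P.s A (-t) = -P.s A t := by
  rw [s, s, ← Real.sinh_neg]; congr 1; ring

theorem s_pos {A t : ℝ} (hA : 0 < A) (ht : 0 < t) : 0 < P.s A t := by
  have := P.hbar_pos
  rw [s, Real.sinh_pos_iff]
  positivity

theorem k_pos : 0 < P.k := by
  have := P.level_pos
  rw [k]
  exact_mod_cast this

theorem s_eq_exp (A t : ℝ) :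
    ((P.s A t : ℝ) : ℂ) = (Complex.exp ((P.hbar * A * t / 2 : ℝ) : ℂ) -
      (Complex.exp ((P.hbar * A * t / 2 : ℝ) : ℂ))⁻¹) / 2 := by
  rw [s, Real.sinh_eq, ← Complex.exp_neg]
  push_cast
  rfl

end Params

section

variable (P : Params) {t : ℝ}

theorem phi_apply_pos (ht : 0 < t) (j : Fin 3) (A B C : ℝ) (α : ℂ) (D : ℝ) :
    phi P j A B C α D j t = P.hbar * (P.s A t / (P.s B t * P.s C t)) *
      (Complex.exp (Complex.I * α * t) * Complex.exp ((P.hbar * D / 2 * t : ℝ) : ℂ)) := by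
  rw [phi, Pi.single_eq_same, Complex.exp_add, abs_of_pos ht]
  push_cast
  ring

theorem phi_apply_neg (ht : 0 < t) (j : Fin 3) (A B C : ℝ) (α : ℂ) (D : ℝ) :
    phi P j A B C α D j (-t) = -(P.hbar * (P.s A t / (P.s B t * P.s C t)) *
      ((Complex.exp (Complex.I * α * t))⁻¹ * Complex.exp ((P.hbar * D / 2 * t : ℝ) : ℂ))) := by
  rw [phi, Pi.single_eq_same, Complex.exp_add, abs_neg, abs_of_pos ht, P.s_neg_right,
    P.s_neg_right, P.s_neg_right, ← Complex.exp_neg]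
  push_cast
  rw [neg_mul_neg, mul_neg, neg_div]
  ring

theorem phi_apply_of_ne {i j : Fin 3} (h : i ≠ j) (A B C : ℝ) (α : ℂ) (D t : ℝ) :
    phi P j A B C α D i t = 0 := by
  rw [phi, Pi.single_eq_of_ne h]; rfl

theorem phiPlus_apply_pos (ht : 0 < t) (j : Fin 3) (A B : ℝ) (α : ℂ) (D : ℝ) :
    phiPlus P j A B α D j t = 2 * P.hbar * (P.s A t / P.s B t) *
      (Complex.exp (Complex.I * α * t) * Complex.exp ((P.hbar * D / 2 * t : ℝ) : ℂ)) := by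
  rw [phiPlus, Pi.single_eq_same, indicator_of_mem (by exact ht), halfCoeff, Complex.exp_add,
    abs_of_pos ht]
  push_cast
  ring

theorem phiPlus_apply_neg (ht : 0 < t) (i j : Fin 3) (A B : ℝ) (α : ℂ) (D : ℝ) :
    phiPlus P j A B α D i (-t) = 0 := by
  by_cases h : i = j
  · subst h
    rw [phiPlus, Pi.single_eq_same, indicator_of_notMem (by simpa using ht.le)]
  · rw [phiPlus, Pi.single_eq_of_ne h]; rfl

theorem phiPlus_apply_of_ne {i j : Fin 3} (h : i ≠ j) (A B : ℝ) (α : ℂ) (D t : ℝ) :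
    phiPlus P j A B α D i t = 0 := by
  rw [phiPlus, Pi.single_eq_of_ne h]; rfl

theorem phiMinus_apply_neg (ht : 0 < t) (j : Fin 3) (A B : ℝ) (α : ℂ) (D : ℝ) :
    phiMinus P j A B α D j (-t) = 2 * P.hbar * (P.s A t / P.s B t) *
      ((Complex.exp (Complex.I * α * t))⁻¹ * Complex.exp ((P.hbar * D / 2 * t : ℝ) : ℂ)) := by
  rw [phiMinus, Pi.single_eq_same, indicator_of_mem (by simpa using ht), halfCoeff,
    Complex.exp_add, abs_neg, abs_of_pos ht, P.s_neg_right, P.s_neg_right, neg_div_neg_eq,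
    ← Complex.exp_neg]
  push_cast
  rw [mul_neg]

theorem phiMinus_apply_pos (ht : 0 < t) (i j : Fin 3) (A B : ℝ) (α : ℂ) (D : ℝ) :
    phiMinus P j A B α D i t = 0 := by
  by_cases h : i = j
  · subst h
    rw [phiMinus, Pi.single_eq_same, indicator_of_notMem (by simpa using ht.le)]
  · rw [phiMinus, Pi.single_eq_of_ne h]; rfl

theorem phiMinus_apply_of_ne {i j : Fin 3} (h : i ≠ j) (A B : ℝ) (α : ℂ) (D t : ℝ) :
    phiMinus P j A B α D i t = 0 := by
  rw [phiMinus, Pi.single_eq_of_ne h]; rfl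

theorem exp_I_mul_sub (γ ζ : ℂ) (t : ℝ) : Complex.exp (Complex.I * (γ - ζ) * t) =
    Complex.exp (Complex.I * γ * t) * (Complex.exp (Complex.I * ζ * t))⁻¹ := by
  rw [← Complex.exp_neg, ← Complex.exp_add]; congr 1; ring


/-- The exponentials that occur in the contractions of the parafermion currents. -/
theorem exists_exp_variables (ht : 0 < t) : ∃ r q : ℂ, r ≠ 0 ∧ q ≠ 0 ∧
    Complex.exp (P.hbar * (P.k / 2) / 2 * t) = r ∧
    Complex.exp (P.hbar * (-P.k / 2) / 2 * t) = r⁻¹ ∧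
    Complex.exp (P.hbar * ((P.k + 2) / 2) / 2 * t) = r * q ∧
    Complex.exp (P.hbar * ((-2 + -P.k) / 2) / 2 * t) = r⁻¹ * q⁻¹ ∧
    Complex.exp (P.hbar * P.k * t / 2) = r ^ 2 ∧
    Complex.exp (-(P.hbar * P.k * t / 2)) = (r ^ 2)⁻¹ ∧
    (P.s 2 t : ℂ) = P.s 1 t * (q + q⁻¹) ∧ q ^ 2 + 1 ≠ 0 ∧
    2 * (P.s P.k t : ℂ) = r ^ 2 - (r ^ 2)⁻¹ := by
  have h2 : (P.s 2 t : ℂ) ≠ 0 := by exact_mod_cast (P.s_pos two_pos ht).ne'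
  have hs : (P.s 2 t : ℂ) = P.s 1 t *
      (Complex.exp (P.hbar * t / 2) + (Complex.exp (P.hbar * t / 2))⁻¹) := by
    rw [P.s_eq_exp, P.s_eq_exp,
      show ((P.hbar * 2 * t / 2 : ℝ) : ℂ) = P.hbar * t / 2 + P.hbar * t / 2 by push_cast; ring,
      show ((P.hbar * 1 * t / 2 : ℝ) : ℂ) = P.hbar * t / 2 by push_cast; ring, Complex.exp_add,
      mul_inv]
    ring
  refine ⟨Complex.exp (P.hbar * P.k * t / 4), Complex.exp (P.hbar * t / 2),
    Complex.exp_ne_zero _, Complex.exp_ne_zero _, ?_, ?_, ?_, ?_, ?_, ?_, hs, ?_, ?_⟩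
  · congr 1; ring
  · rw [← Complex.exp_neg]; congr 1; ring
  · rw [← Complex.exp_add]; congr 1; ring
  · rw [← Complex.exp_neg, ← Complex.exp_neg, ← Complex.exp_add]; congr 1; ring
  · rw [← Complex.exp_nat_mul]; congr 1; push_cast; ring
  · rw [← Complex.exp_nat_mul, ← Complex.exp_neg]; congr 1; push_cast; ring
  · have h := right_ne_zero_of_mul (hs ▸ h2)
    have hq := Complex.exp_ne_zero (P.hbar * t / 2)
    intro h0
    apply h
    generalize Complex.exp (P.hbar * t / 2) = q at *
    field_simp
    simpa using h0
  · rw [P.s_eq_exp, ← Complex.exp_nat_mul,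
      show ((P.hbar * P.k * t / 2 : ℝ) : ℂ) = ((2 : ℕ) : ℂ) * (P.hbar * P.k * t / 4) by
        push_cast; ring]
    ring

/-- The contractions of the parafermion current `Ψ^τ(γ)` and the primary field `φ_{n,τn}(ζ)`. -/
theorem para_primary_same (ht : 0 < t) {τ : ℝ} (hτ : τ = 1 ∨ τ = -1) (b : Bool) (n : ℕ)
    (γ ζ : ℂ) :
    contractionDensity P (paraExp P τ b γ) (primaryExp P n τ ζ) t =
      Complex.exp (Complex.I * (γ - ζ) * t) * ((-(P.s n t / P.s P.k t *
        Real.exp ((bif b then -τ else τ) * (P.hbar * P.k * t / 2))) / t : ℝ) : ℂ) ∧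
    contractionDensity P (primaryExp P n τ ζ) (paraExp P τ b γ) t =
      Complex.exp (Complex.I * (ζ - γ) * t) * ((-(P.s n t / P.s P.k t *
        Real.exp ((bif b then τ else -τ) * (P.hbar * P.k * t / 2))) / t : ℝ) : ℂ) := by
  have hk : (P.s P.k t : ℂ) ≠ 0 := by exact_mod_cast (P.s_pos P.k_pos ht).ne'
  have hk2 : (P.s (P.k + 2) t : ℂ) ≠ 0 := by
    exact_mod_cast (P.s_pos (A := P.k + 2) (by linarith [P.k_pos]) ht).ne'
  have h1 : (P.s 1 t : ℂ) ≠ 0 := by exact_mod_cast (P.s_pos (A := 1) one_pos ht).ne'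
  have hh : (P.hbar : ℂ) ≠ 0 := by exact_mod_cast P.hbar_pos.ne'
  have ht' : (t : ℂ) ≠ 0 := by exact_mod_cast ht.ne'
  obtain ⟨r, q, hr, hq, e1, e2, e3, e4, e5, e6, s2, hqq, sk⟩ := exists_exp_variables P ht
  rw [exp_I_mul_sub, exp_I_mul_sub]
  have ha := Complex.exp_ne_zero (Complex.I * γ * t)
  have hz := Complex.exp_ne_zero (Complex.I * ζ * t)
  constructor <;> rcases hτ with rfl | rfl <;> cases b <;>
    simp [contractionDensity, paraExp, primaryExp, Fin.sum_univ_three, phi_apply_pos P ht,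
      phi_apply_neg P ht, phi_apply_of_ne, phiPlus_apply_pos P ht, phiPlus_apply_neg P ht,
      phiPlus_apply_of_ne, phiMinus_apply_pos P ht, phiMinus_apply_neg P ht,
      phiMinus_apply_of_ne, P.s_neg_left, comm, e1, e2, e3, e4, e5, e6, -one_div] <;>
    generalize Complex.exp (Complex.I * γ * t) = a at ha ⊢ <;>
    generalize Complex.exp (Complex.I * ζ * t) = z at hz ⊢ <;>
    clear e1 e2 e3 e4 e5 e6 <;> try rw [s2]
  -- What remains is rational in `r`, `q`, `a`, `z` and the sinh values. When a half field
  -- contributes, its `a_1` and `a_2` parts carry `q` and `q⁻¹`, and `q + q⁻¹ = s_2/s_1` removes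
  -- their denominator; then `2 s_k = r² - r⁻²` changes `r^{±2}` into `r^{∓2}`.
  all_goals field_simp
  all_goals grind

/-- The contractions of the parafermion current `Ψ^τ(γ)` and the primary field `φ_{n,-τn}(ζ)`. -/
theorem para_primary_opposite (ht : 0 < t) {τ : ℝ} (hτ : τ = 1 ∨ τ = -1) (b : Bool) (n : ℕ)
    (γ ζ : ℂ) :
    contractionDensity P (paraExp P τ b γ) (primaryExp P n (-τ) ζ) t =
      Complex.exp (Complex.I * (γ - ζ) * t) * ((P.s n t / P.s P.k t / t : ℝ) : ℂ) ∧
    contractionDensity P (primaryExp P n (-τ) ζ) (paraExp P τ b γ) t =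
      Complex.exp (Complex.I * (ζ - γ) * t) * ((P.s n t / P.s P.k t / t : ℝ) : ℂ) := by
  have hk : (P.s P.k t : ℂ) ≠ 0 := by exact_mod_cast (P.s_pos P.k_pos ht).ne'
  have hk2 : (P.s (P.k + 2) t : ℂ) ≠ 0 := by
    exact_mod_cast (P.s_pos (A := P.k + 2) (by linarith [P.k_pos]) ht).ne'
  have h1 : (P.s 1 t : ℂ) ≠ 0 := by exact_mod_cast (P.s_pos (A := 1) one_pos ht).ne'
  have hh : (P.hbar : ℂ) ≠ 0 := by exact_mod_cast P.hbar_pos.ne'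
  have ht' : (t : ℂ) ≠ 0 := by exact_mod_cast ht.ne'
  obtain ⟨r, q, hr, hq, e1, e2, e3, e4, e5, e6, s2, hqq, sk⟩ := exists_exp_variables P ht
  rw [exp_I_mul_sub, exp_I_mul_sub]
  have ha := Complex.exp_ne_zero (Complex.I * γ * t)
  have hz := Complex.exp_ne_zero (Complex.I * ζ * t)
  constructor <;> rcases hτ with rfl | rfl <;> cases b <;>
    simp [contractionDensity, paraExp, primaryExp, Fin.sum_univ_three, phi_apply_pos P ht,
      phi_apply_neg P ht, phi_apply_of_ne, phiPlus_apply_pos P ht, phiPlus_apply_neg P ht,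
      phiPlus_apply_of_ne, phiMinus_apply_pos P ht, phiMinus_apply_neg P ht,
      phiMinus_apply_of_ne, P.s_neg_left, comm, e1, e2, e3, e4, -one_div] <;>
    generalize Complex.exp (Complex.I * γ * t) = a at ha ⊢ <;>
    generalize Complex.exp (Complex.I * ζ * t) = z at hz ⊢ <;>
    clear e1 e2 e3 e4 e5 e6 <;> try rw [s2]
  -- With opposite signs the `a_1` and `a_2` half fields carry equal exponentials and cancel, so
  -- only the full field `φ_2` contributes.
  all_goals field_simp
  all_goals grind

section

variable {P} {A a C c : Exponent}

/-- The boson `a_0` commutes with `a_1` and `a_2`. -/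
theorem contractionDensity_add_add (hA : A 0 t = 0) (hC : C 0 (-t) = 0)
    (ha : ∀ j ≠ 0, a j t = 0) (hc : ∀ j ≠ 0, c j (-t) = 0) :
    contractionDensity P (A + a) (C + c) t =
      contractionDensity P A C t + contractionDensity P a c t := by
  simp only [contractionDensity, Fin.sum_univ_three, Pi.add_apply, hA, hC,
    ha 1 (by decide), ha 2 (by decide), hc 1 (by decide), hc 2 (by decide)]
  ring

theorem contractionDensity_neg_left :
    contractionDensity P (-a) c t = -contractionDensity P a c t := by
  simp only [contractionDensity, Fin.sum_univ_three, Pi.neg_apply]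
  ring

theorem contractionDensity_neg_right :
    contractionDensity P a (-c) t = -contractionDensity P a c t := by
  simp only [contractionDensity, Fin.sum_univ_three, Pi.neg_apply]
  ring

end

theorem paraExp_apply_zero (τ : ℝ) (b : Bool) (γ : ℂ) (t : ℝ) : paraExp P τ b γ 0 t = 0 := by
  cases b <;> simp [paraExp, phi_apply_of_ne, phiPlus_apply_of_ne, phiMinus_apply_of_ne]

theorem primaryExp_apply_zero (n : ℕ) (τ : ℝ) (ζ : ℂ) (t : ℝ) : primaryExp P n τ ζ 0 t = 0 := by
  simp [primaryExp, phi_apply_of_ne]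

theorem phi'_apply_of_ne {j : Fin 3} (hj : j ≠ 0) (A B C : ℝ) (α : ℂ) (D t : ℝ) :
    phi' P A B C α D j t = 0 := by
  simp [phi', phi_apply_of_ne P hj]

/-- The contraction of two fields `φ_0`. -/
theorem phi_zero_phi_zero (ht : 0 < t) (A B C A' B' C' : ℝ) (γ ζ : ℂ) :
    contractionDensity P (phi P 0 A B C γ 0) (phi P 0 A' B' C' ζ 0) t =
      Complex.exp (Complex.I * (γ - ζ) * t) * ((-(P.s A t / (P.s B t * P.s C t) *
        (P.s A' t / (P.s B' t * P.s C' t)) *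
        (P.s 2 t * P.s P.k t * P.s (P.xi + P.k) t / P.s P.xi t)) / t : ℝ) : ℂ) := by
  have hh : (P.hbar : ℂ) ≠ 0 := by exact_mod_cast P.hbar_pos.ne'
  have ht' : (t : ℂ) ≠ 0 := by exact_mod_cast ht.ne'
  have hξ : (P.s P.xi t : ℂ) ≠ 0 := by exact_mod_cast (P.s_pos P.xi_pos ht).ne'
  rw [exp_I_mul_sub]
  simp only [contractionDensity, Fin.sum_univ_three, phi_apply_pos P ht, phi_apply_neg P ht,
    phi_apply_of_ne P (show (1 : Fin 3) ≠ 0 by decide),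
    phi_apply_of_ne P (show (2 : Fin 3) ≠ 0 by decide), comm, Matrix.cons_val_zero, mul_zero,
    zero_div, zero_mul, add_zero, Complex.ofReal_zero, Complex.exp_zero, mul_one]
  push_cast
  field_simp

theorem phi'_eq_smul_left (A B C : ℝ) (α : ℂ) (D : ℝ) (Y : Exponent) (t : ℝ) :
    contractionDensity P (phi' P A B C α D) Y t =
      ((P.s P.xi t / P.s (P.xi + P.k) t : ℝ) : ℂ) *
        contractionDensity P (phi P 0 A B C α D) Y t := by
  simp only [contractionDensity, phi', Finset.mul_sum]
  exact Finset.sum_congr rfl fun j _ => by ring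

theorem phi'_eq_smul_right (A B C : ℝ) (α : ℂ) (D : ℝ) (X : Exponent) (t : ℝ) :
    contractionDensity P X (phi' P A B C α D) t =
      ((P.s P.xi t / P.s (P.xi + P.k) t : ℝ) : ℂ) *
        contractionDensity P X (phi P 0 A B C α D) t := by
  simp only [contractionDensity, phi', Finset.mul_sum, P.s_neg_right, neg_div_neg_eq]
  exact Finset.sum_congr rfl fun j _ => by ring

end

/-! ### The exchange relations of the currents and the vertex operators -/

namespace Params

variable (P : Params)

/-- `exp (ħ A t / 2)` -/
noncomputable def ex (A t : ℝ) : ℝ := Real.exp (P.hbar * A * t / 2)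

theorem ex_pos (A t : ℝ) : 0 < P.ex A t := Real.exp_pos _

theorem ex_add (A B t : ℝ) : P.ex (A + B) t = P.ex A t * P.ex B t := by
  rw [ex, ex, ex, ← Real.exp_add]; congr 1; ring

theorem ex_neg (A t : ℝ) : P.ex (-A) t = (P.ex A t)⁻¹ := by
  rw [ex, ex, ← Real.exp_neg]; congr 1; ring

theorem ex_sub (A B t : ℝ) : P.ex (A - B) t = P.ex A t * (P.ex B t)⁻¹ := by
  rw [sub_eq_add_neg, ex_add, ex_neg]

theorem s_eq_ex (A t : ℝ) : P.s A t = (P.ex A t - (P.ex A t)⁻¹) / 2 := by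
  rw [s, Real.sinh_eq, ← ex_neg, ex, ex]
  congr 3
  ring_nf

theorem xi_add_k_pos : 0 < P.xi + P.k := add_pos P.xi_pos P.k_pos

end Params

/-! ### Exchange relations from exponential and hyperbolic densities -/

section

variable {P : Params} {X Y : ℂ → Exponent} {ζ ν : ℂ} {s₁ s₂ : ℂ → ℂ}

theorem Exchange.of_density_ex (N : ℝ)
    (hL : ∀ γ t, 0 < t → densityL P X Y ζ γ t =
      Complex.exp (Complex.I * (γ - ζ) * t) * ((-P.ex N t / t : ℝ) : ℂ))
    (hR : ∀ γ t, 0 < t → densityR P X Y ζ γ t =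
      Complex.exp (Complex.I * (ζ - γ) * t) * ((-P.ex (-N) t / t : ℝ) : ℂ)) :
    Exchange P X Y ζ (-1) (fun _ => 1) (fun _ => 1) := by
  refine .of_density_exp (P.hbar * N / 2) (fun γ t ht => ?_) fun γ t ht => ?_
  · rw [hL γ t ht, Params.ex]
    push_cast
    rw [mul_div_assoc', mul_neg, ← Complex.exp_add, neg_div]
    congr 3
    ring
  · rw [hR γ t ht, Params.ex]
    push_cast
    rw [mul_div_assoc', mul_neg, ← Complex.exp_add, neg_div]
    congr 3
    ring

/-- At scale `b = ħC` the identity `1 - e^{-ħCt} = 2 s_C(t) e^{-ħCt/2}` translates Malmsten's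
integrand into the hyperbolic form in which boson contractions appear. -/
theorem gamma_density_eq {C t : ℝ} (hC : 0 < C) (ht : 0 < t) (z w : ℝ) (u : ℂ) :
    (Complex.exp (-((z + u) * ((1 / (P.hbar * C))⁻¹ : ℝ)) * t) -
        Complex.exp (-((w + u) * ((1 / (P.hbar * C))⁻¹ : ℝ)) * t)) /
        (1 - Complex.exp (-(((1 / (P.hbar * C))⁻¹ : ℝ) : ℂ) * t)) / t =
      Complex.exp (-(u * (P.hbar * C)) * t) *
        (((P.ex (C - 2 * C * z) t - P.ex (C - 2 * C * w) t) / (2 * P.s C t) / t : ℝ) : ℂ) := by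
  have he : ∀ x : ℝ, Complex.exp (-((x + u) * ((1 / (P.hbar * C))⁻¹ : ℝ)) * t) =
      Complex.exp (-(u * (P.hbar * C)) * t) * ((P.ex (2 * C * x) t)⁻¹ : ℝ) := fun x => by
    rw [← P.ex_neg, Params.ex, Complex.ofReal_exp, ← Complex.exp_add, one_div, inv_inv]
    congr 1
    push_cast
    ring
  have hd : Complex.exp (-(((1 / (P.hbar * C))⁻¹ : ℝ) : ℂ) * t) =
      (((P.ex C t)⁻¹ * (P.ex C t)⁻¹ : ℝ) : ℂ) := by
    rw [← P.ex_neg, ← P.ex_add, Params.ex, Complex.ofReal_exp, one_div, inv_inv]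
    congr 1
    push_cast
    ring
  have hs := P.s_pos hC ht
  have hx := P.ex_pos C t
  have h1 : 1 - (P.ex C t)⁻¹ * (P.ex C t)⁻¹ = 2 * P.s C t * (P.ex C t)⁻¹ := by
    rw [P.s_eq_ex]; field_simp
  have key : ((P.ex (2 * C * z) t)⁻¹ - (P.ex (2 * C * w) t)⁻¹) /
      (1 - (P.ex C t)⁻¹ * (P.ex C t)⁻¹) / t =
      (P.ex (C - 2 * C * z) t - P.ex (C - 2 * C * w) t) / (2 * P.s C t) / t := by
    rw [h1, P.ex_sub, P.ex_sub]
    field_simp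
  rw [he, he, hd, ← key]
  push_cast
  ring

/-- Apply the Gamma case with `z = A/(2C)`, `w = B/(2C)` and `ρ = 1/(ħC)`. The bound on `A - B` says
`z - w < 1`, which keeps the growth at most linear, and `sin` of an imaginary multiple gives `sinh`.
-/
theorem Exchange.of_density_sinh {C : ℝ} (hC : 0 < C) (A B : ℝ) (hAB : A - B < 2 * C) (κ : ℂ)
    (hL : ∀ γ t, 0 < t → densityL P X Y ζ γ t = Complex.exp (Complex.I * (γ - ζ) * t) *
      (((P.ex (C - A) t - P.ex (C - B) t) / (2 * P.s C t) / t : ℝ) : ℂ))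
    (hR : ∀ γ t, 0 < t → densityR P X Y ζ γ t = Complex.exp (Complex.I * (ζ - γ) * t) *
      (((P.ex (B - C) t - P.ex (A - C) t) / (2 * P.s C t) / t : ℝ) : ℂ))
    (h₁ : ∀ γ, s₁ γ = κ * Complex.sinh ((Real.pi * (1 / (P.hbar * C)) : ℝ) *
      (γ - ζ + Complex.I * P.hbar / 2 * A)))
    (h₂ : ∀ γ, ν * s₂ γ = κ * Complex.sinh ((Real.pi * (1 / (P.hbar * C)) : ℝ) *
      (γ - ζ + Complex.I * P.hbar / 2 * B))) :
    Exchange P X Y ζ ν s₁ s₂ := by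
  have hh := P.hbar_pos
  have hh' : (P.hbar : ℂ) ≠ 0 := by exact_mod_cast hh.ne'
  have hC' : (C : ℂ) ≠ 0 := by exact_mod_cast hC.ne'
  have hsin : ∀ (A : ℝ) (u : ℂ), Complex.sinh ((Real.pi * (1 / (P.hbar * C)) : ℝ) *
      (u + Complex.I * P.hbar / 2 * A)) = Complex.I * Complex.sin (Real.pi *
        (((A / (2 * C) : ℝ) : ℂ) - Complex.I * ((1 / (P.hbar * C) : ℝ) : ℂ) * u)) := fun A u => by
    have : (Real.pi : ℂ) * (((A / (2 * C) : ℝ) : ℂ) -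
        Complex.I * ((1 / (P.hbar * C) : ℝ) : ℂ) * u) =
        -((Real.pi * (1 / (P.hbar * C)) : ℝ) * (u + Complex.I * P.hbar / 2 * A)) * Complex.I := by
      push_cast
      field_simp
      linear_combination (A : ℂ) * P.hbar * Complex.I_sq
    rw [this, Complex.sin_mul_I, Complex.sinh_neg]
    linear_combination (Complex.sinh ((Real.pi * (1 / (P.hbar * C)) : ℝ) *
      (u + Complex.I * P.hbar / 2 * A))) * Complex.I_sq
  have ha : ∀ A : ℝ, 2 * C * (A / (2 * C)) = A := fun A => by field_simp
  have hb : ∀ A : ℝ, C - 2 * C * (1 - A / (2 * C)) = A - C := fun A => by field_simp; ring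
  refine .of_density_gamma (ρ := 1 / (P.hbar * C)) (by positivity) (A / (2 * C)) (B / (2 * C)) ?_
    (κ * Complex.I) (fun γ t ht => ?_) (fun γ t ht => ?_) (fun γ => ?_) fun γ => ?_
  · rw [← sub_div, div_lt_one (by positivity)]; exact hAB
  · have := gamma_density_eq (P := P) hC ht (A / (2 * C)) (B / (2 * C))
      (-(Complex.I * ((1 / (P.hbar * C) : ℝ) : ℂ) * (γ - ζ)))
    simp only [← sub_eq_add_neg] at this
    rw [hL γ t ht, this, ha, ha]
    congr 2
    push_cast
    field_simp
  · have := gamma_density_eq (P := P) hC ht (1 - B / (2 * C)) (1 - A / (2 * C))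
      (Complex.I * ((1 / (P.hbar * C) : ℝ) : ℂ) * (γ - ζ))
    rw [hb, hb] at this
    push_cast at this ⊢
    rw [this, hR γ t ht]
    congr 1
    · congr 1
      field_simp
      ring
    · push_cast
      ring_nf
  · rw [h₁, hsin]; ring
  · rw [h₂, hsin]; ring

end

/-! ### Contraction densities of the currents with the vertex operators -/

section

variable {P : Params} {t : ℝ}

/-- The exponents of the two terms of the current `E`. -/
noncomputable def eExp (P : Params) (b : Bool) (α : ℂ) : Exponent :=
  paraExp P (-1) b α - phi P 0 1 1 P.k α 0

/-- The exponents of the two terms of the current `F`. -/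
noncomputable def fExp (P : Params) (b : Bool) (α : ℂ) : Exponent :=
  paraExp P 1 b α + phi' P 1 1 P.k α 0

/-- The exponent of the vertex operators of type I: `φ_{n,τn}(ζ) :exp(-φ'_0(l;2,k|ζ)):`. -/
noncomputable def typeIExp (P : Params) (n : ℕ) (τ : ℝ) (l : ℕ) (ζ : ℂ) : Exponent :=
  primaryExp P n τ ζ - phi' P l 2 P.k ζ 0

/-- The exponent of the vertex operators of type II: `φ_{n,τn}(ζ) :exp(φ_0(l;2,k|ζ)):`. -/
noncomputable def typeIIExp (P : Params) (n : ℕ) (τ : ℝ) (l : ℕ) (ζ : ℂ) : Exponent :=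
  primaryExp P n τ ζ + phi P 0 l 2 P.k ζ 0

/-- The exponent of the currents `h^±`. -/
noncomputable def hExp (P : Params) (σ : ℤˣ) (α : ℂ) : Exponent :=
  kExp P (α + Complex.I * P.hbar / 2 * (sgn σ * (P.xi + P.k / 2 : ℝ) + 1)) +
    kExp P (α + Complex.I * P.hbar / 2 * (sgn σ * (P.xi + P.k / 2 : ℝ) - 1))

/-- `X Y` and `Y X` have contraction densities `e^{i(γ-ζ)t} x/t` and `e^{i(ζ-γ)t} y/t`. -/
def HasDensities (P : Params) (X Y : Exponent) (γ ζ : ℂ) (t x y : ℝ) : Prop :=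
  contractionDensity P X Y t = Complex.exp (Complex.I * (γ - ζ) * t) * ((x / t : ℝ) : ℂ) ∧
    contractionDensity P Y X t = Complex.exp (Complex.I * (ζ - γ) * t) * ((y / t : ℝ) : ℂ)

namespace HasDensities

variable {A a C c : Exponent} {γ ζ : ℂ} {x y x' y' : ℝ}

theorem neg_left (h : HasDensities P a c γ ζ t x y) : HasDensities P (-a) c γ ζ t (-x) (-y) := by
  refine ⟨?_, ?_⟩
  · rw [contractionDensity_neg_left, h.1]; push_cast; ring
  · rw [contractionDensity_neg_right, h.2]; push_cast; ring

theorem neg_right (h : HasDensities P a c γ ζ t x y) : HasDensities P a (-c) γ ζ t (-x) (-y) := by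
  refine ⟨?_, ?_⟩
  · rw [contractionDensity_neg_right, h.1]; push_cast; ring
  · rw [contractionDensity_neg_left, h.2]; push_cast; ring

theorem add_add (h : HasDensities P A C γ ζ t x y) (h' : HasDensities P a c γ ζ t x' y')
    (hA : ∀ t, A 0 t = 0) (hC : ∀ t, C 0 t = 0)
    (ha : ∀ t, ∀ j ≠ 0, a j t = 0) (hc : ∀ t, ∀ j ≠ 0, c j t = 0) :
    HasDensities P (A + a) (C + c) γ ζ t (x + x') (y + y') := by
  refine ⟨?_, ?_⟩
  · rw [contractionDensity_add_add (hA _) (hC _) (ha _) (hc _), h.1, h'.1]; push_cast; ring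
  · rw [contractionDensity_add_add (hC _) (hA _) (hc _) (ha _), h.2, h'.2]; push_cast; ring

theorem add_left (h : HasDensities P a c γ ζ t x y) (h' : HasDensities P A c γ ζ t x' y') :
    HasDensities P (a + A) c γ ζ t (x + x') (y + y') := by
  have h1 : contractionDensity P (a + A) c t =
      contractionDensity P a c t + contractionDensity P A c t := by
    simp only [contractionDensity, Fin.sum_univ_three, Pi.add_apply]; ring
  have h2 : contractionDensity P c (a + A) t =
      contractionDensity P c a t + contractionDensity P c A t := by
    simp only [contractionDensity, Fin.sum_univ_three, Pi.add_apply]; ring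
  refine ⟨?_, ?_⟩
  · rw [h1, h.1, h'.1]; push_cast; ring
  · rw [h2, h.2, h'.2]; push_cast; ring

/-- A translation by `iħB/2` multiplies the two plane waves by reciprocal real exponentials. -/
theorem shift (B : ℝ) (h : HasDensities P a c (γ + Complex.I * P.hbar / 2 * B) ζ t x y) :
    HasDensities P a c γ ζ t (P.ex (-B) t * x) (P.ex B t * y) := by
  refine ⟨?_, ?_⟩
  · rw [h.1, mul_div_assoc (P.ex (-B) t), Complex.ofReal_mul, ← mul_assoc, Params.ex, Complex.ofReal_exp,
      ← Complex.exp_add]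
    congr 2
    push_cast
    linear_combination (P.hbar * B * t / 2 : ℂ) * Complex.I_sq
  · rw [h.2, mul_div_assoc (P.ex B t), Complex.ofReal_mul, ← mul_assoc, Params.ex, Complex.ofReal_exp,
      ← Complex.exp_add]
    congr 2
    push_cast
    linear_combination (-P.hbar * B * t / 2 : ℂ) * Complex.I_sq

theorem congr (h : HasDensities P a c γ ζ t x y) (hx : x = x') (hy : y = y') :
    HasDensities P a c γ ζ t x' y' := hx ▸ hy ▸ h

end HasDensities

theorem hasDensities_para_same (ht : 0 < t) {τ : ℝ} (hτ : τ = 1 ∨ τ = -1) (b : Bool) (n : ℕ)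
    (γ ζ : ℂ) : HasDensities P (paraExp P τ b γ) (primaryExp P n τ ζ) γ ζ t
      (-(P.s n t / P.s P.k t * P.ex ((bif b then -τ else τ) * P.k) t))
      (-(P.s n t / P.s P.k t * P.ex ((bif b then τ else -τ) * P.k) t)) := by
  have := para_primary_same P ht hτ b n γ ζ
  refine ⟨?_, ?_⟩
  · rw [this.1, Params.ex]; congr 6; ring
  · rw [this.2, Params.ex]; congr 6; ring

theorem hasDensities_para_opposite (ht : 0 < t) {τ : ℝ} (hτ : τ = 1 ∨ τ = -1) (b : Bool) (n : ℕ)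
    (γ ζ : ℂ) : HasDensities P (paraExp P τ b γ) (primaryExp P n (-τ) ζ) γ ζ t
      (P.s n t / P.s P.k t) (P.s n t / P.s P.k t) :=
  para_primary_opposite P ht hτ b n γ ζ

theorem hasDensities_phi_phi (ht : 0 < t) (A B C A' B' C' : ℝ) (γ ζ : ℂ) :
    HasDensities P (phi P 0 A B C γ 0) (phi P 0 A' B' C' ζ 0) γ ζ t
      (-(P.s A t / (P.s B t * P.s C t) * (P.s A' t / (P.s B' t * P.s C' t)) *
        (P.s 2 t * P.s P.k t * P.s (P.xi + P.k) t / P.s P.xi t)))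
      (-(P.s A t / (P.s B t * P.s C t) * (P.s A' t / (P.s B' t * P.s C' t)) *
        (P.s 2 t * P.s P.k t * P.s (P.xi + P.k) t / P.s P.xi t))) := by
  refine ⟨phi_zero_phi_zero P ht _ _ _ _ _ _ _ _, ?_⟩
  rw [phi_zero_phi_zero P ht]
  congr 3
  ring

theorem HasDensities.phi'_left {A B C : ℝ} {Y : Exponent} {γ ζ α : ℂ} {x y : ℝ}
    (h : HasDensities P (phi P 0 A B C α 0) Y γ ζ t x y) :
    HasDensities P (phi' P A B C α 0) Y γ ζ t (P.s P.xi t / P.s (P.xi + P.k) t * x)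
      (P.s P.xi t / P.s (P.xi + P.k) t * y) := by
  refine ⟨?_, ?_⟩
  · rw [phi'_eq_smul_left, h.1]; push_cast; ring
  · rw [phi'_eq_smul_right, h.2]; push_cast; ring

theorem HasDensities.phi'_right {A B C : ℝ} {Y : Exponent} {γ ζ α : ℂ} {x y : ℝ}
    (h : HasDensities P Y (phi P 0 A B C α 0) γ ζ t x y) :
    HasDensities P Y (phi' P A B C α 0) γ ζ t (P.s P.xi t / P.s (P.xi + P.k) t * x)
      (P.s P.xi t / P.s (P.xi + P.k) t * y) := by
  refine ⟨?_, ?_⟩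
  · rw [phi'_eq_smul_right, h.1]; push_cast; ring
  · rw [phi'_eq_smul_left, h.2]; push_cast; ring

theorem phi_zero_apply_of_ne (A B C : ℝ) (α : ℂ) (D t : ℝ) (j : Fin 3) (hj : j ≠ 0) :
    phi P 0 A B C α D j t = 0 := phi_apply_of_ne P hj A B C α D t

theorem neg_apply_of_ne {a : Exponent} (h : ∀ t, ∀ j ≠ 0, a j t = 0) (t : ℝ) (j : Fin 3)
    (hj : j ≠ 0) : (-a) j t = 0 := by
  rw [Pi.neg_apply, Pi.neg_apply, h t j hj, neg_zero]

/-! The densities of the products of the currents `E`, `F` with the vertex operators. -/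

section

variable (P) (b : Bool) (n l : ℕ) (γ ζ : ℂ) {x y : ℝ}

/-- Only one of the two zero modes fields is primed, so the ratio `s_{ξ+k}/s_ξ` in `c_0` cancels and
the `a_0` contribution no longer involves `ξ`. -/
theorem hasDensities_E_typeI (ht : 0 < t) {τ' : ℝ}
    (h : HasDensities P (paraExp P (-1) b γ) (primaryExp P n τ' ζ) γ ζ t x y) :
    HasDensities P (eExp P b γ) (typeIExp P n τ' l ζ) γ ζ t
      (x - P.s l t / P.s P.k t) (y - P.s l t / P.s P.k t) := by
  have h1 := (P.s_pos one_pos ht).ne'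
  have h2 := (P.s_pos two_pos ht).ne'
  have hk := (P.s_pos P.k_pos ht).ne'
  have hξ := (P.s_pos P.xi_pos ht).ne'
  have hp := (P.s_pos P.xi_add_k_pos ht).ne'
  rw [eExp, typeIExp, sub_eq_add_neg, sub_eq_add_neg]
  refine (h.add_add (hasDensities_phi_phi ht 1 1 P.k l 2 P.k γ ζ).phi'_right.neg_left.neg_right
    (paraExp_apply_zero P _ _ _) (primaryExp_apply_zero P _ _ _)
    (neg_apply_of_ne fun t => phi_zero_apply_of_ne _ _ _ _ _ t)
    (neg_apply_of_ne fun t j hj => phi'_apply_of_ne P hj _ _ _ _ _ t)).congr ?_ ?_ <;>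
  · field_simp
    ring

/-- Neither field is primed: the ratio `s_{ξ+k}/s_ξ` survives and will lead to `η`. -/
theorem hasDensities_E_typeII (ht : 0 < t) {τ' : ℝ}
    (h : HasDensities P (paraExp P (-1) b γ) (primaryExp P n τ' ζ) γ ζ t x y) :
    HasDensities P (eExp P b γ) (typeIIExp P n τ' l ζ) γ ζ t
      (x + P.s l t * P.s (P.xi + P.k) t / (P.s P.k t * P.s P.xi t))
      (y + P.s l t * P.s (P.xi + P.k) t / (P.s P.k t * P.s P.xi t)) := by
  have h1 := (P.s_pos one_pos ht).ne'
  have h2 := (P.s_pos two_pos ht).ne'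
  have hk := (P.s_pos P.k_pos ht).ne'
  have hξ := (P.s_pos P.xi_pos ht).ne'
  rw [eExp, typeIIExp, sub_eq_add_neg]
  refine (h.add_add (hasDensities_phi_phi ht 1 1 P.k l 2 P.k γ ζ).neg_left
    (paraExp_apply_zero P _ _ _) (primaryExp_apply_zero P _ _ _)
    (neg_apply_of_ne fun t => phi_zero_apply_of_ne _ _ _ _ _ t)
    (fun t => phi_zero_apply_of_ne _ _ _ _ _ t)).congr ?_ ?_ <;>
  · field_simp

/-- Both fields are primed: the ratio is inverted to `s_ξ/s_{ξ+k}` and will lead to `η'`. -/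
theorem hasDensities_F_typeI (ht : 0 < t) {τ' : ℝ}
    (h : HasDensities P (paraExp P 1 b γ) (primaryExp P n τ' ζ) γ ζ t x y) :
    HasDensities P (fExp P b γ) (typeIExp P n τ' l ζ) γ ζ t
      (x + P.s l t * P.s P.xi t / (P.s P.k t * P.s (P.xi + P.k) t))
      (y + P.s l t * P.s P.xi t / (P.s P.k t * P.s (P.xi + P.k) t)) := by
  have h1 := (P.s_pos one_pos ht).ne'
  have h2 := (P.s_pos two_pos ht).ne'
  have hk := (P.s_pos P.k_pos ht).ne'
  have hξ := (P.s_pos P.xi_pos ht).ne'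
  have hp := (P.s_pos P.xi_add_k_pos ht).ne'
  rw [fExp, typeIExp, sub_eq_add_neg]
  refine (h.add_add (hasDensities_phi_phi ht 1 1 P.k l 2 P.k γ ζ).phi'_left.phi'_right.neg_right
    (paraExp_apply_zero P _ _ _) (primaryExp_apply_zero P _ _ _)
    (fun t j hj => phi'_apply_of_ne P hj _ _ _ _ _ t)
    (neg_apply_of_ne fun t j hj => phi'_apply_of_ne P hj _ _ _ _ _ t)).congr ?_ ?_ <;>
  · field_simp

theorem hasDensities_F_typeII (ht : 0 < t) {τ' : ℝ}
    (h : HasDensities P (paraExp P 1 b γ) (primaryExp P n τ' ζ) γ ζ t x y) :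
    HasDensities P (fExp P b γ) (typeIIExp P n τ' l ζ) γ ζ t
      (x - P.s l t / P.s P.k t) (y - P.s l t / P.s P.k t) := by
  have h1 := (P.s_pos one_pos ht).ne'
  have h2 := (P.s_pos two_pos ht).ne'
  have hk := (P.s_pos P.k_pos ht).ne'
  have hξ := (P.s_pos P.xi_pos ht).ne'
  have hp := (P.s_pos P.xi_add_k_pos ht).ne'
  rw [fExp, typeIIExp]
  refine (h.add_add (hasDensities_phi_phi ht 1 1 P.k l 2 P.k γ ζ).phi'_left
    (paraExp_apply_zero P _ _ _) (primaryExp_apply_zero P _ _ _)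
    (fun t j hj => phi'_apply_of_ne P hj _ _ _ _ _ t)
    (fun t => phi_zero_apply_of_ne _ _ _ _ _ t)).congr ?_ ?_ <;>
  · field_simp
    ring

/-- The two factors `K` differ by shifts of `±1` in units of `iħ/2`; their sum produces `e^{ħt/2} +
e^{-ħt/2} = s_2/s_1`, which clears the denominator `s_2` of `K`. -/
theorem hasDensities_h_phi (ht : 0 < t) (σ : ℤˣ) :
    HasDensities P (hExp P σ γ) (phi P 0 l 2 P.k ζ 0) γ ζ t
      (P.s l t / P.s P.xi t * P.ex (-((σ : ℤ) * (P.xi + P.k / 2))) t)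
      (P.s l t / P.s P.xi t * P.ex ((σ : ℤ) * (P.xi + P.k / 2)) t) := by
  have h1 := (P.s_pos one_pos ht).ne'
  have h2 := (P.s_pos two_pos ht).ne'
  have hk := (P.s_pos P.k_pos ht).ne'
  have hξ := (P.s_pos P.xi_pos ht).ne'
  have hp := (P.s_pos P.xi_add_k_pos ht).ne'
  have hs2 : P.s 2 t = P.s 1 t * (P.ex 1 t + (P.ex 1 t)⁻¹) := by
    rw [P.s_eq_ex, P.s_eq_ex, show (2 : ℝ) = 1 + 1 by norm_num, P.ex_add, mul_inv]; ring
  have hx := P.ex_pos 1 t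
  have hx2 : P.ex 1 t ^ 2 + 1 ≠ 0 := by positivity
  have key : ∀ B : ℝ, HasDensities P (kExp P (γ + Complex.I * P.hbar / 2 * B))
      (phi P 0 l 2 P.k ζ 0) γ ζ t (P.ex (-B) t * (P.s l t * P.s 1 t / (P.s P.xi t * P.s 2 t)))
      (P.ex B t * (P.s l t * P.s 1 t / (P.s P.xi t * P.s 2 t))) := fun B => by
    refine HasDensities.shift B (((hasDensities_phi_phi ht 1 2 (P.xi + P.k) l 2 P.k _ _).neg_left
      ).congr ?_ ?_) <;> field_simp
  have e1 : (sgn σ * (P.xi + P.k / 2 : ℝ) + 1 : ℂ) =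
      (((σ : ℤ) * (P.xi + P.k / 2) + 1 : ℝ) : ℂ) := by rw [sgn]; push_cast; rfl
  have e2 : (sgn σ * (P.xi + P.k / 2 : ℝ) - 1 : ℂ) =
      (((σ : ℤ) * (P.xi + P.k / 2) - 1 : ℝ) : ℂ) := by rw [sgn]; push_cast; rfl
  rw [hExp, e1, e2]
  refine ((key _).add_left (key _)).congr ?_ ?_
  all_goals
    rw [hs2]
    simp only [P.ex_add, P.ex_sub, P.ex_neg]
    have hy := P.ex_pos ((σ : ℤ) * (P.xi + P.k / 2)) t
    generalize P.ex ((σ : ℤ) * (P.xi + P.k / 2)) t = y at hy ⊢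
    field_simp
  ring

theorem hExp_apply_of_ne (σ : ℤˣ) (t : ℝ) (j : Fin 3) (hj : j ≠ 0) : hExp P σ γ j t = 0 := by
  simp [hExp, kExp, phi_apply_of_ne P hj]

/-- The Cartan currents contain only `a_0`, so parafermion primaries do not affect their
contractions. -/
theorem HasDensities.primary_add {σ : ℤˣ} {d : Exponent} {τ : ℝ}
    (h : HasDensities P (hExp P σ γ) d γ ζ t x y) (hd : ∀ t, ∀ j ≠ 0, d j t = 0) :
    HasDensities P (hExp P σ γ) (primaryExp P n τ ζ + d) γ ζ t x y := by
  have h0 : HasDensities P (0 : Exponent) (primaryExp P n τ ζ) γ ζ t 0 0 := by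
    constructor <;> simp [contractionDensity]
  have := h0.add_add h (fun t => rfl) (primaryExp_apply_zero P _ _ _)
    (hExp_apply_of_ne P γ σ) hd
  rwa [zero_add, zero_add, zero_add] at this

theorem hasDensities_h_typeI (ht : 0 < t) (σ : ℤˣ) (τ : ℝ) :
    HasDensities P (hExp P σ γ) (typeIExp P n τ l ζ) γ ζ t
      (-(P.s l t / P.s (P.xi + P.k) t * P.ex (-((σ : ℤ) * (P.xi + P.k / 2))) t))
      (-(P.s l t / P.s (P.xi + P.k) t * P.ex ((σ : ℤ) * (P.xi + P.k / 2)) t)) := by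
  have hξ := (P.s_pos P.xi_pos ht).ne'
  rw [typeIExp, sub_eq_add_neg]
  refine HasDensities.primary_add P n γ ζ
    ((hasDensities_h_phi P l γ ζ ht σ).phi'_right.neg_right.congr ?_ ?_)
    (neg_apply_of_ne fun t j hj => phi'_apply_of_ne P hj _ _ _ _ _ t) <;>
  · field_simp

theorem hasDensities_h_typeII (ht : 0 < t) (σ : ℤˣ) (τ : ℝ) :
    HasDensities P (hExp P σ γ) (typeIIExp P n τ l ζ) γ ζ t
      (P.s l t / P.s P.xi t * P.ex (-((σ : ℤ) * (P.xi + P.k / 2))) t)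
      (P.s l t / P.s P.xi t * P.ex ((σ : ℤ) * (P.xi + P.k / 2)) t) :=
  HasDensities.primary_add P n γ ζ (hasDensities_h_phi P l γ ζ ht σ)
    fun t => phi_zero_apply_of_ne _ _ _ _ _ t

end

end

section

variable {P : Params} {X Y : ℂ → Exponent} {ζ ν : ℂ} {s₁ s₂ : ℂ → ℂ}

theorem Exchange.of_hasDensities_zero
    (h : ∀ γ t, 0 < t → HasDensities P (X γ) (Y ζ) γ ζ t 0 0) :
    Exchange P X Y ζ 1 (fun _ => 1) (fun _ => 1) :=
  .of_density_eq_zero (fun γ t ht => by rw [densityL, (h γ t ht).1]; simp)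
    fun γ t ht => by rw [densityR, (h γ t ht).2]; simp

theorem Exchange.of_hasDensities_ex (N : ℝ)
    (h : ∀ γ t, 0 < t → HasDensities P (X γ) (Y ζ) γ ζ t (-P.ex N t) (-P.ex (-N) t)) :
    Exchange P X Y ζ (-1) (fun _ => 1) (fun _ => 1) :=
  .of_density_ex N (fun γ t ht => (h γ t ht).1) fun γ t ht => (h γ t ht).2

theorem Exchange.of_hasDensities_sinh {C : ℝ} (hC : 0 < C) (A B : ℝ) (hAB : A - B < 2 * C) (κ : ℂ)
    (h : ∀ γ t, 0 < t → HasDensities P (X γ) (Y ζ) γ ζ t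
      ((P.ex (C - A) t - P.ex (C - B) t) / (2 * P.s C t))
      ((P.ex (B - C) t - P.ex (A - C) t) / (2 * P.s C t)))
    (h₁ : ∀ γ, s₁ γ = κ * Complex.sinh ((Real.pi * (1 / (P.hbar * C)) : ℝ) *
      (γ - ζ + Complex.I * P.hbar / 2 * A)))
    (h₂ : ∀ γ, ν * s₂ γ = κ * Complex.sinh ((Real.pi * (1 / (P.hbar * C)) : ℝ) *
      (γ - ζ + Complex.I * P.hbar / 2 * B))) : Exchange P X Y ζ ν s₁ s₂ :=
  .of_density_sinh hC A B hAB κ (fun γ t ht => (h γ t ht).1) (fun γ t ht => (h γ t ht).2) h₁ h₂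

/-- `sh` changes sign under a shift by the half period. -/
theorem sinh_half_period {C : ℝ} (hC : 0 < C) {x y : ℂ}
    (h : x = y + Complex.I * P.hbar * C) :
    Complex.sinh ((Real.pi * (1 / (P.hbar * C)) : ℝ) * x) =
      -Complex.sinh ((Real.pi * (1 / (P.hbar * C)) : ℝ) * y) := by
  have hh : (P.hbar : ℂ) ≠ 0 := by exact_mod_cast P.hbar_pos.ne'
  have hC' : (C : ℂ) ≠ 0 := by exact_mod_cast hC.ne'
  rw [h, show ((Real.pi * (1 / (P.hbar * C)) : ℝ) : ℂ) * (y + Complex.I * P.hbar * C) =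
    (Real.pi * (1 / (P.hbar * C)) : ℝ) * y + Real.pi * Complex.I by push_cast; field_simp,
    Complex.sinh_add, Complex.cosh_mul_I, Complex.sinh_mul_I]
  simp

end

/-! The identities between hyperbolic functions behind the exchange relations. -/

section

variable (P : Params) {t : ℝ} (l : ℝ)

/-- For the twisted operators, with `n = k - l`, this collapses the parafermion and `a_0`
contributions to a single exponential, the anticommuting case. -/
theorem s_add_s_mul_ex (ht : 0 < t) :
    P.s (P.k - l) t / P.s P.k t * P.ex P.k t + P.s l t / P.s P.k t = P.ex (P.k - l) t := by
  have hk := (P.s_pos P.k_pos ht).ne'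
  have h1 := P.ex_pos P.k t
  have h2 := P.ex_pos l t
  field_simp
  simp only [P.s_eq_ex, P.ex_sub]
  field_simp
  ring

theorem s_add_s_mul_ex_neg (ht : 0 < t) :
    P.s (P.k - l) t / P.s P.k t * P.ex (-P.k) t + P.s l t / P.s P.k t = P.ex (-(P.k - l)) t := by
  have hk := (P.s_pos P.k_pos ht).ne'
  have h1 := P.ex_pos P.k t
  have h2 := P.ex_pos l t
  field_simp
  simp only [P.s_eq_ex, P.ex_neg, P.ex_sub]
  field_simp
  ring

/-- Adding the `a_0` part cancels the parafermion denominator `s_k`. Only `s_{ξ+k}` is left, so the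
contraction is a single quotient of Gamma functions. -/
theorem s_xi_sub (ht : 0 < t) (ε : ℝ) (hε : ε = 1 ∨ ε = -1) :
    -(P.s l t / P.s P.k t * P.ex (ε * P.k) t) +
      P.s l t * P.s P.xi t / (P.s P.k t * P.s (P.xi + P.k) t) =
      (P.ex (ε * (P.xi + P.k) - l) t - P.ex (ε * (P.xi + P.k) + l) t) /
        (2 * P.s (P.xi + P.k) t) := by
  have hk := (P.s_pos P.k_pos ht).ne'
  have hp := (P.s_pos P.xi_add_k_pos ht).ne'
  have h1 := P.ex_pos P.k t
  have h2 := P.ex_pos l t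
  have h3 := P.ex_pos P.xi t
  rcases hε with rfl | rfl <;>
  · simp only [one_mul, neg_one_mul]
    field_simp
    simp only [P.s_eq_ex, P.ex_neg, P.ex_sub, P.ex_add]
    field_simp
    ring

theorem s_xi_add_k_sub (ht : 0 < t) (ε : ℝ) (hε : ε = 1 ∨ ε = -1) :
    -(P.s l t / P.s P.k t * P.ex (-ε * P.k) t) +
      P.s l t * P.s (P.xi + P.k) t / (P.s P.k t * P.s P.xi t) =
      (P.ex (ε * P.xi + l) t - P.ex (ε * P.xi - l) t) / (2 * P.s P.xi t) := by
  have hk := (P.s_pos P.k_pos ht).ne'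
  have hp := (P.s_pos P.xi_pos ht).ne'
  have h1 := P.ex_pos P.k t
  have h2 := P.ex_pos l t
  have h3 := P.ex_pos P.xi t
  rcases hε with rfl | rfl <;>
  · simp only [one_mul, neg_one_mul, neg_neg]
    field_simp
    simp only [P.s_eq_ex, P.ex_neg, P.ex_sub, P.ex_add]
    field_simp
    ring

/-- The twisted counterpart: both sides equal `s_{ξ+k-l}/s_{ξ+k}`, in the form of a Gamma density.
-/
theorem s_k_sub_add (ht : 0 < t) :
    P.s (P.k - l) t / P.s P.k t + P.s l t * P.s P.xi t / (P.s P.k t * P.s (P.xi + P.k) t) =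
      (P.ex (P.xi + P.k - l) t - P.ex (-(P.xi + P.k - l)) t) / (2 * P.s (P.xi + P.k) t) := by
  have hk := (P.s_pos P.k_pos ht).ne'
  have hp := (P.s_pos P.xi_add_k_pos ht).ne'
  have h1 := P.ex_pos P.k t
  have h2 := P.ex_pos l t
  have h3 := P.ex_pos P.xi t
  field_simp
  simp only [P.s_eq_ex, P.ex_neg, P.ex_sub, P.ex_add]
  field_simp
  ring

theorem s_k_sub_add' (ht : 0 < t) :
    P.s (P.k - l) t / P.s P.k t + P.s l t * P.s (P.xi + P.k) t / (P.s P.k t * P.s P.xi t) =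
      (P.ex (P.xi + l) t - P.ex (-(P.xi + l)) t) / (2 * P.s P.xi t) := by
  have hk := (P.s_pos P.k_pos ht).ne'
  have hp := (P.s_pos P.xi_pos ht).ne'
  have h1 := P.ex_pos P.k t
  have h2 := P.ex_pos l t
  have h3 := P.ex_pos P.xi t
  field_simp
  simp only [P.s_eq_ex, P.ex_neg, P.ex_sub, P.ex_add]
  field_simp
  ring

theorem s_div_mul_ex {C : ℝ} (hC : 0 < C) (ht : 0 < t) (θ : ℝ) :
    P.s l t / P.s C t * P.ex θ t = (P.ex (l + θ) t - P.ex (θ - l) t) / (2 * P.s C t) := by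
  have hp := (P.s_pos hC ht).ne'
  have h2 := P.ex_pos l t
  field_simp
  rw [P.s_eq_ex, P.ex_sub, P.ex_add]
  field_simp

end

/-! ### Exchange relation of each current with each vertex operator -/

section

variable (P : Params) (b : Bool) {l : ℕ} (ζ : ℂ) (σ : ℤˣ)

/-- The parafermion contribution `s_l/s_k` is cancelled exactly by that of `a_0`. -/
theorem exchange_E_typeI : Exchange P (eExp P b) (typeIExp P l 1 l) ζ 1
    (fun _ => 1) (fun _ => 1) := by
  refine .of_hasDensities_zero fun γ t ht => ?_
  have h := hasDensities_para_opposite (P := P) ht (τ := -1) (Or.inr rfl) b l γ ζ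
  rw [neg_neg] at h
  exact (hasDensities_E_typeI P b l l γ ζ ht h).congr (sub_self _) (sub_self _)

theorem exchange_F_typeII : Exchange P (fExp P b) (typeIIExp P l (-1) l) ζ 1
    (fun _ => 1) (fun _ => 1) :=
  .of_hasDensities_zero fun γ _ ht => (hasDensities_F_typeII P b l l γ ζ ht
    (hasDensities_para_opposite ht (Or.inl rfl) b l γ ζ)).congr (sub_self _) (sub_self _)

theorem natCast_level_sub (hl : l ≤ P.level) : ((P.level - l : ℕ) : ℝ) = P.k - l := by
  rw [Nat.cast_sub hl, Params.k]

theorem exchange_E_typeI_twisted (hl : l ≤ P.level) :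
    Exchange P (eExp P b) (typeIExp P (P.level - l) (-1) l) ζ (-1) (fun _ => 1) (fun _ => 1) := by
  refine .of_hasDensities_ex (bif b then P.k - l else -(P.k - l)) fun γ t ht =>
    (hasDensities_E_typeI P b (P.level - l) l γ ζ ht
      (hasDensities_para_same ht (Or.inr rfl) b _ γ ζ)).congr ?_ ?_ <;>
  rw [natCast_level_sub P hl] <;> cases b <;>
  simp only [cond_true, cond_false, neg_neg, one_mul, neg_one_mul, ← s_add_s_mul_ex_neg P _ ht,
    ← s_add_s_mul_ex P _ ht] <;> ring

theorem exchange_F_typeII_twisted (hl : l ≤ P.level) :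
    Exchange P (fExp P b) (typeIIExp P (P.level - l) 1 l) ζ (-1) (fun _ => 1) (fun _ => 1) := by
  refine .of_hasDensities_ex (bif b then -(P.k - l) else P.k - l) fun γ t ht =>
    (hasDensities_F_typeII P b (P.level - l) l γ ζ ht
      (hasDensities_para_same ht (Or.inl rfl) b _ γ ζ)).congr ?_ ?_ <;>
  rw [natCast_level_sub P hl] <;> cases b <;>
  simp only [cond_true, cond_false, neg_neg, one_mul, neg_one_mul, ← s_add_s_mul_ex_neg P _ ht,
    ← s_add_s_mul_ex P _ ht] <;> ring

theorem natCast_lt_xi_add_k (hl : l ≤ P.level) : (l : ℝ) < P.xi + P.k := by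
  have : (l : ℝ) ≤ P.k := by rw [Params.k]; exact_mod_cast hl
  linarith [P.xi_pos]

/-- The second term of the current corresponds to `A = l`, `B = -l`. The first has both shifted by
`2(ξ+k)`, a half period in each `sh`, so the two signs cancel in the ratio and the terms share one
exchange factor. -/
theorem exchange_F_typeI (hl : l ≤ P.level) :
    Exchange P (fExp P b) (typeIExp P l 1 l) ζ 1
      (fun γ => P.shEta' (γ - ζ + Complex.I * P.hbar / 2 * l))
      (fun γ => P.shEta' (γ - ζ - Complex.I * P.hbar / 2 * l)) := by
  have hlp := natCast_lt_xi_add_k P hl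
  have hd := fun γ t ht => hasDensities_F_typeI P b l l γ ζ (t := t) ht
      (hasDensities_para_same ht (Or.inl rfl) b _ γ ζ)
  cases b
  · refine .of_hasDensities_sinh P.xi_add_k_pos l (-l) (by linarith) 1
      (fun γ t ht => (hd γ t ht).congr ?_ ?_) (fun γ => ?_) fun γ => ?_
    · rw [cond_false, s_xi_sub P l ht 1 (Or.inl rfl)]; ring_nf
    · rw [cond_false, s_xi_sub P l ht (-1) (Or.inr rfl)]; ring_nf
    · rw [one_mul]; rfl
    · rw [one_mul, one_mul, Params.shEta', Params.eta']; congr 2; push_cast; ring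
  · refine .of_hasDensities_sinh P.xi_add_k_pos (2 * (P.xi + P.k) + l) (2 * (P.xi + P.k) - l)
      (by linarith) (-1) (fun γ t ht => (hd γ t ht).congr ?_ ?_) (fun γ => ?_) fun γ => ?_
    · rw [cond_true, s_xi_sub P l ht (-1) (Or.inr rfl)]; ring_nf
    · rw [cond_true, s_xi_sub P l ht 1 (Or.inl rfl)]; ring_nf
    · rw [sinh_half_period P.xi_add_k_pos (y := γ - ζ + Complex.I * P.hbar / 2 * l)
        (by push_cast; ring), neg_one_mul, neg_neg]; rfl
    · rw [sinh_half_period P.xi_add_k_pos (y := γ - ζ - Complex.I * P.hbar / 2 * l)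
        (by push_cast; ring), neg_one_mul, neg_neg, one_mul]; rfl

/-- Here only `B` is displaced by a half period from `-l`; the single sign is the twist `ν = -1`. -/
theorem exchange_F_typeI_twisted (hl : l ≤ P.level) :
    Exchange P (fExp P b) (typeIExp P (P.level - l) (-1) l) ζ (-1)
      (fun γ => P.shEta' (γ - ζ + Complex.I * P.hbar / 2 * l))
      (fun γ => P.shEta' (γ - ζ - Complex.I * P.hbar / 2 * l)) := by
  have hlp := natCast_lt_xi_add_k P hl
  have hd := fun γ t ht => hasDensities_F_typeI P b (P.level - l) l γ ζ (t := t) ht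
      (hasDensities_para_opposite ht (Or.inl rfl) b _ γ ζ)
  refine .of_hasDensities_sinh P.xi_add_k_pos l (2 * (P.xi + P.k) - l) (by linarith) 1
    (fun γ t ht => (hd γ t ht).congr ?_ ?_) (fun γ => ?_) fun γ => ?_
  · rw [natCast_level_sub P hl, s_k_sub_add P l ht]; ring_nf
  · rw [natCast_level_sub P hl, s_k_sub_add P l ht]; ring_nf
  · rw [one_mul]; rfl
  · rw [sinh_half_period P.xi_add_k_pos (y := γ - ζ - Complex.I * P.hbar / 2 * l)
      (by push_cast; ring), one_mul, neg_one_mul]; rfl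

/-- As for `F` in type I, with `ξ` in place of `ξ + k` and `l` in place of `-l`. Now `A - B = -2l`,
so the growth condition holds whatever the size of `l`. -/
theorem exchange_E_typeII :
    Exchange P (eExp P b) (typeIIExp P l (-1) l) ζ 1
      (fun γ => P.shEta (γ - ζ - Complex.I * P.hbar / 2 * l))
      (fun γ => P.shEta (γ - ζ + Complex.I * P.hbar / 2 * l)) := by
  have hξ := P.xi_pos
  have hl0 : (0 : ℝ) ≤ l := Nat.cast_nonneg l
  have hd := fun γ t ht => hasDensities_E_typeII P b l l γ ζ (t := t) ht
      (hasDensities_para_same ht (Or.inr rfl) b _ γ ζ)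
  cases b
  · refine .of_hasDensities_sinh P.xi_pos (-l) l (by linarith) 1
      (fun γ t ht => (hd γ t ht).congr ?_ ?_) (fun γ => ?_) fun γ => ?_
    · rw [cond_false, s_xi_add_k_sub P l ht 1 (Or.inl rfl)]; ring_nf
    · rw [cond_false, s_xi_add_k_sub P l ht (-1) (Or.inr rfl)]; ring_nf
    · rw [one_mul, Params.shEta, Params.eta]; congr 2; push_cast; ring
    · rw [one_mul, one_mul]; rfl
  · refine .of_hasDensities_sinh P.xi_pos (2 * P.xi - l) (2 * P.xi + l)
      (by linarith) (-1) (fun γ t ht => (hd γ t ht).congr ?_ ?_) (fun γ => ?_) fun γ => ?_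
    · rw [cond_true, s_xi_add_k_sub P l ht (-1) (Or.inr rfl)]; ring_nf
    · rw [cond_true, ← neg_neg (-1 : ℝ), neg_neg (1 : ℝ), s_xi_add_k_sub P l ht 1 (Or.inl rfl)]
      ring_nf
    · rw [sinh_half_period P.xi_pos (y := γ - ζ - Complex.I * P.hbar / 2 * l)
        (by push_cast; ring), neg_one_mul, neg_neg]; rfl
    · rw [sinh_half_period P.xi_pos (y := γ - ζ + Complex.I * P.hbar / 2 * l)
        (by push_cast; ring), neg_one_mul, neg_neg, one_mul]; rfl

theorem exchange_E_typeII_twisted (hl : l ≤ P.level) :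
    Exchange P (eExp P b) (typeIIExp P (P.level - l) 1 l) ζ (-1)
      (fun γ => P.shEta (γ - ζ - Complex.I * P.hbar / 2 * l))
      (fun γ => P.shEta (γ - ζ + Complex.I * P.hbar / 2 * l)) := by
  have hξ := P.xi_pos
  have hl0 : (0 : ℝ) ≤ l := Nat.cast_nonneg l
  have hd := fun γ (t : ℝ) (ht : 0 < t) => hasDensities_E_typeII P b (P.level - l) l γ ζ ht
    (τ' := 1) (by
      have h := hasDensities_para_opposite (P := P) ht (τ := -1) (Or.inr rfl) b (P.level - l) γ ζ
      rwa [neg_neg] at h)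
  refine .of_hasDensities_sinh P.xi_pos (-l) (2 * P.xi + l) (by linarith) 1
    (fun γ t ht => (hd γ t ht).congr ?_ ?_) (fun γ => ?_) fun γ => ?_
  · rw [natCast_level_sub P hl, s_k_sub_add' P l ht]; ring_nf
  · rw [natCast_level_sub P hl, s_k_sub_add' P l ht]; ring_nf
  · rw [one_mul, Params.shEta, Params.eta]; congr 2; push_cast; ring
  · rw [sinh_half_period P.xi_pos (y := γ - ζ + Complex.I * P.hbar / 2 * l)
      (by push_cast; ring), one_mul, neg_one_mul]; rfl

/-- For the sign `+` both parameters exceed the stated shifts by `2(ξ+k)`, a half period in each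
`sh`; for `-` there is no excess. The constant `-sgn σ` compensates. -/
theorem exchange_h_typeI (hl : l ≤ P.level) (n : ℕ) (τ : ℝ) :
    Exchange P (hExp P σ) (typeIExp P n τ l) ζ 1
      (fun γ => P.shEta' (γ - ζ + Complex.I * P.hbar / 2 * (l - sgn σ * (P.k / 2))))
      (fun γ => P.shEta' (γ - ζ - Complex.I * P.hbar / 2 * (l + sgn σ * (P.k / 2)))) := by
  have hlp := natCast_lt_xi_add_k P hl
  refine .of_hasDensities_sinh P.xi_add_k_pos
    (l + (P.xi + P.k) + (σ : ℤ) * (P.xi + P.k / 2))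
    (-l + (P.xi + P.k) + (σ : ℤ) * (P.xi + P.k / 2)) (by linarith) (-sgn σ)
    (fun γ t ht => (hasDensities_h_typeI P n l γ ζ ht σ τ).congr ?_ ?_)
    (fun γ => ?_) fun γ => ?_
  · rw [s_div_mul_ex P l P.xi_add_k_pos ht]; ring_nf
  · rw [s_div_mul_ex P l P.xi_add_k_pos ht]; ring_nf
  · rcases Int.units_eq_one_or σ with rfl | rfl
    · rw [sinh_half_period P.xi_add_k_pos (y := γ - ζ + Complex.I * P.hbar / 2 *
        (l - sgn 1 * (P.k / 2))) (by simp only [sgn]; push_cast; ring)]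
      simp [sgn, Params.shEta', Params.eta']
    · simp only [sgn, Params.shEta', Params.eta', Units.val_neg, Units.val_one, Int.cast_neg,
        Int.cast_one, neg_neg, one_mul]
      congr 2
      push_cast
      ring
  · rcases Int.units_eq_one_or σ with rfl | rfl
    · rw [sinh_half_period P.xi_add_k_pos (y := γ - ζ - Complex.I * P.hbar / 2 *
        (l + sgn 1 * (P.k / 2))) (by simp only [sgn]; push_cast; ring)]
      simp [sgn, Params.shEta', Params.eta']
    · simp only [sgn, Params.shEta', Params.eta', Units.val_neg, Units.val_one, Int.cast_neg,
        Int.cast_one, neg_neg, one_mul]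
      congr 2
      push_cast
      ring

theorem exchange_h_typeII (n : ℕ) (τ : ℝ) :
    Exchange P (hExp P σ) (typeIIExp P n τ l) ζ 1
      (fun γ => P.shEta (γ - ζ - Complex.I * P.hbar / 2 * (l - sgn σ * (P.k / 2))))
      (fun γ => P.shEta (γ - ζ + Complex.I * P.hbar / 2 * (l + sgn σ * (P.k / 2)))) := by
  have hξ := P.xi_pos
  have hl0 : (0 : ℝ) ≤ l := Nat.cast_nonneg l
  refine .of_hasDensities_sinh P.xi_pos
    (-l + P.xi + (σ : ℤ) * (P.xi + P.k / 2))
    (l + P.xi + (σ : ℤ) * (P.xi + P.k / 2)) (by linarith) (-sgn σ)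
    (fun γ t ht => (hasDensities_h_typeII P n l γ ζ ht σ τ).congr ?_ ?_)
    (fun γ => ?_) fun γ => ?_
  · rw [s_div_mul_ex P l P.xi_pos ht]; ring_nf
  · rw [s_div_mul_ex P l P.xi_pos ht]; ring_nf
  · rcases Int.units_eq_one_or σ with rfl | rfl
    · rw [sinh_half_period P.xi_pos (y := γ - ζ - Complex.I * P.hbar / 2 *
        (l - sgn 1 * (P.k / 2))) (by simp only [sgn]; push_cast; ring)]
      simp [sgn, Params.shEta, Params.eta]
    · simp only [sgn, Params.shEta, Params.eta, Units.val_neg, Units.val_one, Int.cast_neg,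
        Int.cast_one, neg_neg, one_mul]
      congr 2
      push_cast
      ring
  · rcases Int.units_eq_one_or σ with rfl | rfl
    · rw [sinh_half_period P.xi_pos (y := γ - ζ + Complex.I * P.hbar / 2 *
        (l + sgn 1 * (P.k / 2))) (by simp only [sgn]; push_cast; ring)]
      simp [sgn, Params.shEta, Params.eta]
    · simp only [sgn, Params.shEta, Params.eta, Units.val_neg, Units.val_one, Int.cast_neg,
        Int.cast_one, neg_neg, one_mul]
      congr 2
      push_cast
      ring

end

/-! ### Matrix elements as functions of the spectral parameter -/

/-- The coefficient functions of `X γ` are plane waves `u(t) e^{iγt}`, with amplitudes that are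
continuous away from `t = 0`. -/
def IsPlaneWave (X : ℂ → Exponent) : Prop :=
  ∀ j, ∃ u v : ℝ → ℂ, ContinuousOn u (Ioi 0) ∧ ContinuousOn v (Ioi 0) ∧
    ∀ γ t, 0 < t → X γ j t = u t * Complex.exp (Complex.I * γ * t) ∧
      X γ j (-t) = v t * Complex.exp (-(Complex.I * γ * t))

namespace IsPlaneWave

variable {X Y : ℂ → Exponent}

theorem add (hX : IsPlaneWave X) (hY : IsPlaneWave Y) : IsPlaneWave fun γ => X γ + Y γ := by
  intro j
  obtain ⟨u, v, hu, hv, h⟩ := hX j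
  obtain ⟨u', v', hu', hv', h'⟩ := hY j
  refine ⟨fun t => u t + u' t, fun t => v t + v' t, hu.add hu', hv.add hv', fun γ t ht => ⟨?_, ?_⟩⟩
  · beta_reduce; rw [Pi.add_apply, Pi.add_apply, (h γ t ht).1, (h' γ t ht).1]; ring
  · beta_reduce; rw [Pi.add_apply, Pi.add_apply, (h γ t ht).2, (h' γ t ht).2]; ring

theorem smul (c : ℂ) (hX : IsPlaneWave X) : IsPlaneWave fun γ => c • X γ := by
  intro j
  obtain ⟨u, v, hu, hv, h⟩ := hX j
  refine ⟨fun t => c * u t, fun t => c * v t, continuousOn_const.mul hu, continuousOn_const.mul hv,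
    fun γ t ht => ⟨?_, ?_⟩⟩
  · beta_reduce; rw [Pi.smul_apply, Pi.smul_apply, smul_eq_mul, (h γ t ht).1]; ring
  · beta_reduce; rw [Pi.smul_apply, Pi.smul_apply, smul_eq_mul, (h γ t ht).2]; ring

theorem neg (hX : IsPlaneWave X) : IsPlaneWave fun γ => -X γ := by
  simpa using hX.smul (-1)

theorem sub (hX : IsPlaneWave X) (hY : IsPlaneWave Y) : IsPlaneWave fun γ => X γ - Y γ := by
  simpa only [sub_eq_add_neg] using hX.add hY.neg

variable (P : Params)

theorem continuousOn_s_div {A B : ℝ} (hB : 0 < B) :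
    ContinuousOn (fun t : ℝ => ((P.s A t / P.s B t : ℝ) : ℂ)) (Ioi 0) := by
  have h : ∀ A, Continuous (P.s A) := fun A => by unfold Params.s; fun_prop
  exact Complex.continuous_ofReal.comp_continuousOn ((h A).continuousOn.div (h B).continuousOn
    fun t ht => (P.s_pos hB ht).ne')

theorem phi (j : Fin 3) (A : ℝ) {B C : ℝ} (hB : 0 < B) (hC : 0 < C) (D : ℝ) :
    IsPlaneWave fun γ => phi P j A B C γ D := by
  intro i
  by_cases hij : i = j
  · subst hij
    have hs : ∀ A, Continuous (P.s A) := fun A => by unfold Params.s; fun_prop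
    have hc : ContinuousOn (fun t : ℝ => (P.hbar * (P.s A t / (P.s B t * P.s C t)) : ℂ) *
        Complex.exp ((P.hbar * D / 2 * t : ℝ) : ℂ)) (Ioi 0) := by
      refine ContinuousOn.mul (continuousOn_const.mul ?_) (by fun_prop)
      refine ContinuousOn.div (Complex.continuous_ofReal.comp (hs A)).continuousOn
        ((Complex.continuous_ofReal.comp (hs B)).mul
          (Complex.continuous_ofReal.comp (hs C))).continuousOn fun t ht => ?_
      exact mul_ne_zero (Complex.ofReal_ne_zero.2 (P.s_pos hB ht).ne')
        (Complex.ofReal_ne_zero.2 (P.s_pos hC ht).ne')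
    refine ⟨_, _, hc, hc.neg, fun γ t ht => ⟨?_, ?_⟩⟩
    · beta_reduce; rw [phi_apply_pos P ht]; ring
    · beta_reduce; rw [phi_apply_neg P ht, Complex.exp_neg]; simp only [Pi.neg_apply]; ring
  · exact ⟨0, 0, continuousOn_const, continuousOn_const, fun γ t _ => by
      simp [phi_apply_of_ne P hij]⟩

theorem phi' (A : ℝ) {B C : ℝ} (hB : 0 < B) (hC : 0 < C) (D : ℝ) :
    IsPlaneWave fun γ => phi' P A B C γ D := by
  intro j
  obtain ⟨u, v, hu, hv, h⟩ := IsPlaneWave.phi P 0 A hB hC D j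
  beta_reduce at h
  have hc := continuousOn_s_div P (A := P.xi) P.xi_add_k_pos
  refine ⟨_, _, hc.mul hu, hc.mul hv, fun γ t ht => ⟨?_, ?_⟩⟩
  · show ((P.s P.xi t / P.s (P.xi + P.k) t : ℝ) : ℂ) * AhEta.phi P 0 A B C γ D j t = _
    rw [(h γ t ht).1]; simp only [Pi.mul_apply]; ring
  · show ((P.s P.xi (-t) / P.s (P.xi + P.k) (-t) : ℝ) : ℂ) * AhEta.phi P 0 A B C γ D j (-t) = _
    rw [(h γ t ht).2, P.s_neg_right, P.s_neg_right, neg_div_neg_eq]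
    simp only [Pi.mul_apply]
    ring

theorem continuousOn_halfCoeff (A : ℝ) {B : ℝ} (hB : 0 < B) (D : ℝ) :
    ContinuousOn (fun t : ℝ => (2 * P.hbar * (P.s A t / P.s B t) : ℂ) *
      Complex.exp ((P.hbar * D / 2 * t : ℝ) : ℂ)) (Ioi 0) := by
  refine ContinuousOn.mul (continuousOn_const.mul ?_) (by fun_prop)
  simpa using continuousOn_s_div P (A := A) hB

theorem phiPlus (j : Fin 3) (A : ℝ) {B : ℝ} (hB : 0 < B) (D : ℝ) :
    IsPlaneWave fun γ => phiPlus P j A B γ D := by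
  intro i
  by_cases hij : i = j
  · subst hij
    refine ⟨_, 0, continuousOn_halfCoeff P A hB D, continuousOn_const, fun γ t ht => ⟨?_, ?_⟩⟩
    · beta_reduce; rw [phiPlus_apply_pos P ht]; ring
    · beta_reduce; rw [phiPlus_apply_neg P ht]; simp
  · exact ⟨0, 0, continuousOn_const, continuousOn_const, fun γ t _ => by
      simp [phiPlus_apply_of_ne P hij]⟩

theorem phiMinus (j : Fin 3) (A : ℝ) {B : ℝ} (hB : 0 < B) (D : ℝ) :
    IsPlaneWave fun γ => phiMinus P j A B γ D := by
  intro i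
  by_cases hij : i = j
  · subst hij
    refine ⟨0, _, continuousOn_const, continuousOn_halfCoeff P A hB D, fun γ t ht => ⟨?_, ?_⟩⟩
    · beta_reduce; rw [phiMinus_apply_pos P ht]; simp
    · beta_reduce; rw [phiMinus_apply_neg P ht, Complex.exp_neg]; ring
  · exact ⟨0, 0, continuousOn_const, continuousOn_const, fun γ t _ => by
      simp [phiMinus_apply_of_ne P hij]⟩

theorem para (τ : ℝ) (b : Bool) : IsPlaneWave (paraExp P τ b) := by
  have hf := (IsPlaneWave.phi P 2 1 one_pos P.k_pos (τ * P.k / 2)).smul (τ : ℂ)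
  cases b
  · exact hf.add ((phiMinus P 2 1 two_pos _).sub ((phiMinus P 1 1 two_pos _).smul _))
  · exact hf.add ((phiPlus P 2 1 two_pos _).neg.add ((phiPlus P 1 1 two_pos _).smul _))

theorem primary (n : ℕ) (τ : ℝ) : IsPlaneWave (primaryExp P n τ) :=
  (IsPlaneWave.phi P 2 _ two_pos P.k_pos _).neg.sub
    (IsPlaneWave.phi P 1 _ two_pos (by linarith [P.k_pos]) _)

theorem eExp (b : Bool) : IsPlaneWave (eExp P b) :=
  (para P _ b).sub (IsPlaneWave.phi P 0 _ one_pos P.k_pos _)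

theorem fExp (b : Bool) : IsPlaneWave (fExp P b) :=
  (para P _ b).add (IsPlaneWave.phi' P _ one_pos P.k_pos _)

theorem typeIExp (n : ℕ) (τ : ℝ) (l : ℕ) : IsPlaneWave (typeIExp P n τ l) :=
  (primary P n τ).sub (IsPlaneWave.phi' P _ two_pos P.k_pos _)

theorem typeIIExp (n : ℕ) (τ : ℝ) (l : ℕ) : IsPlaneWave (typeIIExp P n τ l) :=
  (primary P n τ).add (IsPlaneWave.phi P 0 _ two_pos P.k_pos _)

end IsPlaneWave

theorem continuousOn_comm (P : Params) (j : Fin 3) :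
    ContinuousOn (fun t => (comm P j t : ℂ)) (Ioi 0) := by
  have hs : ∀ A, Continuous (P.s A) := fun A => by unfold Params.s; fun_prop
  have hh := P.hbar_pos
  refine Complex.continuous_ofReal.comp_continuousOn ?_
  fin_cases j
  · show ContinuousOn (fun t => P.s 2 t * P.s P.k t * P.s (P.xi + P.k) t /
      (P.hbar ^ 2 * t * P.s P.xi t)) (Ioi 0)
    refine ContinuousOn.div ((((hs _).mul (hs _)).mul (hs _)).continuousOn)
      (((continuous_const.mul continuous_id).mul (hs _)).continuousOn) fun t (ht : 0 < t) => ?_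
    have := P.s_pos P.xi_pos ht
    have := ht.ne'
    positivity
  · show ContinuousOn (fun t => P.s 2 t * P.s (P.k + 2) t / (P.hbar ^ 2 * t)) (Ioi 0)
    refine ContinuousOn.div (((hs _).mul (hs _)).continuousOn)
      ((continuous_const.mul continuous_id).continuousOn) fun t (ht : 0 < t) => ?_
    have := ht.ne'
    exact mul_ne_zero (pow_ne_zero 2 hh.ne') this
  · show ContinuousOn (fun t => -(P.s 2 t * P.s P.k t / (P.hbar ^ 2 * t))) (Ioi 0)
    refine (ContinuousOn.div (((hs _).mul (hs _)).continuousOn)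
      ((continuous_const.mul continuous_id).continuousOn) fun t (ht : 0 < t) => ?_).neg
    have := ht.ne'
    exact mul_ne_zero (pow_ne_zero 2 hh.ne') this

/-- Boson amplitudes may be singular at `t = 0`; test functions vanish near that point. -/
theorem continuous_mul_of_tsupport_subset {u f : ℝ → ℂ} (hu : ContinuousOn u (Ioi 0))
    (hf : Continuous f) (hs : tsupport f ⊆ Ioi 0) : Continuous fun t => u t * f t :=
  (hu.mul hf.continuousOn).continuous_of_tsupport_subset isOpen_Ioi
    ((tsupport_mul_subset_right (f := u) (g := f)).trans hs)

/-! ### Regularity of matrix elements through Fourier transforms of test functions -/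

/-- A function that is continuous on the plane, and bounded on every horizontal line. -/
def IsTame (N : ℂ → ℂ) : Prop :=
  Continuous N ∧ ∀ b : ℝ, ∃ M, ∀ x : ℝ, ‖N (x + b * Complex.I)‖ ≤ M

namespace IsTame

variable {M N : ℂ → ℂ}

theorem const (c : ℂ) : IsTame fun _ => c := ⟨continuous_const, fun _ => ⟨‖c‖, fun _ => le_rfl⟩⟩

theorem add (hM : IsTame M) (hN : IsTame N) : IsTame fun γ => M γ + N γ := by
  refine ⟨hM.1.add hN.1, fun b => ?_⟩
  obtain ⟨A, hA⟩ := hM.2 b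
  obtain ⟨B, hB⟩ := hN.2 b
  exact ⟨A + B, fun x => (norm_add_le _ _).trans (add_le_add (hA x) (hB x))⟩

theorem exp (hN : IsTame N) : IsTame fun γ => Complex.exp (N γ) := by
  refine ⟨Complex.continuous_exp.comp hN.1, fun b => ?_⟩
  obtain ⟨B, hB⟩ := hN.2 b
  exact ⟨Real.exp B, fun x => (Complex.norm_exp_le_exp_norm _).trans (Real.exp_le_exp.2 (hB x))⟩

theorem comp_neg (hN : IsTame N) : IsTame fun γ => N (-γ) := by
  refine ⟨hN.1.comp continuous_neg, fun b => ?_⟩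
  obtain ⟨B, hB⟩ := hN.2 (-b)
  refine ⟨B, fun x => ?_⟩
  have := hB (-x)
  rwa [show ((-x : ℝ) + (-b : ℝ) * Complex.I : ℂ) = -(x + b * Complex.I) by push_cast; ring] at this

/-- The Fourier transform of a continuous function with compact support. -/
theorem fourier {p : ℝ → ℂ} (hp : Continuous p) (hc : HasCompactSupport p) :
    IsTame fun γ => ∫ t in Ioi (0 : ℝ), p t * Complex.exp (Complex.I * γ * t) := by
  have hre : ∀ (γ : ℂ) (t : ℝ), (Complex.I * γ * t).re = -γ.im * t := fun γ t => by simp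
  constructor
  · refine continuous_iff_continuousAt.2 fun γ₀ => ?_
    refine continuousAt_of_dominated (bound := fun t => ‖p t‖ * Real.exp ((|γ₀.im| + 1) * |t|))
      (Eventually.of_forall fun γ => Continuous.aestronglyMeasurable (by fun_prop)) ?_ ?_
      (Eventually.of_forall fun t => by fun_prop)
    · have : ∀ᶠ γ in 𝓝 γ₀, |γ.im| < |γ₀.im| + 1 :=
        (Complex.continuous_im.abs.continuousAt).eventually_lt continuousAt_const (by simp)
      filter_upwards [this] with γ hγ
      refine Eventually.of_forall fun t => ?_
      rw [norm_mul, Complex.norm_exp, hre]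
      refine mul_le_mul_of_nonneg_left (Real.exp_le_exp.2 ?_) (norm_nonneg _)
      calc -γ.im * t ≤ |-γ.im * t| := le_abs_self _
        _ = |γ.im| * |t| := by rw [abs_mul, abs_neg]
        _ ≤ _ := by gcongr
    · refine Integrable.integrableOn (Continuous.integrable_of_hasCompactSupport (by fun_prop) ?_)
      exact hc.norm.mul_right
  · intro b
    -- The modulus of `e^{iγt}` depends on `Im γ` only, so the value at `x = 0` bounds the whole
    -- line.
    refine ⟨∫ t in Ioi (0 : ℝ), ‖p t * Complex.exp (Complex.I * (b * Complex.I) * t)‖,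
      fun x => (norm_integral_le_integral_norm _).trans (le_of_eq ?_)⟩
    congr 1
    ext t
    rw [norm_mul, norm_mul, Complex.norm_exp, Complex.norm_exp, hre, hre]
    simp

end IsTame

/-- Matrix elements of normal ordered exponentials are continuous in the spectral parameter, and
bounded on horizontal lines. -/
theorem isTame_normalOrdered (P : Params) {X Y : ℂ → Exponent} (hX : IsPlaneWave X)
    (hY : IsPlaneWave Y) (ζ : ℂ) (g f : TestState) :
    IsTame fun γ => normalOrdered P (X γ + Y ζ) g f := by
  refine IsTame.exp ?_
  have hterm : ∀ j : Fin 3, IsTame fun γ => ∫ t in Ioi (0 : ℝ),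
      ((X γ + Y ζ) j t * f.toFun j t + g.toFun j t * (X γ + Y ζ) j (-t) +
        g.toFun j t * f.toFun j t) * (comm P j t : ℂ) := by
    intro j
    obtain ⟨u, v, hu, hv, h⟩ := hX j
    obtain ⟨u', v', hu', hv', h'⟩ := hY j
    have hc := continuousOn_comm P j
    have cont_f : ∀ {w : ℝ → ℂ}, ContinuousOn w (Ioi 0) →
        Continuous fun t => w t * f.toFun j t := fun hw =>
      continuous_mul_of_tsupport_subset hw (f.cont j) (f.pos j)
    have cont_g : ∀ {w : ℝ → ℂ}, ContinuousOn w (Ioi 0) →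
        Continuous fun t => w t * g.toFun j t := fun hw =>
      continuous_mul_of_tsupport_subset hw (g.cont j) (g.pos j)
    have supp_f : ∀ w : ℝ → ℂ, HasCompactSupport fun t => w t * f.toFun j t := fun w =>
      (f.compact j).mul_left
    have supp_g : ∀ w : ℝ → ℂ, HasCompactSupport fun t => w t * g.toFun j t := fun w =>
      (g.compact j).mul_left
    have hexp : ContinuousOn (fun t : ℝ => Complex.exp (Complex.I * ζ * t)) (Ioi 0) := by fun_prop
    have hexp' : ContinuousOn (fun t : ℝ => Complex.exp (-(Complex.I * ζ * t))) (Ioi 0) := by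
      fun_prop
    -- The exponent splits into a Fourier transform in `γ` (annihilation part against `f`), one in
    -- `-γ` (creation part against `g`), and terms free of `γ`.
    set p : ℝ → ℂ := fun t => (u t * comm P j t) * f.toFun j t with hp
    set q : ℝ → ℂ := fun t => (v t * comm P j t) * g.toFun j t with hq
    set r₁ : ℝ → ℂ := fun t => (u' t * Complex.exp (Complex.I * ζ * t) * comm P j t) *
      f.toFun j t with hr₁
    set r₂ : ℝ → ℂ := fun t => (v' t * Complex.exp (-(Complex.I * ζ * t)) * comm P j t +
      f.toFun j t * comm P j t) * g.toFun j t with hr₂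
    have cp : Continuous p := cont_f (hu.mul hc)
    have cq : Continuous q := cont_g (hv.mul hc)
    have cr₁ : Continuous r₁ := cont_f ((hu'.mul hexp).mul hc)
    have cr₂ : Continuous r₂ := cont_g
      (((hv'.mul hexp').mul hc).add ((f.cont j).continuousOn.mul hc))
    have ht := (((IsTame.fourier cp (supp_f _)).add (IsTame.fourier cq (supp_g _)).comp_neg).add
      (IsTame.const (∫ t in Ioi (0 : ℝ), r₁ t))).add (IsTame.const (∫ t in Ioi (0 : ℝ), r₂ t))
    convert ht using 1
    ext γ
    have i1 : IntegrableOn (fun t : ℝ => p t * Complex.exp (Complex.I * γ * t)) (Ioi 0) :=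
      (Continuous.integrable_of_hasCompactSupport (by fun_prop)
        (supp_f _).mul_right).integrableOn
    have i2 : IntegrableOn (fun t : ℝ => q t * Complex.exp (Complex.I * -γ * t)) (Ioi 0) :=
      (Continuous.integrable_of_hasCompactSupport (by fun_prop)
        (supp_g _).mul_right).integrableOn
    have i3 : IntegrableOn r₁ (Ioi 0) :=
      (cr₁.integrable_of_hasCompactSupport (supp_f _)).integrableOn
    have i4 : IntegrableOn r₂ (Ioi 0) :=
      (cr₂.integrable_of_hasCompactSupport (supp_g _)).integrableOn
    have i12 : IntegrableOn (fun t : ℝ => p t * Complex.exp (Complex.I * γ * t) +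
        q t * Complex.exp (Complex.I * -γ * t)) (Ioi 0) := i1.add i2
    have i123 : IntegrableOn (fun t : ℝ => p t * Complex.exp (Complex.I * γ * t) +
        q t * Complex.exp (Complex.I * -γ * t) + r₁ t) (Ioi 0) := i12.add i3
    rw [← integral_add i1 i2, ← integral_add i12 i3, ← integral_add i123 i4]
    refine setIntegral_congr_fun measurableSet_Ioi fun t ht => ?_
    simp only [Pi.add_apply, (h γ t ht).1, (h γ t ht).2, (h' ζ t ht).1, (h' ζ t ht).2, hp, hq,
      hr₁, hr₂, mul_neg, neg_mul]
    ring
  simp only [Fin.sum_univ_three]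
  exact ((hterm 0).add (hterm 1)).add (hterm 2)

/-! ### Convergence of the half current integrals -/

theorem norm_inv_sinh_le {w : ℂ} (hw : 1 ≤ |w.re|) :
    ‖(Complex.sinh w)⁻¹‖ ≤ 4 * Real.exp (-|w.re|) := by
  have h1 : Real.exp |w.re| / 4 ≤ ‖Complex.sinh w‖ := by
    have h2 : |Real.exp w.re - Real.exp (-w.re)| ≤ 2 * ‖Complex.sinh w‖ := by
      have := abs_norm_sub_norm_le (Complex.exp w) (Complex.exp (-w))
      rw [Complex.norm_exp, Complex.norm_exp, ← Complex.two_sinh, norm_mul] at this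
      simpa using this
    have h3 : ∀ r : ℝ, 1 ≤ r → Real.exp r / 2 ≤ Real.exp r - Real.exp (-r) := by
      intro r hr
      have h4 := Real.add_one_le_exp r
      have h5 : Real.exp r * Real.exp (-r) = 1 := by rw [← Real.exp_add]; simp
      nlinarith [Real.exp_pos (-r)]
    rcases le_total 0 w.re with h | h
    · rw [abs_of_nonneg h] at hw ⊢
      linarith [h3 _ hw, le_abs_self (Real.exp w.re - Real.exp (-w.re))]
    · rw [abs_of_nonpos h] at hw ⊢
      have := h3 _ hw
      rw [neg_neg] at this
      linarith [neg_abs_le (Real.exp w.re - Real.exp (-w.re))]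
  rw [norm_inv, Real.exp_neg]
  calc ‖Complex.sinh w‖⁻¹ ≤ (Real.exp |w.re| / 4)⁻¹ := inv_anti₀ (by positivity) h1
    _ = _ := by rw [inv_div, div_eq_mul_inv]

/-- The kernel decays like `e^{-ρ|x|}`. Half of this decay absorbs the linear growth, by `|x|
e^{-ρ|x|/2} ≤ 2/ρ`, and the other half is kept. -/
theorem exists_norm_kernel_mul_le {ρ : ℝ} (hρ : 0 < ρ) (κ α : ℂ) {M N : ℂ → ℂ}
    (hM : HasLinearBound M) (hN : IsTame N) (b : ℝ) :
    ∃ K R : ℝ, ∀ x : ℝ, R ≤ |x| → ContinuousAt M (x + b * Complex.I) →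
      ‖κ / Complex.sinh (ρ * (α - (x + b * Complex.I))) *
        (M (x + b * Complex.I) * N (x + b * Complex.I))‖ ≤ K * Real.exp (-(ρ / 2) * |x|) := by
  obtain ⟨A, R, hA, h⟩ := hM b
  obtain ⟨B, hB⟩ := hN.2 b
  refine ⟨‖κ‖ * (4 * Real.exp (ρ * |α.re|)) * (A * (2 / ρ) * B), max R (|α.re| + 1 / ρ),
    fun x hx hc => ?_⟩
  have hB0 : 0 ≤ B := (norm_nonneg _).trans (hB 0)
  have hre : (ρ * (α - (x + b * Complex.I)) : ℂ).re = ρ * (α.re - x) := by simp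
  have habs : ρ * |x| - ρ * |α.re| ≤ |ρ * (α.re - x)| := by
    rw [abs_mul, abs_of_pos hρ, abs_sub_comm]
    nlinarith [abs_sub_abs_le_abs_sub x α.re]
  have h1 : 1 ≤ |ρ * (α.re - x)| := by
    refine le_trans ?_ habs
    have := mul_le_mul_of_nonneg_left ((le_max_right _ _).trans hx) hρ.le
    rw [mul_add, mul_one_div_cancel hρ.ne'] at this
    linarith
  have h2 := norm_inv_sinh_le (w := ρ * (α - (x + b * Complex.I))) (by rwa [hre])
  rw [hre] at h2
  have h3 : ‖(Complex.sinh (ρ * (α - (x + b * Complex.I))))⁻¹‖ ≤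
      4 * Real.exp (ρ * |α.re|) * Real.exp (-(ρ / 2) * |x|) * Real.exp (-(ρ / 2) * |x|) := by
    refine h2.trans ?_
    rw [mul_assoc, mul_assoc, ← Real.exp_add, ← Real.exp_add]
    refine mul_le_mul_of_nonneg_left (Real.exp_le_exp.2 ?_) (by norm_num)
    linarith
  have h4 : |x| * Real.exp (-(ρ / 2) * |x|) ≤ 2 / ρ := by
    have h5 := Real.add_one_le_exp (ρ / 2 * |x|)
    rw [neg_mul, Real.exp_neg, ← div_eq_mul_inv, div_le_div_iff₀ (Real.exp_pos _) hρ]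
    linarith
  rw [div_eq_mul_inv, norm_mul, norm_mul, norm_mul]
  calc _ ≤ ‖κ‖ * (4 * Real.exp (ρ * |α.re|) * Real.exp (-(ρ / 2) * |x|) *
        Real.exp (-(ρ / 2) * |x|)) * (A * |x| * B) := by
        gcongr
        · exact h x ((le_max_left _ _).trans hx) hc
        · exact hB x
    _ = ‖κ‖ * (4 * Real.exp (ρ * |α.re|)) * (A * (|x| * Real.exp (-(ρ / 2) * |x|)) * B) *
        Real.exp (-(ρ / 2) * |x|) := by ring
    _ ≤ _ := by gcongr

/-- The integrand is continuous along the contour and, on the horizontal ends, where `dγ = dx`,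
exponentially small. -/
theorem Contour.converges_kernel_mul (C : Contour) {ρ : ℝ} (hρ : 0 < ρ) (κ : ℂ) {α : ℂ}
    {M N : ℂ → ℂ} (hα : ∀ x, Complex.sinh (ρ * (α - C.path x)) ≠ 0)
    (hMc : ∀ x, ContinuousAt M (C.path x)) (hM : HasLinearBound M) (hN : IsTame N) :
    C.Converges fun γ => κ / Complex.sinh (ρ * (α - γ)) * (M γ * N γ) := by
  have hp : Continuous C.path := C.smooth.continuous
  have hcont : Continuous fun x : ℝ => κ / Complex.sinh (ρ * (α - C.path x)) *
      (M (C.path x) * N (C.path x)) * deriv C.path x := by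
    have hMp : Continuous fun x => M (C.path x) := continuous_iff_continuousAt.2 fun x =>
      (hMc x).comp hp.continuousAt
    have hd : Continuous (deriv C.path) := C.smooth.continuous_deriv le_rfl
    exact ((continuous_const.div (by fun_prop) hα).mul (hMp.mul (hN.1.comp hp))).mul hd
  have hbound : ∀ {b : ℝ} {s : Set ℝ}, IsOpen s → (∀ x ∈ s, C.path x = x + b * Complex.I) →
      ∃ K R' : ℝ, ∀ x ∈ s, R' ≤ |x| → ‖κ / Complex.sinh (ρ * (α - C.path x)) *
        (M (C.path x) * N (C.path x)) * deriv C.path x‖ ≤ K * Real.exp (-(ρ / 2) * |x|) := by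
    intro b s hs hpath
    obtain ⟨K, R', h⟩ := exists_norm_kernel_mul_le hρ κ α hM hN b
    refine ⟨K, R', fun x hx hR => ?_⟩
    have hd : deriv C.path x = 1 := by
      have he : C.path =ᶠ[𝓝 x] fun y => (y : ℂ) + b * Complex.I := by
        filter_upwards [hs.mem_nhds hx] with y hy using hpath y hy
      rw [he.deriv_eq]
      exact ((Complex.ofRealCLM.hasDerivAt (x := x)).add_const _).deriv
    rw [hd, mul_one, hpath x hx]
    exact h x hR (hpath x hx ▸ hMc x)
  refine hcont.locallyIntegrable.integrable_of_isBigO_atBot_atTop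
    (g := fun x => Real.exp (ρ / 2 * x)) (g' := fun x => Real.exp (-(ρ / 2) * x)) ?_ ?_ ?_ ?_
  · obtain ⟨R, b, h⟩ := C.left_end
    obtain ⟨K, R', hK⟩ := hbound (b := b) (s := Iio R) isOpen_Iio fun x hx => h x hx.le
    refine Asymptotics.IsBigO.of_bound K ?_
    filter_upwards [eventually_lt_atBot R, eventually_le_atBot (-R'), eventually_le_atBot 0]
      with x h1 h2 h3
    have := hK x h1 (by rw [abs_of_nonpos h3]; linarith)
    rw [abs_of_nonpos h3] at this
    rw [Real.norm_of_nonneg (Real.exp_pos _).le]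
    simpa using this
  · exact ⟨Iic 0, Iic_mem_atBot 0, integrableOn_exp_mul_Iic (by positivity) 0⟩
  · obtain ⟨R, b, h⟩ := C.right_end
    obtain ⟨K, R', hK⟩ := hbound (b := b) (s := Ioi R) isOpen_Ioi fun x hx =>
      h x (le_of_lt hx)
    refine Asymptotics.IsBigO.of_bound K ?_
    filter_upwards [eventually_gt_atTop R, eventually_ge_atTop R', eventually_ge_atTop 0]
      with x h1 h2 h3
    have := hK x h1 (by rwa [abs_of_nonneg h3])
    rw [abs_of_nonneg h3] at this
    rwa [Real.norm_of_nonneg (Real.exp_pos _).le]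
  · exact ⟨Ioi 0, Ioi_mem_atTop 0, integrableOn_exp_mul_Ioi (by linarith) 0⟩

/-! ### Exchange of a current with a vertex operator -/

/-- The exchange relation of every term of the current `A` with `:exp Y(ζ):`, the factors depending
on the difference of the spectral parameters. -/
def FieldExchange (P : Params) (A : VertexField) (Y : ℂ → Exponent) (ν : ℂ) (s₁ s₂ : ℂ → ℂ) :
    Prop :=
  ∀ p ∈ A, ∀ ζ, Exchange P p.2 Y ζ ν (fun γ => s₁ (γ - ζ)) fun γ => s₂ (γ - ζ)

theorem Exchange.cancel {P : Params} {X Y : ℂ → Exponent} {ζ ν c : ℂ} {s₁ s₂ : ℂ → ℂ}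
    (h : Exchange P X Y ζ ν s₁ s₂) (hc : ∀ γ, s₁ γ = c * s₂ γ)
    (h0 : ∀ z, ∀ᶠ γ in 𝓝[≠] z, s₂ γ ≠ 0) : Exchange P X Y ζ ν (fun _ => c) fun _ => 1 where
  existsL := h.existsL
  existsR := h.existsR
  growthL := h.growthL
  growthR := h.growthR
  rel z := by
    filter_upwards [h.rel z, h0 z] with γ h1 h2
    rw [hc] at h1
    refine mul_right_cancel₀ h2 ?_
    linear_combination h1

theorem eventually_sinh_affine_ne_zero {ρ : ℝ} (hρ : 0 < ρ) (d z : ℂ) :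
    ∀ᶠ γ in 𝓝[≠] z, Complex.sinh (ρ * (γ - d)) ≠ 0 := by
  have hpi : (Real.pi : ℂ) ≠ 0 := by exact_mod_cast Real.pi_ne_zero
  have hρ' : (ρ : ℂ) ≠ 0 := by exact_mod_cast hρ.ne'
  filter_upwards [eventually_sin_affine_ne_zero (c := ρ * Complex.I / Real.pi)
    (div_ne_zero (mul_ne_zero hρ' Complex.I_ne_zero) hpi) (-(ρ * d * Complex.I / Real.pi)) z]
    with γ h h0
  rw [show (Real.pi : ℂ) * (-(ρ * d * Complex.I / Real.pi) + ρ * Complex.I / Real.pi * γ) =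
    ρ * (γ - d) * Complex.I by field_simp; ring, Complex.sin_mul_I, h0, zero_mul] at h
  exact h rfl

/-- When `sh 2ρB = 0`, the factors `sh ρ(u+B)` and `sh ρ(u-B)` are proportional, and the second has
isolated zeros, so it can be cancelled. -/
theorem FieldExchange.cancel {P : Params} {A : VertexField} {Y : ℂ → Exponent} {ν B : ℂ} {ρ : ℝ}
    (hρ : 0 < ρ) (h : FieldExchange P A Y ν (fun u => Complex.sinh (ρ * (u + B)))
      fun u => Complex.sinh (ρ * (u - B))) (h0 : Complex.sinh (ρ * (2 * B)) = 0) :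
    FieldExchange P A Y ν (fun _ => Complex.cosh (ρ * (2 * B))) fun _ => 1 := by
  intro p hp ζ
  refine (h p hp ζ).cancel (fun γ => ?_) fun z => ?_
  · beta_reduce
    rw [show (ρ : ℂ) * (γ - ζ + B) = ρ * (2 * B) + ρ * (γ - ζ - B) by ring, Complex.sinh_add, h0]
    ring
  · filter_upwards [eventually_sinh_affine_ne_zero hρ (ζ + B) z] with γ h1
    rwa [← sub_sub] at h1

section

variable {P : Params} {A : VertexField} {Y : ℂ → Exponent} {ν : ℂ} {s₁ s₂ : ℂ → ℂ}

theorem FieldExchange.hasProducts (h : FieldExchange P A Y ν s₁ s₂) :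
    HasProducts P A [(1, Y)] := by
  intro ζ p hp q hq
  obtain rfl := List.mem_singleton.1 hq
  exact ⟨(h p hp ζ).existsL, (h p hp ζ).existsR⟩

/-- The meromorphic relation holds near `γ`, and at a regular point both sides are continuous, so it
holds at `γ` itself. Every term carries the same factors, hence so does the sum. -/
theorem FieldExchange.mulL_mul (h : FieldExchange P A Y ν s₁ s₂) (h₁ : Continuous s₁)
    (h₂ : Continuous s₂) {γ ζ : ℂ} (hr : IsRegular P A [(1, Y)] ζ γ) (g f : TestState) :
    mulL P A [(1, Y)] γ ζ g f * s₁ (γ - ζ) = ν * (mulR P A [(1, Y)] γ ζ g f * s₂ (γ - ζ)) := by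
  simp only [mulL, mulR, List.map_cons, List.map_nil, List.sum_singleton]
  rw [← List.sum_map_mul_right, ← List.sum_map_mul_right, ← List.sum_map_mul_left]
  congr 1
  refine List.map_congr_left fun p hp => ?_
  obtain ⟨hL, hR⟩ := hr p hp _ (List.mem_singleton.2 rfl)
  have key := eq_of_eventuallyEq_nhdsNE
    (hL.continuousAt.mul (h₁.comp (continuous_sub_right ζ)).continuousAt)
    (continuousAt_const.mul (hR.continuousAt.mul (h₂.comp (continuous_sub_right ζ)).continuousAt))
    ((h p hp ζ).rel γ)
  simp only [Pi.mul_apply, Function.comp_apply] at key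
  linear_combination p.1 * normalOrdered P (p.2 γ + Y ζ) g f * key

theorem Contour.converges_sum {ι : Type*} (C : Contour) (l : List ι) {G : ι → ℂ → ℂ}
    (h : ∀ i ∈ l, C.Converges (G i)) : C.Converges fun γ => (l.map fun i => G i γ).sum := by
  induction l with
  | nil => simp [Contour.Converges]
  | cons i l ih =>
    have := (h i List.mem_cons_self).add (ih fun j hj => h j (List.mem_cons_of_mem _ hj))
    refine this.congr (Eventually.of_forall fun x => ?_)
    simp [add_mul]

theorem FieldExchange.halfConverges (h : FieldExchange P A Y ν s₁ s₂)
    (hA : ∀ p ∈ A, IsPlaneWave p.2) (hY : IsPlaneWave Y) {C : Contour} {ζ : ℂ}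
    (hr : ∀ x, IsRegular P A [(1, Y)] ζ (C.path x)) {ρ : ℝ} (hρ : 0 < ρ) (κ : ℂ) {α : ℂ}
    (hα : ∀ x, Complex.sinh (ρ * (α - C.path x)) ≠ 0) :
    HalfConverges P C (fun γ => κ / Complex.sinh (ρ * (α - γ))) A [(1, Y)] ζ := by
  intro g f
  simp only [mulL, mulR, List.map_cons, List.map_nil, List.sum_singleton,
    ← List.sum_map_mul_left]
  constructor
  · refine C.converges_sum A fun p hp => ?_
    have := C.converges_kernel_mul hρ (κ * (p.1 * 1)) hα
      (fun x => (hr x p hp _ (List.mem_singleton.2 rfl)).1.continuousAt) (h p hp ζ).growthL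
      (isTame_normalOrdered P (hA p hp) hY ζ g f)
    convert this using 2
    ring
  · refine C.converges_sum A fun p hp => ?_
    have := C.converges_kernel_mul hρ (κ * (p.1 * 1)) hα
      (fun x => (hr x p hp _ (List.mem_singleton.2 rfl)).2.continuousAt) (h p hp ζ).growthR
      (isTame_normalOrdered P (hA p hp) hY ζ g f)
    convert this using 2
    ring

theorem Contour.integral_congr (C : Contour) {G H : ℂ → ℂ}
    (h : ∀ x, G (C.path x) = H (C.path x)) : C.integral G = C.integral H := by
  simp only [Contour.integral, h]

theorem Contour.integral_mul_sub (C : Contour) {G H : ℂ → ℂ} (hG : C.Converges G)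
    (hH : C.Converges H) (a b : ℂ) :
    C.integral (fun γ => a * G γ - b * H γ) = a * C.integral G - b * C.integral H := by
  simp only [Contour.integral]
  rw [show (fun x => (a * G (C.path x) - b * H (C.path x)) * deriv C.path x) = fun x =>
    a * (G (C.path x) * deriv C.path x) - b * (H (C.path x) * deriv C.path x) by ext; ring,
    integral_sub (hG.const_mul a) (hH.const_mul b), integral_const_mul, integral_const_mul]
  ring

theorem Contour.integral_const_mul (C : Contour) (G : ℂ → ℂ) (a : ℂ) :
    C.integral (fun γ => a * G γ) = a * C.integral G := by
  simp only [Contour.integral, mul_assoc]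
  rw [MeasureTheory.integral_const_mul]
  ring

/-- Currents that commute with a vertex operator give half currents that commute with it. -/
theorem FieldExchange.halfL_eq (h : FieldExchange P A Y ν (fun _ => 1) fun _ => 1) {C : Contour}
    {ζ : ℂ} (hr : ∀ x, IsRegular P A [(1, Y)] ζ (C.path x)) (K : ℂ → ℂ) :
    halfL P C K A [(1, Y)] ζ = ν • halfR P C K A [(1, Y)] ζ := by
  ext g f
  simp only [halfL, halfR, Pi.smul_apply, smul_eq_mul]
  rw [← C.integral_const_mul]
  refine C.integral_congr fun x => ?_
  have := h.mulL_mul continuous_const continuous_const (hr x) g f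
  linear_combination K (C.path x) * this

/-- The numerator of a difference of two kernel coefficients: it factors into a part that depends on
the two `α`s and the factor of the exchange relation. -/
theorem sinh_kernel_identity (a₁ a₂ u b : ℂ) :
    Complex.sinh (a₂ - u) * Complex.sinh (a₁ + b) - Complex.sinh (a₁ - u) * Complex.sinh (a₂ + b) =
      Complex.sinh (a₂ - a₁) * Complex.sinh (u + b) := by
  simp only [Complex.sinh_add, Complex.sinh_sub]
  ring

/-- The combination `sh ρ(α-ζ+B) x(α)Φ - ν sh ρ(α-ζ-B) Φ x(α)` for the half current
`x(α) = κ ∫_C dγ/(2πi) A(γ) / sh ρ(α-γ)` and `Φ = :exp Y(ζ):`. -/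
noncomputable def halfCommutator (P : Params) (C : Contour) (ρ : ℝ) (κ B ν : ℂ) (A : VertexField)
    (Y : ℂ → Exponent) (ζ α : ℂ) : Op :=
  Complex.sinh (ρ * (α - ζ + B)) •
      halfL P C (fun γ => κ / Complex.sinh (ρ * (α - γ))) A [(1, Y)] ζ -
    (ν * Complex.sinh (ρ * (α - ζ - B))) •
      halfR P C (fun γ => κ / Complex.sinh (ρ * (α - γ))) A [(1, Y)] ζ

section

variable {C : Contour} {ρ : ℝ} {B ζ : ℂ} (hρ : 0 < ρ) (κ : ℂ)
  (h : FieldExchange P A Y ν (fun u => Complex.sinh (ρ * (u + B)))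
    fun u => Complex.sinh (ρ * (u - B)))
  (hA : ∀ p ∈ A, IsPlaneWave p.2) (hY : IsPlaneWave Y)
  (hr : ∀ x, IsRegular P A [(1, Y)] ζ (C.path x))

include hρ h hA hY hr

theorem halfCommutator_apply {α : ℂ} (hα : ∀ x, Complex.sinh (ρ * (α - C.path x)) ≠ 0)
    (g f : TestState) : halfCommutator P C ρ κ B ν A Y ζ α g f = C.integral fun γ =>
      Complex.sinh (ρ * (α - ζ + B)) * (κ / Complex.sinh (ρ * (α - γ)) *
        mulL P A [(1, Y)] γ ζ g f) -
      ν * Complex.sinh (ρ * (α - ζ - B)) * (κ / Complex.sinh (ρ * (α - γ)) *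
        mulR P A [(1, Y)] γ ζ g f) := by
  obtain ⟨hL, hR⟩ := h.halfConverges hA hY hr hρ κ hα g f
  rw [C.integral_mul_sub hL hR]
  rfl

/-- By the kernel identity with `b = ±ρB`, the two integrands differ by a multiple of `sh ρ(γ-ζ+B)
A(γ)Φ - ν sh ρ(γ-ζ-B) ΦA(γ)`, which vanishes by the exchange relation. -/
theorem halfCommutator_eq {α₁ α₂ : ℂ} (h₁ : ∀ x, Complex.sinh (ρ * (α₁ - C.path x)) ≠ 0)
    (h₂ : ∀ x, Complex.sinh (ρ * (α₂ - C.path x)) ≠ 0) :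
    halfCommutator P C ρ κ B ν A Y ζ α₁ = halfCommutator P C ρ κ B ν A Y ζ α₂ := by
  ext g f
  rw [halfCommutator_apply hρ κ h hA hY hr h₁, halfCommutator_apply hρ κ h hA hY hr h₂]
  refine C.integral_congr fun x => ?_
  have key := h.mulL_mul (by fun_prop) (by fun_prop) (hr x) g f
  beta_reduce at key
  have i₁ := sinh_kernel_identity (ρ * (α₁ - ζ)) (ρ * (α₂ - ζ)) (ρ * (C.path x - ζ)) (ρ * B)
  have i₂ := sinh_kernel_identity (ρ * (α₁ - ζ)) (ρ * (α₂ - ζ)) (ρ * (C.path x - ζ)) (-(ρ * B))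
  simp only [← sub_eq_add_neg, ← mul_sub, ← mul_add, sub_sub_sub_cancel_right] at i₁ i₂
  have n₁ := h₁ x
  have n₂ := h₂ x
  field_simp
  linear_combination κ * mulL P A [(1, Y)] (C.path x) ζ g f * i₁ -
    κ * ν * mulR P A [(1, Y)] (C.path x) ζ g f * i₂ +
    κ * Complex.sinh (ρ * (α₂ - α₁)) * key

/-- The outer coefficients and the exchange factors are then proportional with the same constant `ch
2ρB`, so the integrand is zero pointwise. -/
theorem halfCommutator_eq_zero (h0 : Complex.sinh (ρ * (2 * B)) = 0) {α : ℂ}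
    (hα : ∀ x, Complex.sinh (ρ * (α - C.path x)) ≠ 0) :
    halfCommutator P C ρ κ B ν A Y ζ α = 0 := by
  ext g f
  rw [halfCommutator_apply hρ κ h hA hY hr hα]
  have hz : C.integral (fun _ => 0) = 0 := by simp [Contour.integral]
  refine (C.integral_congr fun x => ?_).trans hz
  have key := (h.cancel hρ h0).mulL_mul continuous_const continuous_const (hr x) g f
  beta_reduce at key
  have hs : Complex.sinh (ρ * (α - ζ + B)) =
      Complex.cosh (ρ * (2 * B)) * Complex.sinh (ρ * (α - ζ - B)) := by
    rw [show (ρ : ℂ) * (α - ζ + B) = ρ * (2 * B) + ρ * (α - ζ - B) by ring, Complex.sinh_add, h0]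
    ring
  rw [hs]
  linear_combination Complex.sinh (ρ * (α - ζ - B)) * (κ / Complex.sinh (ρ * (α - C.path x))) * key

end

open Classical in
/-- The combination `halfCommutator` does not depend on the spectral parameter of the half current,
and vanishes if `sh 2ρB = 0`. -/
theorem exists_halfCommutator_eq (C : Contour) {ρ : ℝ} (hρ : 0 < ρ) (κ : ℂ) {B : ℂ}
    (h : FieldExchange P A Y ν (fun u => Complex.sinh (ρ * (u + B)))
      fun u => Complex.sinh (ρ * (u - B)))
    (hA : ∀ p ∈ A, IsPlaneWave p.2) (hY : IsPlaneWave Y) :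
    ∃ T : ℂ → Op, (Complex.sinh (ρ * (2 * B)) = 0 → T = 0) ∧
      ∀ ζ, (∀ x, IsRegular P A [(1, Y)] ζ (C.path x)) →
        ∀ α, (∀ x, Complex.sinh (ρ * (α - C.path x)) ≠ 0) →
          HalfConverges P C (fun γ => κ / Complex.sinh (ρ * (α - γ))) A [(1, Y)] ζ ∧
            halfCommutator P C ρ κ B ν A Y ζ α = T ζ := by
  -- Any admissible `α` may define the operator, as the combination does not depend on it; if none
  -- exists, the value is immaterial. The outer case makes the whole family zero in the degenerate
  -- situation, also where `ζ` is not regular.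
  refine ⟨fun ζ => if Complex.sinh (ρ * (2 * B)) = 0 then 0 else
    if hα : ∃ α, ∀ x, Complex.sinh (ρ * (α - C.path x)) ≠ 0 then
      halfCommutator P C ρ κ B ν A Y ζ hα.choose else 0, fun h0 => ?_, fun ζ hr α hα =>
    ⟨h.halfConverges hA hY hr hρ κ hα, ?_⟩⟩
  · ext ζ
    simp [h0]
  · by_cases h0 : Complex.sinh (ρ * (2 * B)) = 0
    · beta_reduce
      rw [if_pos h0]
      exact halfCommutator_eq_zero hρ κ h hA hY hr h0 hα
    · have hex : ∃ α, ∀ x, Complex.sinh (ρ * (α - C.path x)) ≠ 0 := ⟨α, hα⟩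
      beta_reduce
      rw [if_neg h0, dif_pos hex]
      exact halfCommutator_eq hρ κ h hA hY hr hα hex.choose_spec

end

/-! ### The intertwining relations -/

section

variable {P : Params} {Y : ℂ → Exponent} {ν : ℂ} {s₁ s₂ : ℂ → ℂ}

theorem fieldExchange_E (h : ∀ b ζ, Exchange P (eExp P b) Y ζ ν (fun γ => s₁ (γ - ζ))
    fun γ => s₂ (γ - ζ)) : FieldExchange P (E P) Y ν s₁ s₂ := by
  intro p hp ζ
  rcases List.mem_pair.1 hp with rfl | rfl
  exacts [h true ζ, h false ζ]

theorem fieldExchange_F (h : ∀ b ζ, Exchange P (fExp P b) Y ζ ν (fun γ => s₁ (γ - ζ))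
    fun γ => s₂ (γ - ζ)) : FieldExchange P (F P) Y ν s₁ s₂ := by
  intro p hp ζ
  rcases List.mem_pair.1 hp with rfl | rfl
  exacts [h true ζ, h false ζ]

theorem fieldExchange_h (κ : ℂ) (σ : ℤˣ) (h : ∀ ζ, Exchange P (hExp P σ) Y ζ ν
    (fun γ => s₁ (γ - ζ)) fun γ => s₂ (γ - ζ)) :
    FieldExchange P (AhEta.h P κ σ) Y ν s₁ s₂ := by
  intro p hp ζ
  obtain rfl := List.mem_singleton.1 hp
  exact h ζ

theorem isPlaneWave_of_mem_E (p : ℂ × (ℂ → Exponent)) (hp : p ∈ E P) : IsPlaneWave p.2 := by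
  rcases List.mem_pair.1 hp with rfl | rfl
  exacts [.eExp P true, .eExp P false]

theorem isPlaneWave_of_mem_F (p : ℂ × (ℂ → Exponent)) (hp : p ∈ F P) : IsPlaneWave p.2 := by
  rcases List.mem_pair.1 hp with rfl | rfl
  exacts [.fExp P true, .fExp P false]

end

/-! ### Half currents as integrals with a translated kernel -/

variable (P : Params)

theorem pi_mul_eta_pos : 0 < Real.pi * P.eta :=
  mul_pos Real.pi_pos (one_div_pos.2 (mul_pos P.hbar_pos P.xi_pos))

theorem pi_mul_eta'_pos : 0 < Real.pi * P.eta' :=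
  mul_pos Real.pi_pos (one_div_pos.2 (mul_pos P.hbar_pos P.xi_add_k_pos))

/-- The value is `i sin(π/(ξ+k))`, and `ξ + k > 1` because `k ≥ 1`. The type II coefficient
`sh(iπηħl)` has no such protection. -/
theorem shEta'_I_mul_hbar_ne_zero : P.shEta' (Complex.I * P.hbar) ≠ 0 := by
  have hk : (1 : ℝ) ≤ P.k := by rw [Params.k]; exact_mod_cast P.level_pos
  have h1 : 1 < P.xi + P.k := by linarith [P.xi_pos]
  have hpi := Real.pi_pos
  have h2 : Real.pi * P.eta' * P.hbar = Real.pi / (P.xi + P.k) := by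
    have := P.hbar_pos.ne'
    rw [Params.eta']
    field_simp
  rw [Params.shEta', show ((Real.pi * P.eta' : ℝ) : ℂ) * (Complex.I * P.hbar) =
    ((Real.pi / (P.xi + P.k) : ℝ) : ℂ) * Complex.I by rw [← h2]; push_cast; ring,
    Complex.sinh_mul_I, ← Complex.ofReal_sin]
  refine mul_ne_zero (Complex.ofReal_ne_zero.2 (Real.sin_pos_of_pos_of_lt_pi (by positivity) ?_).ne')
    Complex.I_ne_zero
  rw [div_lt_iff₀ (by linarith)]
  nlinarith

/-- Absorbing the sign dependent shift into `α` reduces both half currents to one kernel, which is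
why the lower component is common to both signs. -/
theorem eDen_eq (σ : ℤˣ) (α γ : ℂ) : eDen P σ α γ = Complex.sinh ((Real.pi * P.eta : ℝ) *
    (α + sgn σ * (Complex.I * P.hbar * P.k / 4) - γ)) := by
  rw [eDen, Params.shEta, sub_add_eq_add_sub]

theorem fDen_eq (σ : ℤˣ) (α γ : ℂ) : fDen P σ α γ = Complex.sinh ((Real.pi * P.eta' : ℝ) *
    (α - sgn σ * (Complex.I * P.hbar * P.k / 4) - γ)) := by
  rw [fDen, Params.shEta', sub_right_comm]

variable {P} {l : ℕ} {ν : ℂ} {Y : ℂ → Exponent}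

theorem typeI_of_exchange (κ : ℂ) (hY : IsPlaneWave Y)
    (hE : ∀ b ζ, Exchange P (eExp P b) Y ζ ν (fun _ => 1) fun _ => 1)
    (hF : ∀ b ζ, Exchange P (fExp P b) Y ζ ν
      (fun γ => P.shEta' (γ - ζ + Complex.I * P.hbar / 2 * l))
      fun γ => P.shEta' (γ - ζ - Complex.I * P.hbar / 2 * l))
    (hh : ∀ σ ζ, Exchange P (hExp P σ) Y ζ 1
      (fun γ => P.shEta' (γ - ζ + Complex.I * P.hbar / 2 * (l - sgn σ * (P.k / 2))))
      fun γ => P.shEta' (γ - ζ - Complex.I * P.hbar / 2 * (l + sgn σ * (P.k / 2)))) :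
    TypeI P κ l ν [(1, Y)] := by
  have fE : FieldExchange P (E P) Y ν (fun _ => 1) fun _ => 1 := fieldExchange_E hE
  have fF : FieldExchange P (F P) Y ν
      (fun u => Complex.sinh ((Real.pi * P.eta' : ℝ) * (u + Complex.I * P.hbar / 2 * l)))
      fun u => Complex.sinh ((Real.pi * P.eta' : ℝ) * (u - Complex.I * P.hbar / 2 * l)) :=
    fieldExchange_F hF
  have fh : ∀ σ, FieldExchange P (AhEta.h P κ σ) Y 1
      (fun u => P.shEta' (u + Complex.I * P.hbar / 2 * (l - sgn σ * (P.k / 2))))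
      fun u => P.shEta' (u - Complex.I * P.hbar / 2 * (l + sgn σ * (P.k / 2))) := fun σ =>
    fieldExchange_h κ σ (hh σ)
  refine ⟨⟨fun σ => (fh σ).hasProducts, fE.hasProducts, fF.hasProducts⟩, fun σ α ζ hr h0 => ?_,
    fun C ζ hr σ α hα => ⟨?_, fE.halfL_eq hr _⟩, fun C => ?_⟩
  · ext g f
    have key := (fh σ).mulL_mul (by unfold Params.shEta'; fun_prop)
      (by unfold Params.shEta'; fun_prop) hr g f
    beta_reduce at key
    rw [Pi.smul_apply, Pi.smul_apply, smul_eq_mul, div_mul_eq_mul_div, eq_div_iff h0]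
    linear_combination -key
  · simp only [eDen_eq] at hα
    have := fE.halfConverges isPlaneWave_of_mem_E hY hr (pi_mul_eta_pos P)
      (Real.sin (Real.pi * P.eta * P.hbar) : ℝ) hα
    unfold eKer
    simpa only [eDen_eq] using this
  · obtain ⟨T, hT0, hT⟩ := exists_halfCommutator_eq C (pi_mul_eta'_pos P)
      (Real.sin (Real.pi * P.eta' * P.hbar) : ℝ) fF isPlaneWave_of_mem_F hY
    refine ⟨(P.shEta' (Complex.I * P.hbar))⁻¹ • T, fun hl => ?_, fun ζ hr σ α hα => ?_⟩
    · rw [hT0 (by simp [hl]), smul_zero]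
    · simp only [fDen_eq] at hα
      have := hT ζ hr _ hα
      unfold fKer
      simp only [fDen_eq]
      refine ⟨this.1, ?_⟩
      rw [Pi.smul_apply, smul_inv_smul₀ (shEta'_I_mul_hbar_ne_zero P), ← this.2, halfCommutator,
        Params.shEta', Params.shEta']
      congr 4 <;> ring

theorem typeII_of_exchange (κ : ℂ) (hν : ν * ν = 1) (hY : IsPlaneWave Y)
    (hE : ∀ b ζ, Exchange P (eExp P b) Y ζ ν
      (fun γ => P.shEta (γ - ζ - Complex.I * P.hbar / 2 * l))
      fun γ => P.shEta (γ - ζ + Complex.I * P.hbar / 2 * l))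
    (hF : ∀ b ζ, Exchange P (fExp P b) Y ζ ν (fun _ => 1) fun _ => 1)
    (hh : ∀ σ ζ, Exchange P (hExp P σ) Y ζ 1
      (fun γ => P.shEta (γ - ζ - Complex.I * P.hbar / 2 * (l - sgn σ * (P.k / 2))))
      fun γ => P.shEta (γ - ζ + Complex.I * P.hbar / 2 * (l + sgn σ * (P.k / 2)))) :
    TypeII P κ l ν [(1, Y)] := by
  have fF : FieldExchange P (F P) Y ν (fun _ => 1) fun _ => 1 := fieldExchange_F hF
  have fE : FieldExchange P (E P) Y ν
      (fun u => Complex.sinh ((Real.pi * P.eta : ℝ) * (u + -(Complex.I * P.hbar / 2 * l))))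
      fun u => Complex.sinh ((Real.pi * P.eta : ℝ) * (u - -(Complex.I * P.hbar / 2 * l))) := by
    simp only [← sub_eq_add_neg, sub_neg_eq_add]
    exact fieldExchange_E hE
  have fh : ∀ σ, FieldExchange P (AhEta.h P κ σ) Y 1
      (fun u => P.shEta (u - Complex.I * P.hbar / 2 * (l - sgn σ * (P.k / 2))))
      fun u => P.shEta (u + Complex.I * P.hbar / 2 * (l + sgn σ * (P.k / 2))) := fun σ =>
    fieldExchange_h κ σ (hh σ)
  refine ⟨⟨fun σ => (fh σ).hasProducts, fE.hasProducts, fF.hasProducts⟩, fun σ α ζ hr h0 => ?_,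
    fun C ζ hr σ α hα => ⟨?_, fF.halfL_eq hr _⟩, fun C => ?_⟩
  · ext g f
    have key := (fh σ).mulL_mul (by unfold Params.shEta; fun_prop)
      (by unfold Params.shEta; fun_prop) hr g f
    beta_reduce at key
    rw [Pi.smul_apply, Pi.smul_apply, smul_eq_mul, div_mul_eq_mul_div, eq_div_iff h0]
    linear_combination key
  · simp only [fDen_eq] at hα
    have := fF.halfConverges isPlaneWave_of_mem_F hY hr (pi_mul_eta'_pos P)
      (Real.sin (Real.pi * P.eta' * P.hbar) : ℝ) hα
    unfold fKer
    simpa only [fDen_eq] using this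
  · obtain ⟨T, hT0, hT⟩ := exists_halfCommutator_eq C (pi_mul_eta_pos P)
      (Real.sin (Real.pi * P.eta * P.hbar) : ℝ) fE isPlaneWave_of_mem_E hY
    have hd : Complex.sinh ((Real.pi * P.eta : ℝ) * (2 * -(Complex.I * P.hbar / 2 * l))) =
        -P.shEta (Complex.I * P.hbar * l) := by
      rw [Params.shEta, ← Complex.sinh_neg]
      ring_nf
    rw [hd, neg_eq_zero] at hT0
    -- Type II subtracts in the other order, so the combination is multiplied by `-ν` with `ν² = 1`.
    -- If the coefficient is zero, its inverse is `0` by convention, and the relation still holds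
    -- because `T` vanishes then.
    refine ⟨(P.shEta (Complex.I * P.hbar * l))⁻¹ • (-ν) • T, fun hl => ?_, fun ζ hr σ α hα => ?_⟩
    · rw [hT0 (by simp [hl, Params.shEta]), smul_zero, smul_zero]
    · simp only [eDen_eq] at hα
      have := hT ζ hr _ hα
      unfold eKer
      simp only [eDen_eq]
      refine ⟨this.1, ?_⟩
      have hT' : P.shEta (Complex.I * P.hbar * l) •
          ((P.shEta (Complex.I * P.hbar * l))⁻¹ • (-ν) • T) ζ = (-ν) • T ζ := by
        by_cases h0 : P.shEta (Complex.I * P.hbar * l) = 0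
        · rw [hT0 h0]; simp
        · rw [Pi.smul_apply, smul_inv_smul₀ h0, Pi.smul_apply]
      rw [hT', ← this.2, halfCommutator, Params.shEta, Params.shEta, neg_smul, smul_sub, smul_smul,
        smul_smul, ← mul_assoc, hν, one_mul, neg_sub]
      congr 4 <;> ring

end AhEta

theorem proposition4p3 (P : AhEta.Params) (κ : ℂ) (l : ℕ) (hl : l ≤ P.level) :
    AhEta.TypeI P κ l 1 (AhEta.PhiTop P l) ∧
    AhEta.TypeII P κ l 1 (AhEta.PsiTop P l) ∧
    AhEta.TypeI P κ l (-1) (AhEta.PhiTwisted P l) ∧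
    AhEta.TypeII P κ l (-1) (AhEta.PsiTwisted P l) := by
  open AhEta in
  exact ⟨typeI_of_exchange κ (.typeIExp P _ _ _) (exchange_E_typeI P · ·)
      (exchange_F_typeI P · · hl) fun σ ζ => exchange_h_typeI P ζ σ hl _ _,
    typeII_of_exchange κ (one_mul 1) (.typeIIExp P _ _ _) (exchange_E_typeII P · ·)
      (exchange_F_typeII P · ·) fun σ ζ => exchange_h_typeII P ζ σ _ _,
    typeI_of_exchange κ (.typeIExp P _ _ _) (exchange_E_typeI_twisted P · · hl)
      (exchange_F_typeI_twisted P · · hl) fun σ ζ => exchange_h_typeI P ζ σ hl _ _,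
    typeII_of_exchange κ (by norm_num) (.typeIIExp P _ _ _) (exchange_E_typeII_twisted P · · hl)
      (exchange_F_typeII_twisted P · · hl) fun σ ζ => exchange_h_typeII P ζ σ _ _⟩
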